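/- Let $p$ be a prime, let $K_1,\dots,K_m$ be finite field extensions of $\mathbb{Q}_p$ with $r_i=[K_i:\mathbb{Q}_p]$, ramification index $e_i$, ring of integers $\mathcal{O}_{K_i}$ and a uniformizer $\pi_i$, and let $E=K_1\times\cdots\times K_m$, $r=\dim_{\mathbb{Q}_p}E=r_1+\cdots+r_m$. Let $\|\cdot\|$ be the unique extension to $\overline{\mathbb{Q}}_p$ (and to each $K_i$) of the $p$-adic absolute value, $\|p\|=p^{-1}$, and let $\mathrm{val}$ be the valuation with $\|y\|=p^{-\mathrm{val}(y)}$, $\mathrm{val}(0)=\infty$. Let $\mathfrak{x}=(x_1,\dots,x_m)\in\prod_i\mathcal{O}_{K_i}$ be such that $E=\mathbb{Q}_p[\mathfrak{x}]$, and let $\mathrm{Disc}(\mathfrak{x})$ be the discriminant of the product of the minimal polynomials of $x_1,\dots,x_m$ over $\mathbb{Q}_p$. For elements $y_1,\dots,y_k$ of finite extensions $F_1,\dots,F_k$ of $\mathbb{Q}_p$, let $\Delta_\sigma(y_1,\dots,y_k)=\prod_{a<b}(z_a-z_b)$, where $z_1,z_2,\dots$ is an enumeration of all the conjugates $\sigma(y_j)$,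 $1\le j\le k$, $\sigma$ running over the $[F_j:\mathbb{Q}_p]$ embeddings of $F_j$ into $\overline{\mathbb{Q}}_p$ (its norm does not depend on the enumeration). Let $\mathrm{Mod}_{\mathbb{Z}_p[x_i]}$ be the set of $\mathbb{Z}_p[x_i]$-submodules of $K_i$ that are $\mathbb{Z}_p$-lattices of rank $r_i$, acted on by $\Lambda_{K_i}=\pi_i^{\mathbb{Z}}\subset K_i^\times$ by multiplication. Theorem. The sets $\Lambda_{K_i}\backslash\mathrm{Mod}_{\mathbb{Z}_p[x_i]}$ are finite. Put $$V(x_i)=\frac{\#\bigl(\Lambda_{K_i}\backslash\mathrm{Mod}_{\mathbb{Z}_p[x_i]}\bigr)\,\|\Delta_\sigma(x_i)\|}{1-p^{-r_i/e_i}}.$$ Let $A\in\mathrm{Mat}_r(\mathbb{Z}_p)$ be distributed according to the additive Haar probability measure $\mathbf{P}$, with characteristic polynomial $P_A(t)=\det(t-A)$. Then for all tuples $(s_1,\dots,s_m)$ with $s_i\in\frac1{e_i}\mathbb{N}$ and $s_i>r\,\mathrm{val}\,\mathrm{Disc}(\mathfrak{x})$ for all $i$, $$\prod_{i=1}^m p^{s_ir_i}\cdot\mathbf{P}\bigl(\mathrm{val}\,P_A(x_i)\ge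 s_i\ \ \forall\,1\le i\le m\bigr)=\frac{(1-p^{-1})(1-p^{-2})\cdots(1-p^{-r})}{\|\Delta_\sigma(x_1,\dots,x_m)\|}\prod_{i=1}^m V(x_i).$$ -/

import Mathlib

open scoped Pointwise
open MeasureTheory

noncomputable section

namespace PadicEtale

/-! ### Norm and valuation on algebraic extensions of `ℚ_p` -/

/-- The unique extension to `L` of the `p`-adic absolute value `‖·‖` (normalised by `‖p‖ = p⁻¹`). -/
def absVal (p : ℕ) [Fact p.Prime] {L : Type*} [Field L] [Algebra ℚ_[p] L] (y : L) : ℝ :=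
  spectralNorm ℚ_[p] L y

open Classical in
/-- The valuation `val` with `‖y‖ = p ^ (- val y)`, `val p = 1` and `val 0 = ∞`. -/
def val (p : ℕ) [Fact p.Prime] {L : Type*} [Field L] [Algebra ℚ_[p] L] (y : L) : EReal :=
  if y = 0 then ⊤ else ((-Real.logb p (absVal p y) : ℝ) : EReal)

/-! ### Rings of integers, ramification, uniformizers -/

section Integers

variable (p : ℕ) [Fact p.Prime] (K : Type*) [Field K] [Algebra ℚ_[p] K] [Algebra ℤ_[p] K]

/-- The ring of integers `𝓞_K`. -/
abbrev integers : Subalgebra ℤ_[p] K := integralClosure ℤ_[p] K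

variable [IsScalarTower ℤ_[p] ℚ_[p] K] [FiniteDimensional ℚ_[p] K]

theorem mem_integers_iff (y : K) : y ∈ integers p K ↔ spectralNorm ℚ_[p] K y ≤ 1 := by
  have hy : IsIntegral ℚ_[p] y := Algebra.IsIntegral.isIntegral y
  rw [spectralNorm, spectralValue_le_one_iff (minpoly.monic hy)]
  constructor
  · intro h n
    have h' : IsIntegral ℤ_[p] y := h
    rw [minpoly.isIntegrallyClosed_eq_field_fractions' ℚ_[p] h', Polynomial.coeff_map]
    exact PadicInt.norm_le_one _
  · intro h
    have hl : minpoly ℚ_[p] y ∈ Polynomial.lifts (algebraMap ℤ_[p] ℚ_[p]) := by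
      rw [Polynomial.lifts_iff_coeff_lifts]
      intro n
      exact ⟨⟨_, h n⟩, rfl⟩
    obtain ⟨q, hq, -, hqm⟩ := Polynomial.lifts_and_degree_eq_and_monic hl (minpoly.monic hy)
    refine ⟨q, hqm, ?_⟩
    have h0 := minpoly.aeval ℚ_[p] y
    rw [← hq, Polynomial.aeval_map_algebraMap] at h0
    exact h0

instance : IsLocalRing (integers p K) := by
  have hu : ∀ a : integers p K, a ∈ nonunits _ ↔ spectralNorm ℚ_[p] K (a : K) < 1 := by
    intro a
    have ha := (mem_integers_iff p K a).1 a.2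
    rw [mem_nonunits_iff, ← not_le, not_iff_not]
    have hmul : ∀ b c : K, spectralNorm ℚ_[p] K (b * c) =
        spectralNorm ℚ_[p] K b * spectralNorm ℚ_[p] K c := fun b c =>
      spectralAlgNorm_mul (K := ℚ_[p]) (L := K) b c
    constructor
    · rintro ⟨u, rfl⟩
      have h1 : ((u : integers p K) : K) * ((u⁻¹ : (integers p K)ˣ) : integers p K) = 1 := by
        exact_mod_cast congrArg (Subtype.val) u.mul_inv
      have h2 := hmul ((u : integers p K) : K) ((u⁻¹ : (integers p K)ˣ) : integers p K)
      rw [h1, spectralNorm_one] at h2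
      have h3 := (mem_integers_iff p K _).1 ((u⁻¹ : (integers p K)ˣ) : integers p K).2
      have h4 := spectralNorm_nonneg (K := ℚ_[p]) ((u : integers p K) : K)
      nlinarith
    · intro h
      have h0 : (a : K) ≠ 0 := by
        intro h0
        rw [h0, spectralNorm_zero] at h
        linarith
      have h1 : spectralNorm ℚ_[p] K ((a : K)⁻¹) ≤ 1 := by
        have h2 := hmul (a : K) (a : K)⁻¹
        rw [mul_inv_cancel₀ h0, spectralNorm_one] at h2
        have h4 := spectralNorm_nonneg (K := ℚ_[p]) ((a : K)⁻¹)
        nlinarith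
      refine IsUnit.of_mul_eq_one ⟨(a : K)⁻¹, (mem_integers_iff p K _).2 h1⟩ ?_
      exact Subtype.ext (mul_inv_cancel₀ h0)
  refine IsLocalRing.of_nonunits_add fun a b ha hb => ?_
  rw [hu] at ha hb ⊢
  exact lt_of_le_of_lt (isNonarchimedean_spectralNorm (K := ℚ_[p]) (L := K) _ _) (max_lt ha hb)

/-- The ramification index `e` of `K / ℚ_p`. -/
def ramIndex : ℕ :=
  (IsLocalRing.maximalIdeal ℤ_[p]).ramificationIdx' (IsLocalRing.maximalIdeal (integers p K))

variable {K}

/-- `π` is a uniformizer: it is integral and generates the maximal ideal of `𝓞_K`. -/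
def IsUniformizer (π : Kˣ) : Prop :=
  ∃ h : (π : K) ∈ integers p K,
    Ideal.span {(⟨π, h⟩ : integers p K)} = IsLocalRing.maximalIdeal (integers p K)

end Integers

/-! ### Lattices stable under `ℤ_p[x]` and their orbits -/

section Lattices

variable (p : ℕ) [Fact p.Prime] {E : Type*} [CommRing E] [Algebra ℚ_[p] E] [Algebra ℤ_[p] E]
  [IsScalarTower ℤ_[p] ℚ_[p] E]

/-- `Mod_{ℤ_p[x]}`: the `ℤ_p[x]`-submodules of `E` that are (full) `ℤ_p`-lattices in `E`. -/
def LatticeMod (x : E) : Type _ :=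
  {M : Submodule (Algebra.adjoin ℤ_[p] {x}) E //
    Submodule.IsLattice ℚ_[p] (M.restrictScalars ℤ_[p])}

/-- `Eˣ` acts on `Mod_{ℤ_p[x]}` by `u • M = {u * y | y ∈ M}`. -/
instance (x : E) : MulAction Eˣ (LatticeMod p x) where
  smul u M := ⟨u • M.1, by
    obtain ⟨M, hM⟩ := M
    let f : E ≃ₗ[ℚ_[p]] E := DistribMulAction.toLinearEquiv ℚ_[p] E u
    have hmap : (u • M).restrictScalars ℤ_[p] =
        (M.restrictScalars ℤ_[p]).map ((f : E →ₗ[ℚ_[p]] E).restrictScalars ℤ_[p]) := rfl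
    have hset : ((u • M : Submodule (Algebra.adjoin ℤ_[p] {x}) E) : Set E) =
        (f : E →ₗ[ℚ_[p]] E) '' (M : Set E) := rfl
    have hspan : Submodule.span ℚ_[p] (M : Set E) = ⊤ := hM.span_eq_top
    refine ⟨?_, ?_⟩
    · rw [hmap]
      exact hM.fg.map _
    · change Submodule.span ℚ_[p] ((u • M : Submodule (Algebra.adjoin ℤ_[p] {x}) E) : Set E) = ⊤
      rw [hset, Submodule.span_image, hspan, Submodule.map_top]
      exact LinearEquiv.range f⟩
  one_smul M := Subtype.ext (one_smul _ M.1)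
  mul_smul u v M := Subtype.ext (mul_smul u v M.1)

/-- The set of orbits `π^ℤ \ Mod_{ℤ_p[x]}`. -/
abbrev LatticeOrbits (π : Eˣ) (x : E) : Type _ :=
  MulAction.orbitRel.Quotient (Subgroup.zpowers π) (LatticeMod p x)

end Lattices

/-! ### Discriminants and `Δ_σ` -/

/-- The Vandermonde product `∏_{a < b} (y_a - y_b)`. -/
def vandermondeProd {F : Type*} [CommRing F] {n : ℕ} (y : Fin n → F) : F :=
  ∏ a, ∏ b ∈ Finset.Ioi a, (y a - y b)

section Conjugates

variable (p : ℕ) [Fact p.Prime] {ι : Type*} [Finite ι] {K : ι → Type*} [∀ i, Field (K i)]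
  [∀ i, Algebra ℚ_[p] (K i)] [∀ i, FiniteDimensional ℚ_[p] (K i)]

/-- `Δ_σ(x_1, …, x_m)`: the Vandermonde product of all the conjugates `σ(x_i)`, where for each `i`
the map `σ` runs over the `[K_i : ℚ_p]` embeddings of `K_i` into the algebraic closure of `ℚ_p`.
The conjugates are enumerated in some order, which affects only the sign. -/
def deltaSigma (x : ∀ i, K i) : PadicAlgCl p :=
  vandermondeProd fun a =>
    let c := (Finite.equivFin (Σ i, K i →ₐ[ℚ_[p]] PadicAlgCl p)).symm a
    c.2 (x c.1)

end Conjugates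

/-- The discriminant of `(x_1, …, x_m)`: the discriminant of the product of the minimal polynomials
of the `x_i`. -/
def disc (p : ℕ) [Fact p.Prime] {ι : Type*} [Fintype ι] {K : ι → Type*} [∀ i, Field (K i)]
    [∀ i, Algebra ℚ_[p] (K i)] (x : ∀ i, K i) : ℚ_[p] :=
  (∏ i, minpoly ℚ_[p] (x i)).discr

/-- `V(x) = #(π^ℤ \ Mod_{ℤ_p[x]}) · ‖Δ_σ(x)‖ / (1 - p^{-f})`, where `f = [K : ℚ_p] / e`. -/
def V (p : ℕ) [Fact p.Prime] {K : Type*} [Field K] [Algebra ℚ_[p] K] [Algebra ℤ_[p] K]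
    [IsScalarTower ℤ_[p] ℚ_[p] K] [FiniteDimensional ℚ_[p] K] (π : Kˣ) (x : K) : ℝ :=
  (Nat.card (LatticeOrbits p π x) : ℝ) * ‖deltaSigma p (fun _ : Unit => x)‖ /
    (1 - (p : ℝ) ^ (-((Module.finrank ℚ_[p] K : ℝ) / (ramIndex p K : ℝ))))

end PadicEtale

end

noncomputable section

set_option linter.unusedSectionVars false

namespace PadicEtale

section

open Measure Metric
open scoped ENNReal

/-! ### Haar measure on `ℚ_p`-vector spaces -/

section Scale

variable {X Y : Type*} [AddCommGroup X] [TopologicalSpace X] [IsTopologicalAddGroup X]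
  [MeasurableSpace X] [BorelSpace X]
  [AddCommGroup Y] [TopologicalSpace Y] [IsTopologicalAddGroup Y]
  [LocallyCompactSpace Y] [SecondCountableTopology Y] [MeasurableSpace Y] [BorelSpace Y]

/-! The law of the characteristic polynomial of `A` is computed by adjoining a random row vector `v`
and studying the matrix `B = krylov A v` with rows `v A^k`. Where `B` is invertible, it determines
(`A`, `v`) together with the characteristic coefficients `a`, because `B A = (comp a) B`. Replacing
(`A`, `v`) by (`g⁻¹ A g`, `v g`) fixes `a`, multiplies `B` by `g` on the right and scales volume by
`|det g|`. So on the event that `a` lies in `S0` the law of `B` has density `vol(S0) |det B|^(1-r)`,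
and `H GL_r(ℤ_p)` receives the mass `|det H| vol(S0) vol(GL_r(ℤ_p))` (`krylovMeasure_mul_IntGL`).

Let `S0` consist of the coefficients of the monic polynomials of size at most `ρ_i = p^(-s_i)` at
`x_i`. By Hensel's lemma (`Sep.exists_root`) the characteristic polynomial of such an `A` has a root
`y ∈ E` so close to `x` that `x` and `y` stabilise the same normalized lattices. Then `A` is
multiplication by `y` in suitable coordinates `φ : E ≃ ℚ_p^r`, and `krylov A v` lies in the coset
attached to a lattice `M` exactly when `v = φ e` with `e` invertible and `e M = Λ`, where `Λ =
φ⁻¹(ℤ_p^r)`. If `A` is integral, each `e` with suitable absolute values meets exactly one normalized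
stable lattice; otherwise no lattice occurs. Weighting by the Haar measure `ν M` and summing over
`M` gives `ν {‖e_i‖ = 1}`, independently of `A` (`sum_measure_krylov`). Integrating over `A` in two
ways yields `volume_charpoly_small`: the probability times `ν {‖e_i‖ = 1}` is the number of
normalized stable lattices of `E`, times `vol(GL_r(ℤ_p))`, times `ν {‖e_i‖ ≤ ρ_i}`.

The quotient of the two `ν`-volumes is `∏ p^(-s_i r_i) / (1 - p^(-r_i/e_i))`, and `vol(GL_r(ℤ_p)) =
∏ (1 - p^(-k))`. What remains is a product formula for lattices: their number in `E` times `‖Δ(x)‖`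
is the product over `i` of the number in `K_i` times `‖Δ(x_i)‖`
(`ncard_normLat_mul_norm_deltaSigma`). Factors are split off one at a time. A stable lattice is an
extension of its image in the first factor by its kernel, and the number of extensions is the
inverse absolute value of a resultant (`ncard_fiberSet`), which is the mixed part of `Δ`. In a
single field every orbit of `π^ℤ` contains exactly one normalized lattice (`card_latticeOrbits`).

The lower bound on `s_i` enters only through `d = √‖Disc(x)‖`: it gives `ρ_i < d²`, needed for
Hensel's lemma, and `ρ_i ≤ d³`, needed to identify the lattices for `x` and `y`. -/

theorem exists_scale (f : X ≃ₜ+ Y) (μ : Measure X) [μ.IsAddHaarMeasure] (ν : Measure Y)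
    [ν.IsAddHaarMeasure] :
    ∃ c : ℝ≥0∞, c ≠ 0 ∧ c ≠ ∞ ∧ ∀ U : Set X, ν (f '' U) = c * μ U := by
  have : (μ.map f).IsAddHaarMeasure := f.isAddHaarMeasure_map μ
  refine ⟨addHaarScalarFactor ν (μ.map f), ?_, ENNReal.coe_ne_top, fun U => ?_⟩
  · exact_mod_cast (addHaarScalarFactor_pos_of_isAddHaarMeasure ν (μ.map f)).ne'
  · have h := isAddLeftInvariant_eq_smul ν (μ.map f)
    have h2 : (μ.map f) (f '' U) = μ U := by
      rw [show (f : X → Y) = f.toHomeomorph.toMeasurableEquiv from rfl, MeasurableEquiv.map_apply]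
      congr 1
      exact Set.preimage_image_eq _ f.injective
    conv_lhs => rw [h]
    rw [Measure.smul_apply, h2]
    rfl

end Scale

variable {p : ℕ} [Fact p.Prime]

instance instMeasurableSpacePadic : MeasurableSpace ℚ_[p] := borel _

instance instBorelSpacePadic : BorelSpace ℚ_[p] := ⟨rfl⟩

theorem isOpen_unitBall : IsOpen (closedBall (0 : ℚ_[p]) 1) :=
  IsUltrametricDist.isOpen_closedBall _ one_ne_zero

/-- The Haar measure on `ℚ_p` giving mass `1` to `ℤ_p`. -/
instance instMeasureSpacePadic : MeasureSpace ℚ_[p] where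
  volume := addHaarMeasure ⟨⟨closedBall 0 1, isCompact_closedBall _ _⟩, by
    rw [isOpen_unitBall.interior_eq]; exact ⟨0, by simp⟩⟩

instance instHaarPadic : (volume : Measure ℚ_[p]).IsAddHaarMeasure :=
  isAddHaarMeasure_addHaarMeasure _

theorem volume_unitBall : volume (closedBall (0 : ℚ_[p]) 1) = 1 :=
  addHaarMeasure_self

/-! ### Volume scaling of row vectors under `GL_n(ℚ_p)`. -/

section Vec

variable {n : ℕ}

theorem volume_vecBall : volume (closedBall (0 : Fin n → ℚ_[p]) 1) = 1 := by
  rw [closedBall_pi _ zero_le_one, volume_pi_pi]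
  simp only [Pi.zero_apply, volume_unitBall, Finset.prod_const_one]

instance instHaarVec : (volume : Measure (Fin n → ℚ_[p])).IsAddHaarMeasure :=
  inferInstance

instance instMeasureSpaceMat : MeasureSpace (Matrix (Fin n) (Fin n) ℚ_[p]) :=
  inferInstanceAs (MeasureSpace (Fin n → Fin n → ℚ_[p]))

instance instBorelMat : BorelSpace (Matrix (Fin n) (Fin n) ℚ_[p]) :=
  inferInstanceAs (BorelSpace (Fin n → Fin n → ℚ_[p]))

instance instLCMat : LocallyCompactSpace (Matrix (Fin n) (Fin n) ℚ_[p]) :=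
  inferInstanceAs (LocallyCompactSpace (Fin n → Fin n → ℚ_[p]))

instance instSCMat : SecondCountableTopology (Matrix (Fin n) (Fin n) ℚ_[p]) :=
  inferInstanceAs (SecondCountableTopology (Fin n → Fin n → ℚ_[p]))

instance instHaarMat : (volume : Measure (Matrix (Fin n) (Fin n) ℚ_[p])).IsAddHaarMeasure :=
  have : (volume : Measure (Fin n → Fin n → ℚ_[p])).IsAddHaarMeasure :=
    Measure.pi.isAddHaarMeasure fun _ : Fin n => (volume : Measure (Fin n → ℚ_[p]))
  this

/-- The continuous additive equivalence underlying a linear one. -/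
def contEquiv {X Y : Type*} [AddCommGroup X] [TopologicalSpace X] [IsTopologicalAddGroup X]
    [Module ℚ_[p] X] [ContinuousSMul ℚ_[p] X] [FiniteDimensional ℚ_[p] X] [T2Space X]
    [AddCommGroup Y] [TopologicalSpace Y] [IsTopologicalAddGroup Y]
    [Module ℚ_[p] Y] [ContinuousSMul ℚ_[p] Y] [FiniteDimensional ℚ_[p] Y] [T2Space Y]
    (f : X ≃ₗ[ℚ_[p]] Y) : X ≃ₜ+ Y :=
  { f.toAddEquiv with
    continuous_toFun := (f : X →ₗ[ℚ_[p]] Y).continuous_of_finiteDimensional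
    continuous_invFun := (f.symm : Y →ₗ[ℚ_[p]] X).continuous_of_finiteDimensional }

/-- The unit ball `ℤ_p^n`. -/
def L0 (p n : ℕ) [Fact p.Prime] : Set (Fin n → ℚ_[p]) := {v | ∀ i, ‖v i‖ ≤ 1}

theorem L0_eq : L0 p n = closedBall 0 1 := by
  ext v
  simp [L0, pi_norm_le_iff_of_nonneg]

theorem volume_L0 : volume (L0 p n) = 1 := by rw [L0_eq, volume_vecBall]

/-- Right multiplication of row vectors by an invertible matrix. -/
def rowMul (g : GL (Fin n) ℚ_[p]) : (Fin n → ℚ_[p]) ≃ₗ[ℚ_[p]] (Fin n → ℚ_[p]) where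
  toFun v := Matrix.vecMul v g.1
  map_add' := fun v w => Matrix.add_vecMul _ _ _
  map_smul' := fun c v => Matrix.smul_vecMul _ _ _
  invFun v := Matrix.vecMul v (g⁻¹).1
  left_inv v := by
    simp only [Matrix.vecMul_vecMul, ← Units.val_mul, mul_inv_cancel, Units.val_one, Matrix.vecMul_one]
  right_inv v := by
    simp only [Matrix.vecMul_vecMul, ← Units.val_mul, inv_mul_cancel, Units.val_one, Matrix.vecMul_one]

@[simp] theorem rowMul_apply (g : GL (Fin n) ℚ_[p]) (v : Fin n → ℚ_[p]) :
    rowMul g v = Matrix.vecMul v g.1 := rfl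

/-- The factor by which right multiplication by `g` scales volumes of row vectors. -/
def rowScale (g : GL (Fin n) ℚ_[p]) : ℝ≥0∞ := volume (rowMul g '' L0 p n)

theorem rowScale_spec (g : GL (Fin n) ℚ_[p]) :
    rowScale g ≠ 0 ∧ rowScale g ≠ ∞ ∧
      ∀ U : Set (Fin n → ℚ_[p]), volume (rowMul g '' U) = rowScale g * volume U := by
  obtain ⟨c, h0, ht, h⟩ := exists_scale (contEquiv (rowMul g)) volume volume
  have hc : rowScale g = c := by
    have := h (L0 p n)
    rw [volume_L0, mul_one] at this
    exact this
  rw [hc]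
  exact ⟨h0, ht, h⟩

theorem volume_rowMul_image (g : GL (Fin n) ℚ_[p]) (U : Set (Fin n → ℚ_[p])) :
    volume (rowMul g '' U) = rowScale g * volume U := (rowScale_spec g).2.2 U

theorem rowScale_mul (g h : GL (Fin n) ℚ_[p]) : rowScale (g * h) = rowScale g * rowScale h := by
  have : rowMul (g * h) '' L0 p n = rowMul h '' (rowMul g '' L0 p n) := by
    rw [← Set.image_comp]
    congr 1
    ext1 v
    simp [Matrix.vecMul_vecMul]
  rw [rowScale, this, volume_rowMul_image, mul_comm]
  rfl

theorem rowScale_one : rowScale (1 : GL (Fin n) ℚ_[p]) = 1 := by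
  have : rowMul (1 : GL (Fin n) ℚ_[p]) '' L0 p n = L0 p n := by
    convert Set.image_id _ using 2
    ext1 v
    simp
  rw [rowScale, this, volume_L0]

/-- The transpose of an invertible matrix. -/
def glTranspose (g : GL (Fin n) ℚ_[p]) : GL (Fin n) ℚ_[p] where
  val := g.1.transpose
  inv := (g⁻¹).1.transpose
  val_inv := by rw [← Matrix.transpose_mul, ← Units.val_mul]; simp
  inv_val := by rw [← Matrix.transpose_mul, ← Units.val_mul]; simp

theorem integral_vecMul {v : Fin n → ℚ_[p]} {A : Matrix (Fin n) (Fin n) ℚ_[p]}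
    (hv : v ∈ L0 p n) (hA : ∀ i j, ‖A i j‖ ≤ 1) : Matrix.vecMul v A ∈ L0 p n := by
  intro j
  change ‖∑ i, v i * A i j‖ ≤ 1
  refine IsUltrametricDist.norm_sum_le_of_forall_le_of_nonneg zero_le_one fun i _ => ?_
  rw [norm_mul]
  exact mul_le_one₀ (hv i) (norm_nonneg _) (hA i j)

theorem rowScale_eq_one_of_integral {g : GL (Fin n) ℚ_[p]} (h : ∀ i j, ‖g.1 i j‖ ≤ 1)
    (h' : ∀ i j, ‖(g⁻¹).1 i j‖ ≤ 1) : rowScale g = 1 := by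
  have : rowMul g '' L0 p n = L0 p n := by
    apply Set.Subset.antisymm
    · rintro _ ⟨v, hv, rfl⟩
      exact integral_vecMul hv h
    · intro v hv
      refine ⟨_, integral_vecMul hv h', ?_⟩
      simp [Matrix.vecMul_vecMul]
  rw [rowScale, this, volume_L0]

/-- Powers of a transvection multiply its parameter, so for large `k` the `p^k`-th power and its
inverse are integral and preserve `ℤ_p^n`. The scale is multiplicative, and a nonnegative real
number with a power equal to `1` is `1`. -/
theorem rowScale_transvection {i j : Fin n} (hij : i ≠ j) (c : ℚ_[p]) (g : GL (Fin n) ℚ_[p])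
    (hg : g.1 = Matrix.transvection i j c) : rowScale g = 1 := by
  have hunit : ∀ c : ℚ_[p], Matrix.transvection i j c * Matrix.transvection i j (-c) = 1 := by
    intro c
    rw [Matrix.transvection_mul_transvection_same i j hij]
    simp
  let T : ℚ_[p] → GL (Fin n) ℚ_[p] := fun c =>
    ⟨Matrix.transvection i j c, Matrix.transvection i j (-c), hunit c, by simpa using hunit (-c)⟩
  have hpow : ∀ m : ℕ, T c ^ m = T (m * c) := by
    intro m
    induction m with
    | zero => ext1; simp [T]
    | succ m ih =>
      rw [pow_succ, ih]
      ext1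
      simp only [T, Units.val_mul]
      rw [Matrix.transvection_mul_transvection_same i j hij]
      push_cast
      ring_nf
  obtain ⟨k, hk⟩ : ∃ k : ℕ, ‖((p ^ k : ℕ) : ℚ_[p]) * c‖ ≤ 1 := by
    obtain ⟨k, hk⟩ := exists_nat_gt ‖c‖
    refine ⟨k, ?_⟩
    have hp : (1 : ℝ) < p := by exact_mod_cast (Fact.out : p.Prime).one_lt
    have : ‖c‖ ≤ (p : ℝ) ^ k := by
      refine hk.le.trans ?_
      exact_mod_cast (Nat.lt_pow_self (Fact.out : p.Prime).one_lt).le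
    rw [norm_mul, Nat.cast_pow, norm_pow, Padic.norm_p, inv_pow]
    rwa [inv_mul_le_iff₀ (by positivity), mul_one]
  have hint : ∀ c : ℚ_[p], ‖c‖ ≤ 1 → ∀ a b, ‖(Matrix.transvection i j c) a b‖ ≤ 1 := by
    intro c hc a b
    rw [Matrix.transvection, Matrix.add_apply]
    refine (IsUltrametricDist.norm_add_le_max _ _).trans (max_le ?_ ?_)
    · rw [Matrix.one_apply]; split_ifs <;> simp
    · rw [Matrix.single_apply]; split_ifs <;> simp [hc]
  have h1 : rowScale (T ((p ^ k : ℕ) * c)) = 1 :=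
    rowScale_eq_one_of_integral (hint _ hk) (hint (-_) (by rwa [norm_neg]))
  have h2 : ∀ m : ℕ, rowScale (T c ^ m) = rowScale (T c) ^ m := by
    intro m
    induction m with
    | zero => simp [rowScale_one]
    | succ m ih => rw [pow_succ, pow_succ, rowScale_mul, ih]
  have hg' : g = T c := Units.ext hg
  rw [← hpow, h2, ← hg'] at h1
  have hne : p ^ k ≠ 0 := (pow_pos (Fact.out : p.Prime).pos k).ne'
  have h3 : (rowScale g).toReal ^ p ^ k = 1 := by rw [← ENNReal.toReal_pow, h1, ENNReal.toReal_one]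
  have h4 := (pow_eq_one_iff_of_nonneg ENNReal.toReal_nonneg hne).1 h3
  rw [← ENNReal.ofReal_toReal (rowScale_spec g).2.1, h4, ENNReal.ofReal_one]

/-- Invertible matrices are products of diagonal matrices and transvections, and the scale is
multiplicative with commuting values, so reversing the order of the factors is harmless. This makes
left and right multiplication scale matrix volumes alike. -/
theorem rowScale_transpose (g : GL (Fin n) ℚ_[p]) : rowScale (glTranspose g) = rowScale g := by
  suffices H : ∀ M : Matrix (Fin n) (Fin n) ℚ_[p], M.det ≠ 0 →
      ∀ g : GL (Fin n) ℚ_[p], g.1 = M → rowScale (glTranspose g) = rowScale g by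
    refine H g.1 ?_ g rfl
    exact ((Matrix.isUnit_iff_isUnit_det _).1 g.isUnit).ne_zero
  intro M hM
  refine Matrix.diagonal_transvection_induction_of_det_ne_zero
    (fun M => ∀ g : GL (Fin n) ℚ_[p], g.1 = M → rowScale (glTranspose g) = rowScale g) M hM ?_ ?_ ?_
  · intro D _ g hg
    congr 1
    ext1
    simp [glTranspose, hg]
  · intro t g hg
    rw [rowScale_transvection t.hij t.c g hg, rowScale_transvection t.hij.symm t.c]
    simp only [glTranspose, hg, Matrix.TransvectionStruct.toMatrix, Matrix.transvection,
      Matrix.transpose_add, Matrix.transpose_one, Matrix.transpose_single]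
  · intro A B hA hB hPA hPB g hg
    let gA : GL (Fin n) ℚ_[p] := Matrix.GeneralLinearGroup.mkOfDetNeZero A hA
    let gB : GL (Fin n) ℚ_[p] := Matrix.GeneralLinearGroup.mkOfDetNeZero B hB
    have h1 : g = gA * gB := Units.ext hg
    have h2 : glTranspose g = glTranspose gB * glTranspose gA := by
      rw [h1]
      ext1
      simp [glTranspose, Matrix.transpose_mul]
    rw [h2, rowScale_mul, hPA gA rfl, hPB gB rfl, h1, rowScale_mul, mul_comm]

end Vec

end

section

open Metric
open scoped ENNReal

/-! ### Krylov matrices and companion matrices -/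

section Krylov

variable {R S : Type*} [CommRing R] [CommRing S] {n m : ℕ}

/-- The matrix with rows `v, v A, v A², …`. -/
def krylov (A : Matrix (Fin n) (Fin n) R) (v : Fin n → R) : Matrix (Fin n) (Fin n) R :=
  Matrix.of fun k => Matrix.vecMul v (A ^ (k : ℕ))

/-- The coefficients `a_k` in `det (t - A) = t ^ n - ∑ a_k t ^ k`. -/
def charCoeff (A : Matrix (Fin n) (Fin n) R) : Fin n → R := fun k => -A.charpoly.coeff k

/-- The companion matrix acting on row vectors. -/
def comp (a : Fin (m + 1) → R) : Matrix (Fin (m + 1)) (Fin (m + 1)) R :=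
  Matrix.of (Fin.snoc (α := fun _ => Fin (m + 1) → R) (fun k : Fin m => Pi.single k.succ 1) a)

theorem comp_castSucc (a : Fin (m + 1) → R) (k : Fin m) :
    comp a k.castSucc = Pi.single k.succ 1 := by
  change Fin.snoc (α := fun _ => Fin (m + 1) → R) (fun k : Fin m => Pi.single k.succ 1) a
    k.castSucc = _
  rw [Fin.snoc_castSucc]

theorem comp_last (a : Fin (m + 1) → R) : comp a (Fin.last m) = a := by
  change Fin.snoc (α := fun _ => Fin (m + 1) → R) (fun k : Fin m => Pi.single k.succ 1) a
    (Fin.last m) = _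
  rw [Fin.snoc_last]

theorem krylov_apply (A : Matrix (Fin n) (Fin n) R) (v : Fin n → R) (k : Fin n) :
    krylov A v k = Matrix.vecMul v (A ^ (k : ℕ)) := rfl

theorem vecMul_map (f : R →+* S) (v : Fin n → R) (A : Matrix (Fin n) (Fin n) R) (j : Fin n) :
    Matrix.vecMul (fun i => f (v i)) (A.map f) j = f (Matrix.vecMul v A j) := by
  simp [Matrix.vecMul, dotProduct]

theorem map_pow_matrix (f : R →+* S) (A : Matrix (Fin n) (Fin n) R) (k : ℕ) :
    (A ^ k).map f = A.map f ^ k := by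
  have := map_pow f.mapMatrix A k
  simpa using this

theorem krylov_map (f : R →+* S) (A : Matrix (Fin n) (Fin n) R) (v : Fin n → R) :
    krylov (A.map f) (fun i => f (v i)) = (krylov A v).map f := by
  ext k j
  rw [Matrix.map_apply, krylov_apply, krylov_apply, ← map_pow_matrix, vecMul_map]

theorem charCoeff_map (f : R →+* S) (A : Matrix (Fin n) (Fin n) R) (k : Fin n) :
    charCoeff (A.map f) k = f (charCoeff A k) := by
  simp [charCoeff, Matrix.charpoly_map]

theorem comp_map (f : R →+* S) (a : Fin (m + 1) → R) :
    (comp a).map f = comp fun i => f (a i) := by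
  ext k j
  induction k using Fin.lastCases with
  | last => rw [Matrix.map_apply, comp_last, comp_last]
  | cast k =>
    rw [Matrix.map_apply, comp_castSucc, comp_castSucc]
    simp only [Pi.single_apply]
    split_ifs <;> simp

theorem pow_eq_sum [Nontrivial R] (A : Matrix (Fin n) (Fin n) R) :
    A ^ n = ∑ k : Fin n, charCoeff A k • A ^ (k : ℕ) := by
  have h := A.aeval_self_charpoly
  rw [A.charpoly_monic.as_sum, A.charpoly_natDegree_eq_dim, Fintype.card_fin] at h
  simp only [map_add, map_sum, map_pow, map_mul, Polynomial.aeval_X, Polynomial.aeval_C] at h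
  rw [eq_neg_of_add_eq_zero_left h, ← Fin.sum_univ_eq_sum_range
    (fun i => algebraMap R (Matrix (Fin n) (Fin n) R) (A.charpoly.coeff i) * A ^ i),
    ← Finset.sum_neg_distrib]
  refine Finset.sum_congr rfl fun k _ => ?_
  rw [charCoeff, neg_smul, Algebra.smul_def]

theorem vecMul_pow_eq [Nontrivial R] (A : Matrix (Fin n) (Fin n) R) (v : Fin n → R) :
    Matrix.vecMul v (A ^ n) = Matrix.vecMul (charCoeff A) (krylov A v) := by
  rw [pow_eq_sum]
  ext j
  rw [Matrix.vecMul_sum, Finset.sum_apply]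
  simp only [Matrix.vecMul_smul, Pi.smul_apply, smul_eq_mul]
  rfl

/-- Multiplication by `A` shifts the rows `v A^k`, and Cayley–Hamilton expresses the last shifted
row through the others. When the Krylov matrix is invertible, `A` is recovered from it and the
characteristic coefficients. -/
theorem krylov_mul [Nontrivial R] (A : Matrix (Fin (m + 1)) (Fin (m + 1)) R)
    (v : Fin (m + 1) → R) : krylov A v * A = comp (charCoeff A) * krylov A v := by
  ext k j
  rw [Matrix.mul_apply_eq_vecMul, Matrix.mul_apply_eq_vecMul]
  refine congrFun (?_ : Matrix.vecMul (krylov A v k) A =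
    Matrix.vecMul (comp (charCoeff A) k) (krylov A v)) j
  rw [krylov_apply, Matrix.vecMul_vecMul, ← pow_succ]
  induction k using Fin.lastCases with
  | last => rw [comp_last, ← vecMul_pow_eq, Fin.val_last]
  | cast k => rw [comp_castSucc, Matrix.single_one_vecMul]; rfl

theorem krylov_comp (a : Fin (m + 1) → R) : krylov (comp a) (Pi.single 0 1) = 1 := by
  have h : ∀ k : ℕ, ∀ hk : k < m + 1, Matrix.vecMul (Pi.single 0 1) (comp a ^ k) =
      (Pi.single ⟨k, hk⟩ 1 : Fin (m + 1) → R) := by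
    intro k
    induction k with
    | zero => intro _; simp
    | succ k ih =>
      intro hk
      rw [pow_succ, ← Matrix.vecMul_vecMul, ih (by omega), Matrix.single_one_vecMul]
      exact comp_castSucc a ⟨k, by omega⟩
  ext k j
  rw [krylov_apply, h k k.2, Matrix.one_apply, Pi.single_apply]
  simp [eq_comm]

theorem charCoeff_comp [Nontrivial R] (a : Fin (m + 1) → R) : charCoeff (comp a) = a := by
  have h := vecMul_pow_eq (comp a) (Pi.single 0 1)
  rw [krylov_comp, Matrix.vecMul_one, pow_succ, ← Matrix.vecMul_vecMul] at h
  have h2 : Matrix.vecMul (Pi.single 0 1) (comp a ^ m) = krylov (comp a) (Pi.single 0 1)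
    (Fin.last m) := rfl
  rw [h2, krylov_comp] at h
  rw [← h]
  have : (1 : Matrix (Fin (m + 1)) (Fin (m + 1)) R) (Fin.last m) = Pi.single (Fin.last m) 1 := by
    ext j; rw [Matrix.one_apply, Pi.single_apply]; simp [eq_comm]
  rw [this, Matrix.single_one_vecMul]
  exact comp_last a

/-- With the invariance of `charCoeff`, this equivariance propagates the law of Krylov matrices from
a neighbourhood of `1` to all of `GL_n(ℚ_p)`. -/
theorem krylov_conj (A : Matrix (Fin n) (Fin n) R) (v : Fin n → R) (g : GL (Fin n) R) :
    krylov ((g⁻¹).1 * A * g.1) (Matrix.vecMul v g.1) = krylov A v * g.1 := by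
  have h : ∀ k : ℕ, g.1 * ((g⁻¹).1 * A * g.1) ^ k = A ^ k * g.1 := by
    intro k
    induction k with
    | zero => simp
    | succ k ih =>
      rw [pow_succ, ← mul_assoc, ih, pow_succ]
      simp only [mul_assoc]
      rw [← mul_assoc g.1, ← Units.val_mul]
      simp
  ext k j
  rw [Matrix.mul_apply_eq_vecMul]
  rw [krylov_apply, krylov_apply, Matrix.vecMul_vecMul, Matrix.vecMul_vecMul, h]

theorem charCoeff_conj (A : Matrix (Fin n) (Fin n) R) (g : GL (Fin n) R) :
    charCoeff ((g⁻¹).1 * A * g.1) = charCoeff A := by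
  have := Matrix.charpoly_units_conj' g A
  rw [← Matrix.coe_units_inv] at this
  unfold charCoeff
  rw [this]

end Krylov

/-! ### Continuity of Krylov matrices and characteristic coefficients. -/

section Topology

variable {p : ℕ} [Fact p.Prime] {n : ℕ}

theorem continuous_krylov : Continuous fun z : Matrix (Fin n) (Fin n) ℚ_[p] × (Fin n → ℚ_[p]) =>
    krylov z.1 z.2 := by
  refine continuous_pi fun k => ?_
  exact (continuous_snd : Continuous fun z :
    Matrix (Fin n) (Fin n) ℚ_[p] × (Fin n → ℚ_[p]) => z.2).matrix_vecMul
      ((continuous_fst : Continuous fun z :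
    Matrix (Fin n) (Fin n) ℚ_[p] × (Fin n → ℚ_[p]) => z.1).pow _)

theorem continuous_charCoeff : Continuous fun A : Matrix (Fin n) (Fin n) ℚ_[p] => charCoeff A := by
  refine continuous_pi fun k => Continuous.neg ?_
  have h : ∀ A : Matrix (Fin n) (Fin n) ℚ_[p], A.charpoly.coeff k =
      MvPolynomial.eval (fun ij : Fin n × Fin n => A ij.1 ij.2)
        ((Matrix.charpoly.univ ℚ_[p] (Fin n)).coeff k) := by
    intro A
    exact (Matrix.charpoly.univ_coeff_eval₂Hom (R := ℚ_[p]) (Fin n)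
      (RingHom.id _) (fun ij : Fin n × Fin n => A ij.1 ij.2) k).symm
  simp only [h]
  exact (MvPolynomial.continuous_eval _).comp
    (continuous_pi fun ij => continuous_id.matrix_elem ij.1 ij.2)

end Topology

/-! ### Congruences -/

section Congr

variable {p : ℕ} [Fact p.Prime] {n m : ℕ}

theorem exists_lift_mat {A : Matrix (Fin n) (Fin n) ℚ_[p]} (hA : ∀ i j, ‖A i j‖ ≤ 1) :
    ∃ A0 : Matrix (Fin n) (Fin n) ℤ_[p], A0.map PadicInt.Coe.ringHom = A :=
  ⟨Matrix.of fun i j => ⟨A i j, hA i j⟩, rfl⟩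

theorem exists_lift_vec {v : Fin n → ℚ_[p]} (hv : v ∈ L0 p n) :
    ∃ v0 : Fin n → ℤ_[p], (fun i => PadicInt.Coe.ringHom (v0 i)) = v :=
  ⟨fun i => ⟨v i, hv i⟩, rfl⟩

theorem norm_sub_le_iff (N : ℕ) (x y : ℤ_[p]) :
    ‖(PadicInt.Coe.ringHom x : ℚ_[p]) - PadicInt.Coe.ringHom y‖ ≤ (p : ℝ) ^ (-N : ℤ) ↔
      PadicInt.toZModPow N x = PadicInt.toZModPow N y := by
  rw [← map_sub, ← sub_eq_zero, ← map_sub, ← RingHom.mem_ker, PadicInt.ker_toZModPow,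
    ← PadicInt.norm_le_pow_iff_mem_span_pow]
  rfl

theorem zpow_neg_le_one (N : ℕ) : (p : ℝ) ^ (-N : ℤ) ≤ 1 :=
  zpow_le_one_of_nonpos₀ (by exact_mod_cast (Fact.out : p.Prime).one_lt.le) (by simp)

theorem zpow_neg_lt_one {N : ℕ} (hN : N ≠ 0) : (p : ℝ) ^ (-N : ℤ) < 1 :=
  zpow_lt_one_of_neg₀ (by exact_mod_cast (Fact.out : p.Prime).one_lt) (by omega)

theorem norm_le_one_of_sub {x y : ℚ_[p]} {N : ℕ} (hy : ‖y‖ ≤ 1)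
    (h : ‖x - y‖ ≤ (p : ℝ) ^ (-N : ℤ)) : ‖x‖ ≤ 1 := by
  have := IsUltrametricDist.norm_add_le_max (x - y) y
  rw [sub_add_cancel] at this
  exact this.trans (max_le (h.trans (zpow_neg_le_one N)) hy)

theorem norm_single_le (i j : Fin n) : ‖(Pi.single i 1 : Fin n → ℚ_[p]) j‖ ≤ 1 := by
  rw [Pi.single_apply]; split_ifs <;> simp

theorem norm_one_le (i j : Fin n) : ‖(1 : Matrix (Fin n) (Fin n) ℚ_[p]) i j‖ ≤ 1 := by
  rw [Matrix.one_apply]; split_ifs <;> simp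

/-- The group of matrices congruent to `1` modulo `p ^ N`. -/
def Gam (p n N : ℕ) [Fact p.Prime] : Set (Matrix (Fin n) (Fin n) ℚ_[p]) :=
  {B | ∀ i j, ‖B i j - (1 : Matrix (Fin n) (Fin n) ℚ_[p]) i j‖ ≤ (p : ℝ) ^ (-N : ℤ)}

/-- The determinant is congruent to `1` modulo `p ^ N`, hence a unit because `N` is positive. -/
theorem isUnit_of_map_eq_one {N : ℕ} (hN : N ≠ 0) {B : Matrix (Fin n) (Fin n) ℤ_[p]}
    (h : B.map (PadicInt.toZModPow N) = 1) : IsUnit B := by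
  rw [Matrix.isUnit_iff_isUnit_det, PadicInt.isUnit_iff]
  have h1 : PadicInt.toZModPow N B.det = PadicInt.toZModPow N 1 := by
    rw [RingHom.map_det]
    simp [h]
  rw [← norm_sub_le_iff] at h1
  have h2 : ‖B.det - 1‖ < 1 := lt_of_le_of_lt h1 (zpow_neg_lt_one hN)
  have h3 := PadicInt.norm_eq_of_norm_add_lt_right (z1 := B.det) (z2 := -1)
    (by simpa [sub_eq_add_neg] using h2)
  simpa using h3

theorem exists_lift_Gam {N : ℕ} {B : Matrix (Fin n) (Fin n) ℚ_[p]} (hB : B ∈ Gam p n N) :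
    ∃ B0 : Matrix (Fin n) (Fin n) ℤ_[p], B0.map PadicInt.Coe.ringHom = B ∧
      B0.map (PadicInt.toZModPow N) = 1 := by
  obtain ⟨B0, rfl⟩ := exists_lift_mat fun i j => norm_le_one_of_sub (norm_one_le i j) (hB i j)
  refine ⟨B0, rfl, ?_⟩
  ext i j
  have h := hB i j
  have h1 : (1 : Matrix (Fin n) (Fin n) ℚ_[p]) i j =
      PadicInt.Coe.ringHom ((1 : Matrix (Fin n) (Fin n) ℤ_[p]) i j) := by
    rw [Matrix.one_apply, Matrix.one_apply]; split_ifs <;> simp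
  rw [h1, Matrix.map_apply, norm_sub_le_iff] at h
  rw [Matrix.map_apply, h, Matrix.one_apply, Matrix.one_apply]
  split_ifs <;> simp

theorem mem_Gam_of_map {N : ℕ} {B0 : Matrix (Fin n) (Fin n) ℤ_[p]}
    (h : B0.map (PadicInt.toZModPow N) = 1) : B0.map PadicInt.Coe.ringHom ∈ Gam p n N := by
  intro i j
  have h1 : (1 : Matrix (Fin n) (Fin n) ℚ_[p]) i j =
      PadicInt.Coe.ringHom ((1 : Matrix (Fin n) (Fin n) ℤ_[p]) i j) := by
    rw [Matrix.one_apply, Matrix.one_apply]; split_ifs <;> simp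
  rw [h1, Matrix.map_apply, norm_sub_le_iff]
  have h2 := congrFun (congrFun h i) j
  rw [Matrix.map_apply] at h2
  rw [h2, Matrix.one_apply, Matrix.one_apply]
  split_ifs <;> simp

theorem exists_inv_Gam {N : ℕ} (hN : N ≠ 0) {B : Matrix (Fin n) (Fin n) ℚ_[p]}
    (hB : B ∈ Gam p n N) : ∃ g : GL (Fin n) ℚ_[p], g.1 = B ∧ (g⁻¹).1 ∈ Gam p n N := by
  obtain ⟨B0, rfl, h⟩ := exists_lift_Gam hB
  obtain ⟨u, rfl⟩ := isUnit_of_map_eq_one hN h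
  refine ⟨Units.map (PadicInt.Coe.ringHom (p := p)).mapMatrix.toMonoidHom u, rfl, ?_⟩
  refine mem_Gam_of_map (B0 := (u⁻¹).1) ?_
  have h3 : (u.1 * (u⁻¹).1).map (PadicInt.toZModPow N) = 1 := by
    rw [← Units.val_mul]; simp
  rw [Matrix.map_mul, h, one_mul] at h3
  exact h3

theorem mul_mem_Gam {N : ℕ} {B C : Matrix (Fin n) (Fin n) ℚ_[p]}
    (hB : B ∈ Gam p n N) (hC : C ∈ Gam p n N) : B * C ∈ Gam p n N := by
  obtain ⟨B0, rfl, h⟩ := exists_lift_Gam hB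
  obtain ⟨C0, rfl, h'⟩ := exists_lift_Gam hC
  rw [← Matrix.map_mul]
  refine mem_Gam_of_map ?_
  rw [Matrix.map_mul, h, h', one_mul]

/-- A pair `(A, v)` has Krylov matrix congruent to `1` if and only if `A` is congruent to a
companion matrix and `v` to the first basis vector. -/
theorem krylov_mem_Gam_iff {N : ℕ} (hN : N ≠ 0) {S0 : Set (Fin (m + 1) → ℚ_[p])}
    (hS : S0 ⊆ L0 p (m + 1))
    (hS' : ∀ a ∈ S0, ∀ b : Fin (m + 1) → ℚ_[p], (∀ k, ‖b k - a k‖ ≤ (p : ℝ) ^ (-N : ℤ)) → b ∈ S0)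
    (A : Matrix (Fin (m + 1)) (Fin (m + 1)) ℚ_[p]) (v : Fin (m + 1) → ℚ_[p]) :
    (krylov A v ∈ Gam p (m + 1) N ∧ charCoeff A ∈ S0) ↔
      ((∀ k : Fin m, ∀ j, ‖A k.castSucc j - (Pi.single k.succ 1 : Fin (m + 1) → ℚ_[p]) j‖ ≤
          (p : ℝ) ^ (-N : ℤ)) ∧ A (Fin.last m) ∈ S0) ∧
        ∀ j, ‖v j - (Pi.single 0 1 : Fin (m + 1) → ℚ_[p]) j‖ ≤ (p : ℝ) ^ (-N : ℤ) := by
  have hsingle : ∀ i j : Fin (m + 1), (Pi.single i 1 : Fin (m + 1) → ℚ_[p]) j =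
      PadicInt.Coe.ringHom ((Pi.single i 1 : Fin (m + 1) → ℤ_[p]) j) := by
    intro i j
    rw [Pi.single_apply, Pi.single_apply]; split_ifs <;> simp
  have hsingle' : ∀ i j : Fin (m + 1), PadicInt.toZModPow N
      ((Pi.single i 1 : Fin (m + 1) → ℤ_[p]) j) =
        (Pi.single i 1 : Fin (m + 1) → ZMod (p ^ N)) j := by
    intro i j
    rw [Pi.single_apply, Pi.single_apply]; split_ifs <;> simp
  have hnt : Nontrivial (ZMod (p ^ N)) := by
    have : Fact (1 < p ^ N) := ⟨Nat.one_lt_pow hN (Fact.out : p.Prime).one_lt⟩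
    infer_instance
  constructor
  -- `A` is recovered as `B⁻¹ (comp a) B` with `B` congruent to `1`: it is integral, and modulo `p ^
  -- N` it equals the companion matrix.
  · rintro ⟨hK, hc⟩
    have hv : v = krylov A v 0 := by rw [krylov_apply]; simp
    have hmul := krylov_mul A v
    obtain ⟨B0, hB0, hB1⟩ := exists_lift_Gam hK
    obtain ⟨a0, ha0⟩ := exists_lift_vec (hS hc)
    obtain ⟨u, hu⟩ := isUnit_of_map_eq_one hN hB1
    let A1 : Matrix (Fin (m + 1)) (Fin (m + 1)) ℤ_[p] := (u⁻¹).1 * comp a0 * u.1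
    have hBA : B0 * A1 = comp a0 * B0 := by
      rw [← hu]
      simp [A1, ← mul_assoc]
    have hA : A1.map PadicInt.Coe.ringHom = A := by
      have h1 : B0.map PadicInt.Coe.ringHom * A1.map PadicInt.Coe.ringHom =
          B0.map PadicInt.Coe.ringHom * A := by
        rw [← Matrix.map_mul, hBA, Matrix.map_mul, comp_map, ha0, hB0, hmul]
      have h2 : (u⁻¹).1.map (PadicInt.Coe.ringHom (p := p)) * B0.map PadicInt.Coe.ringHom = 1 := by
        rw [← Matrix.map_mul, ← hu, ← Units.val_mul]
        simp
      calc A1.map PadicInt.Coe.ringHom = ((u⁻¹).1.map (PadicInt.Coe.ringHom (p := p)) *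
          B0.map PadicInt.Coe.ringHom) * A1.map PadicInt.Coe.ringHom := by rw [h2, one_mul]
        _ = A := by rw [mul_assoc, h1, ← mul_assoc, h2, one_mul]
    have hA' : A1.map (PadicInt.toZModPow N) = comp fun i => PadicInt.toZModPow N (a0 i) := by
      have := congrArg (fun M => M.map (PadicInt.toZModPow N)) hBA
      simpa only [Matrix.map_mul, hB1, one_mul, mul_one, comp_map] using this
    refine ⟨⟨fun k j => ?_, ?_⟩, fun j => ?_⟩
    · have h1 := congrFun (congrFun hA' k.castSucc) j
      rw [Matrix.map_apply, comp_castSucc] at h1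
      have h2 := congrFun (congrFun hA k.castSucc) j
      rw [Matrix.map_apply] at h2
      rw [← h2, hsingle, norm_sub_le_iff, hsingle', h1]
    · refine hS' _ hc _ fun j => ?_
      have h1 := congrFun (congrFun hA' (Fin.last m)) j
      rw [Matrix.map_apply, comp_last] at h1
      have h2 := congrFun (congrFun hA (Fin.last m)) j
      rw [Matrix.map_apply] at h2
      rw [← h2, ← ha0, norm_sub_le_iff, h1]
    · have := hK 0 j
      rw [← hv, Matrix.one_apply] at this
      rw [Pi.single_apply]
      simpa [eq_comm] using this
  -- Modulo `p ^ N`, `A` is the companion matrix of its own last row and `v` is the first basis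
  -- vector. So the Krylov matrix reduces to `1` and the characteristic coefficients reduce to the
  -- last row; invariance of `S0` under translation by `p ^ N` transfers membership.
  · rintro ⟨⟨hr, hl⟩, hv⟩
    have hAint : ∀ i j, ‖A i j‖ ≤ 1 := by
      intro i
      induction i using Fin.lastCases with
      | last => exact hS hl
      | cast k => exact fun j => norm_le_one_of_sub (norm_single_le _ _) (hr k j)
    obtain ⟨A0, hA0⟩ := exists_lift_mat hAint
    obtain ⟨v0, hv0⟩ := exists_lift_vec (v := v)
      fun j => norm_le_one_of_sub (norm_single_le _ _) (hv j)
    have hA' : A0.map (PadicInt.toZModPow N) =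
        comp fun i => PadicInt.toZModPow N (A0 (Fin.last m) i) := by
      ext k j
      rw [Matrix.map_apply]
      induction k using Fin.lastCases with
      | last => rw [comp_last]
      | cast k =>
        rw [comp_castSucc, ← hsingle', ← norm_sub_le_iff, ← hsingle]
        have := hr k j
        rwa [← hA0] at this
    have hv' : (fun i => PadicInt.toZModPow N (v0 i)) = Pi.single 0 1 := by
      ext j
      rw [← hsingle', ← norm_sub_le_iff, ← hsingle]
      have := hv j
      rwa [← hv0] at this
    constructor
    · rw [← hA0, ← hv0, krylov_map]
      refine mem_Gam_of_map ?_
      rw [← krylov_map, hA', hv', krylov_comp]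
    · refine hS' _ hl _ fun j => ?_
      have h2 := congrFun (congrFun hA0 (Fin.last m)) j
      rw [Matrix.map_apply] at h2
      rw [← h2, ← hA0, charCoeff_map, norm_sub_le_iff, ← charCoeff_map, hA', charCoeff_comp]

end Congr

end

section

open Metric
open scoped ENNReal

/-! ### Volumes of sets of matrices -/

section MatVolume

variable {p : ℕ} [Fact p.Prime] {n m : ℕ}

/-- The matrices with entries in `ℤ_p`. -/
def Mat0 (p n : ℕ) [Fact p.Prime] : Set (Matrix (Fin n) (Fin n) ℚ_[p]) := {A | ∀ i j, ‖A i j‖ ≤ 1}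

/-- The set `GL_n(ℤ_p)` inside the matrices over `ℚ_p`. -/
def IntGL (p n : ℕ) [Fact p.Prime] : Set (Matrix (Fin n) (Fin n) ℚ_[p]) :=
  {B | ∃ g : GL (Fin n) ℚ_[p], g.1 = B ∧ g.1 ∈ Mat0 p n ∧ (g⁻¹).1 ∈ Mat0 p n}

theorem volume_rows (t : Fin n → Set (Fin n → ℚ_[p])) :
    volume {A : Matrix (Fin n) (Fin n) ℚ_[p] | ∀ i, A i ∈ t i} = ∏ i, volume (t i) := by
  have h : {A : Matrix (Fin n) (Fin n) ℚ_[p] | ∀ i, A i ∈ t i} = Set.univ.pi t := by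
    ext A; exact ⟨fun h i _ => h i, fun h i => h i trivial⟩
  rw [h]
  exact volume_pi_pi (α := fun _ : Fin n => Fin n → ℚ_[p]) t

theorem volume_Mat0 : volume (Mat0 p n) = 1 := by
  have : Mat0 p n = {A | ∀ i, A i ∈ L0 p n} := rfl
  rw [this, volume_rows]
  simp [volume_L0]

theorem mul_mem_Mat0 {A B : Matrix (Fin n) (Fin n) ℚ_[p]} (hA : A ∈ Mat0 p n) (hB : B ∈ Mat0 p n) :
    A * B ∈ Mat0 p n := by
  intro i j
  rw [Matrix.mul_apply]
  refine IsUltrametricDist.norm_sum_le_of_forall_le_of_nonneg zero_le_one fun k _ => ?_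
  rw [norm_mul]
  exact mul_le_one₀ (hA i k) (norm_nonneg _) (hB k j)

theorem IntGL_eq : IntGL p n = {B | B ∈ Mat0 p n ∧ ‖B.det‖ = 1} := by
  ext B
  constructor
  · rintro ⟨g, rfl, hg, hg'⟩
    refine ⟨hg, ?_⟩
    obtain ⟨G, hG⟩ := exists_lift_mat hg
    obtain ⟨G', hG'⟩ := exists_lift_mat hg'
    have h1 : ‖g.1.det‖ ≤ 1 := by
      rw [← hG, ← RingHom.mapMatrix_apply, ← RingHom.map_det]
      exact G.det.2
    have h2 : ‖(g⁻¹).1.det‖ ≤ 1 := by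
      rw [← hG', ← RingHom.mapMatrix_apply, ← RingHom.map_det]
      exact G'.det.2
    have h3 : ‖g.1.det‖ * ‖(g⁻¹).1.det‖ = 1 := by
      rw [← norm_mul, ← Matrix.det_mul, ← Units.val_mul]
      simp
    nlinarith [norm_nonneg g.1.det]
  · rintro ⟨hB, hd⟩
    obtain ⟨B0, rfl⟩ := exists_lift_mat hB
    have hu : IsUnit B0 := by
      rw [Matrix.isUnit_iff_isUnit_det, PadicInt.isUnit_iff]
      rw [← RingHom.mapMatrix_apply, ← RingHom.map_det] at hd
      exact hd
    obtain ⟨u, rfl⟩ := hu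
    let g : GL (Fin n) ℚ_[p] :=
      Units.map (PadicInt.Coe.ringHom (p := p)).mapMatrix.toMonoidHom u
    exact ⟨g, rfl, hB, fun i j => ((u⁻¹).1 i j).2⟩

theorem isOpen_Mat0 : IsOpen (Mat0 p n) := by
  have : Mat0 p n = ⋂ i, ⋂ j, (fun A : Matrix (Fin n) (Fin n) ℚ_[p] => A i j) ⁻¹'
      closedBall 0 1 := by
    ext A; simp [Mat0]
  rw [this]
  exact isOpen_iInter_of_finite fun i => isOpen_iInter_of_finite fun j =>
    isOpen_unitBall.preimage (continuous_id.matrix_elem i j)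

theorem isOpen_IntGL : IsOpen (IntGL p n) := by
  have : IntGL p n = Mat0 p n ∩ (fun A : Matrix (Fin n) (Fin n) ℚ_[p] => A.det) ⁻¹'
      sphere 0 1 := by
    rw [IntGL_eq]; ext A; simp
  rw [this]
  exact isOpen_Mat0.inter
    ((IsUltrametricDist.isOpen_sphere _ one_ne_zero).preimage continuous_id.matrix_det)

theorem isOpen_Gam (N : ℕ) : IsOpen (Gam p n N) := by
  have : Gam p n N = ⋂ i, ⋂ j, (fun A : Matrix (Fin n) (Fin n) ℚ_[p] => A i j) ⁻¹'
      closedBall ((1 : Matrix (Fin n) (Fin n) ℚ_[p]) i j) ((p : ℝ) ^ (-N : ℤ)) := by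
    ext A; simp [Gam, dist_eq_norm]
  have hp : (0 : ℝ) < p := by exact_mod_cast (Fact.out : p.Prime).pos
  rw [this]
  exact isOpen_iInter_of_finite fun i => isOpen_iInter_of_finite fun j =>
    (IsUltrametricDist.isOpen_closedBall _ (by positivity)).preimage
      (continuous_id.matrix_elem i j)

/-- Right multiplication of matrices by an invertible matrix. -/
def mulRightEquiv (g : GL (Fin n) ℚ_[p]) :
    Matrix (Fin n) (Fin n) ℚ_[p] ≃ₗ[ℚ_[p]] Matrix (Fin n) (Fin n) ℚ_[p] where
  toFun A := A * g.1
  map_add' _ _ := add_mul _ _ _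
  map_smul' _ _ := smul_mul_assoc _ _ _
  invFun A := A * (g⁻¹).1
  left_inv A := by
    simp only [mul_assoc, ← Units.val_mul, mul_inv_cancel, Units.val_one, mul_one]
  right_inv A := by
    simp only [mul_assoc, ← Units.val_mul, inv_mul_cancel, Units.val_one, mul_one]

/-- Left multiplication of matrices by an invertible matrix. -/
def mulLeftEquiv (g : GL (Fin n) ℚ_[p]) :
    Matrix (Fin n) (Fin n) ℚ_[p] ≃ₗ[ℚ_[p]] Matrix (Fin n) (Fin n) ℚ_[p] where
  toFun A := g.1 * A
  map_add' _ _ := mul_add _ _ _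
  map_smul' _ _ := mul_smul_comm _ _ _
  invFun A := (g⁻¹).1 * A
  left_inv A := by
    simp only [← mul_assoc, ← Units.val_mul, inv_mul_cancel, Units.val_one, one_mul]
  right_inv A := by
    simp only [← mul_assoc, ← Units.val_mul, mul_inv_cancel, Units.val_one, one_mul]

/-- The rows are multiplied independently, each contributing one factor `rowScale g`. -/
theorem volume_mulRight_image (g : GL (Fin n) ℚ_[p]) (U : Set (Matrix (Fin n) (Fin n) ℚ_[p])) :
    volume (mulRightEquiv g '' U) = rowScale g ^ n * volume U := by
  obtain ⟨c, -, -, h⟩ := exists_scale (contEquiv (mulRightEquiv g)) volume volume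
  have h0 : ∀ U, volume (mulRightEquiv g '' U) = c * volume U := h
  have h1 := h0 (Mat0 p n)
  have h2 : mulRightEquiv g '' Mat0 p n = {A | ∀ i, A i ∈ rowMul g '' L0 p n} := by
    ext A
    constructor
    · rintro ⟨B, hB, rfl⟩ i
      exact ⟨B i, hB i, (Matrix.mul_apply_eq_vecMul B g.1 i).symm⟩
    · intro hA
      choose B hB hB' using hA
      refine ⟨Matrix.of B, fun i => hB i, ?_⟩
      ext i j
      have := congrFun (hB' i) j
      rw [← this]
      rfl
  rw [h2, volume_rows, volume_Mat0, mul_one] at h1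
  rw [h0, ← h1]
  simp [rowScale]

theorem volume_transpose_image (U : Set (Matrix (Fin n) (Fin n) ℚ_[p])) :
    volume (Matrix.transpose '' U) = volume U := by
  obtain ⟨c, -, -, h⟩ := exists_scale
    (contEquiv (Matrix.transposeLinearEquiv (Fin n) (Fin n) ℚ_[p] ℚ_[p])) volume volume
  have h0 : ∀ U : Set (Matrix (Fin n) (Fin n) ℚ_[p]),
    volume (Matrix.transpose '' U) = c * volume U := h
  have h1 := h0 (Mat0 p n)
  have h2 : Matrix.transpose '' Mat0 p n = Mat0 p n := by
    ext A
    constructor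
    · rintro ⟨B, hB, rfl⟩ i j
      exact hB j i
    · intro hA
      exact ⟨A.transpose, fun i j => hA j i, A.transpose_transpose⟩
  rw [h2, volume_Mat0, mul_one] at h1
  rw [h0, ← h1, one_mul]

theorem volume_mulLeft_image (g : GL (Fin n) ℚ_[p]) (U : Set (Matrix (Fin n) (Fin n) ℚ_[p])) :
    volume (mulLeftEquiv g '' U) = rowScale g ^ n * volume U := by
  have h : mulLeftEquiv g '' U =
      Matrix.transpose '' (mulRightEquiv (glTranspose g) '' (Matrix.transpose '' U)) := by
    simp only [← Set.image_comp]
    congr 1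
    ext1 A
    change g.1 * A = (A.transpose * g.1.transpose).transpose
    rw [Matrix.transpose_mul, Matrix.transpose_transpose, Matrix.transpose_transpose]
  rw [h, volume_transpose_image, volume_mulRight_image, volume_transpose_image,
    rowScale_transpose]

end MatVolume

/-! ### The distribution of Krylov matrices -/

section KrylovMeasure

variable {p : ℕ} [Fact p.Prime] {n m : ℕ}

/-- The map `(A, v) ↦ (g⁻¹ A g, v g)`. -/
def conjEquiv (g : GL (Fin n) ℚ_[p]) :
    (Matrix (Fin n) (Fin n) ℚ_[p] × (Fin n → ℚ_[p])) ≃ₗ[ℚ_[p]]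
      (Matrix (Fin n) (Fin n) ℚ_[p] × (Fin n → ℚ_[p])) :=
  LinearEquiv.prodCongr ((mulLeftEquiv g⁻¹).trans (mulRightEquiv g)) (rowMul g)

theorem conjEquiv_apply (g : GL (Fin n) ℚ_[p])
    (z : Matrix (Fin n) (Fin n) ℚ_[p] × (Fin n → ℚ_[p])) :
    conjEquiv g z = ((g⁻¹).1 * z.1 * g.1, Matrix.vecMul z.2 g.1) := rfl

instance instHaarMatVec : (volume : Measure
    (Matrix (Fin n) (Fin n) ℚ_[p] × (Fin n → ℚ_[p]))).IsAddHaarMeasure :=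
  inferInstanceAs ((volume : Measure (Matrix (Fin n) (Fin n) ℚ_[p])).prod
    (volume : Measure (Fin n → ℚ_[p]))).IsAddHaarMeasure

/-- The scales of `A ↦ g⁻¹ A` and `A ↦ A g` cancel, so only the vector contributes. -/
theorem volume_conj_image (g : GL (Fin n) ℚ_[p])
    (U : Set (Matrix (Fin n) (Fin n) ℚ_[p] × (Fin n → ℚ_[p]))) :
    volume (conjEquiv g '' U) = rowScale g * volume U := by
  obtain ⟨c, -, -, h⟩ := exists_scale (contEquiv (conjEquiv g)) volume volume
  have h0 : ∀ U, volume (conjEquiv g '' U) = c * volume U := h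
  have h1 := h0 (Mat0 p n ×ˢ L0 p n)
  have h2 : conjEquiv g '' (Mat0 p n ×ˢ L0 p n) =
      (mulRightEquiv g '' (mulLeftEquiv g⁻¹ '' Mat0 p n)) ×ˢ (rowMul g '' L0 p n) := by
    rw [← Set.image_comp, Set.prod_image_image_eq]
    rfl
  rw [h2, Measure.volume_eq_prod, Measure.prod_prod, Measure.prod_prod, volume_mulRight_image,
    volume_mulLeft_image, volume_Mat0, volume_L0, mul_one, mul_one, mul_one,
    mul_comm _ (rowScale g⁻¹ ^ n), ← mul_pow, ← rowScale_mul, inv_mul_cancel, rowScale_one,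
    one_pow, one_mul] at h1
  rw [h0, ← h1]
  rfl

/-- The distribution of the Krylov matrix of `(A, v)`, for `A` and `v` distributed according to
Haar measure, on the event that the characteristic polynomial of `A` has coefficients in `S0`. -/
def krylovMeasure (S0 : Set (Fin n → ℚ_[p])) : Measure (Matrix (Fin n) (Fin n) ℚ_[p]) :=
  (volume.restrict {z : Matrix (Fin n) (Fin n) ℚ_[p] × (Fin n → ℚ_[p]) |
    charCoeff z.1 ∈ S0}).map fun z => krylov z.1 z.2

variable {S0 : Set (Fin n → ℚ_[p])}

theorem krylovMeasure_apply {U : Set (Matrix (Fin n) (Fin n) ℚ_[p])} (hU : MeasurableSet U) :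
    krylovMeasure S0 U = volume {z : Matrix (Fin n) (Fin n) ℚ_[p] × (Fin n → ℚ_[p]) |
      krylov z.1 z.2 ∈ U ∧ charCoeff z.1 ∈ S0} := by
  have hm := (continuous_krylov (p := p) (n := n)).measurable
  rw [krylovMeasure, Measure.map_apply hm hU, Measure.restrict_apply (hm hU)]
  rfl

/-- The map `conjEquiv g` carries the event for `U` onto the event for `U g`, conjugation leaving
the characteristic polynomial unchanged. Haar measure on matrices scales by the `n`-th power of the
same factor, so the two measures differ by a power of `rowScale`. -/
theorem krylovMeasure_mulRight (g : GL (Fin n) ℚ_[p]) {U : Set (Matrix (Fin n) (Fin n) ℚ_[p])}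
    (hU : IsOpen U) : krylovMeasure S0 (mulRightEquiv g '' U) = rowScale g * krylovMeasure S0 U := by
  have hopen : IsOpen (mulRightEquiv g '' U) :=
    (contEquiv (mulRightEquiv g)).toHomeomorph.isOpenMap U hU
  rw [krylovMeasure_apply hU.measurableSet, krylovMeasure_apply hopen.measurableSet,
    ← volume_conj_image]
  congr 1
  ext z
  constructor
  · rintro ⟨⟨B, hB, hBz⟩, hc⟩
    have hkey : krylov (g.1 * z.1 * (g⁻¹).1) (Matrix.vecMul z.2 (g⁻¹).1) = B := by
      have h1 := krylov_conj z.1 z.2 g⁻¹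
      rw [inv_inv] at h1
      rw [h1, ← hBz]
      change B * g.1 * (g⁻¹).1 = B
      rw [mul_assoc, ← Units.val_mul]
      simp
    refine ⟨(g.1 * z.1 * (g⁻¹).1, Matrix.vecMul z.2 (g⁻¹).1), ⟨?_, ?_⟩, ?_⟩
    · change krylov (g.1 * z.1 * (g⁻¹).1) (Matrix.vecMul z.2 (g⁻¹).1) ∈ U
      rwa [hkey]
    · have h2 := charCoeff_conj z.1 g⁻¹
      rw [inv_inv] at h2
      change charCoeff (g.1 * z.1 * (g⁻¹).1) ∈ S0
      rwa [h2]
    · rw [conjEquiv_apply]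
      refine Prod.ext ?_ ?_
      · change (g⁻¹).1 * (g.1 * z.1 * (g⁻¹).1) * g.1 = z.1
        rw [mul_assoc g.1, ← mul_assoc (g⁻¹).1, ← Units.val_mul, mul_assoc, mul_assoc z.1,
          ← Units.val_mul]
        simp
      · change Matrix.vecMul (Matrix.vecMul z.2 (g⁻¹).1) g.1 = z.2
        rw [Matrix.vecMul_vecMul, ← Units.val_mul]
        simp
  · rintro ⟨w, ⟨hw, hc⟩, rfl⟩
    rw [conjEquiv_apply]
    refine ⟨⟨_, hw, ?_⟩, ?_⟩
    · exact (krylov_conj w.1 w.2 g).symm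
    · change charCoeff ((g⁻¹).1 * w.1 * g.1) ∈ S0
      rwa [charCoeff_conj]

/-- By `krylov_mem_Gam_iff` the event is a product: `m` rows of `A` and the vector `v` range over
balls of radius `p ^ (-N)`, the last row over `S0`. A matrix in `Gam` has `m + 1` rows in such
balls; the ball of `v` takes the place of the missing one. -/
theorem krylovMeasure_Gam {N : ℕ} (hN : N ≠ 0) {S0 : Set (Fin (m + 1) → ℚ_[p])}
    (hS : S0 ⊆ L0 p (m + 1))
    (hS' : ∀ a ∈ S0, ∀ b : Fin (m + 1) → ℚ_[p], (∀ k, ‖b k - a k‖ ≤ (p : ℝ) ^ (-N : ℤ)) → b ∈ S0) :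
    krylovMeasure S0 (Gam p (m + 1) N) = volume S0 * volume (Gam p (m + 1) N) := by
  let D : (Fin (m + 1) → ℚ_[p]) → Set (Fin (m + 1) → ℚ_[p]) := fun c =>
    {v | ∀ j, ‖v j - c j‖ ≤ (p : ℝ) ^ (-N : ℤ)}
  have hD : ∀ c, volume (D c) = volume (D 0) := by
    intro c
    rw [← measure_preimage_add_right volume (-c) (D 0)]
    congr 1
    ext v
    simp [D, sub_eq_add_neg]
  rw [krylovMeasure_apply (isOpen_Gam N).measurableSet]
  have h1 : {z : Matrix (Fin (m + 1)) (Fin (m + 1)) ℚ_[p] × (Fin (m + 1) → ℚ_[p]) |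
      krylov z.1 z.2 ∈ Gam p (m + 1) N ∧ charCoeff z.1 ∈ S0} =
      {A : Matrix (Fin (m + 1)) (Fin (m + 1)) ℚ_[p] | ∀ i, A i ∈
        (Fin.snoc (α := fun _ => Set (Fin (m + 1) → ℚ_[p]))
          (fun k : Fin m => D (Pi.single k.succ 1)) S0 : Fin (m + 1) → _) i} ×ˢ
        D (Pi.single 0 1) := by
    ext z
    rw [Set.mem_ofPred_eq, krylov_mem_Gam_iff hN hS hS', Set.mem_prod, Set.mem_ofPred_eq,
      Fin.forall_fin_succ' (P := fun i => z.1 i ∈ _), Fin.snoc_last]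
    simp only [Fin.snoc_castSucc]
    rfl
  have h2 : Gam p (m + 1) N = {A : Matrix (Fin (m + 1)) (Fin (m + 1)) ℚ_[p] |
      ∀ i, A i ∈ D ((1 : Matrix (Fin (m + 1)) (Fin (m + 1)) ℚ_[p]) i)} := rfl
  rw [h1, Measure.volume_eq_prod, Measure.prod_prod, volume_rows, h2, volume_rows,
    Fin.prod_univ_castSucc, Fin.snoc_last]
  simp only [Fin.snoc_castSucc, hD, Finset.prod_const, Finset.card_univ, Fintype.card_fin]
  rw [pow_succ]
  ring

theorem mulRightEquiv_apply (g : GL (Fin n) ℚ_[p]) (A : Matrix (Fin n) (Fin n) ℚ_[p]) :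
    mulRightEquiv g A = A * g.1 := rfl

/-- The cosets `Gam b` are open, and two of them are equal or disjoint, so countably many of them
partition the set and the proportionality can be summed. -/
theorem measure_eq_of_cosets {N : ℕ} (hN : N ≠ 0)
    (μ ν : Measure (Matrix (Fin n) (Fin n) ℚ_[p])) (c : ℝ≥0∞)
    (U : Set (GL (Fin n) ℚ_[p]))
    (hU : ∀ b ∈ U, mulRightEquiv b '' Gam p n N ⊆ Units.val '' U)
    (h : ∀ b ∈ U, μ (mulRightEquiv b '' Gam p n N) = c * ν (mulRightEquiv b '' Gam p n N)) :
    μ (Units.val '' U) = c * ν (Units.val '' U) := by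
  let C : Set (Set (Matrix (Fin n) (Fin n) ℚ_[p])) :=
    (fun b : GL (Fin n) ℚ_[p] => mulRightEquiv b '' Gam p n N) '' U
  have hself : ∀ b : GL (Fin n) ℚ_[p], b.1 ∈ mulRightEquiv b '' Gam p n N := fun b =>
    ⟨1, fun i j => by
      rw [sub_self, norm_zero]
      exact zpow_nonneg (Nat.cast_nonneg _) _, by rw [mulRightEquiv_apply, one_mul]⟩
  have hsub : ∀ b b' : GL (Fin n) ℚ_[p], ∀ B ∈ mulRightEquiv b '' Gam p n N,
      B ∈ mulRightEquiv b' '' Gam p n N →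
        mulRightEquiv b '' Gam p n N ⊆ mulRightEquiv b' '' Gam p n N := by
    rintro b b' _ ⟨x, hx, rfl⟩ ⟨y, hy, hxy⟩ _ ⟨w, hw, rfl⟩
    obtain ⟨gx, rfl, hgx⟩ := exists_inv_Gam hN hx
    refine ⟨w * ((gx⁻¹).1 * y), mul_mem_Gam hw (mul_mem_Gam hgx hy), ?_⟩
    rw [mulRightEquiv_apply, mulRightEquiv_apply] at hxy ⊢
    rw [mul_assoc, mul_assoc, hxy, ← mul_assoc (gx⁻¹).1, ← Units.val_mul]
    simp
  have hopen : ∀ b : GL (Fin n) ℚ_[p], IsOpen (mulRightEquiv b '' Gam p n N) := fun b =>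
    (contEquiv (mulRightEquiv b)).toHomeomorph.isOpenMap _ (isOpen_Gam N)
  have hdisj : C.PairwiseDisjoint id := by
    rintro _ ⟨b, hb, rfl⟩ _ ⟨b', hb', rfl⟩ hne
    refine Set.disjoint_left.2 fun B hB hB' => hne ?_
    exact Set.Subset.antisymm (hsub b b' B hB hB') (hsub b' b B hB' hB)
  have hcount : C.Countable := by
    refine hdisj.countable_of_isOpen ?_ ?_
    · rintro _ ⟨b, -, rfl⟩; exact hopen b
    · rintro _ ⟨b, -, rfl⟩; exact ⟨_, hself b⟩
  have hunion : Units.val '' U = ⋃₀ C := by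
    apply Set.Subset.antisymm
    · rintro _ ⟨b, hb, rfl⟩
      exact ⟨_, ⟨b, hb, rfl⟩, hself b⟩
    · rintro B ⟨_, ⟨b, hb, rfl⟩, hB⟩
      exact hU b hb hB
  have hmeas : ∀ s ∈ C, MeasurableSet s := by
    rintro _ ⟨b, -, rfl⟩; exact (hopen b).measurableSet
  rw [hunion, measure_sUnion hcount hdisj hmeas, measure_sUnion hcount hdisj hmeas,
    ← ENNReal.tsum_mul_left]
  refine tsum_congr ?_
  rintro ⟨_, b, hb, rfl⟩
  exact h b hb

/-- Since `Gam` is closed under inverses, this shows that `H GL_n(ℤ_p)` is stable under left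
multiplication by `Gam` for large `N`, hence a union of cosets `Gam b`. -/
theorem exists_conj_Gam_integral (H : GL (Fin n) ℚ_[p]) :
    ∃ N0 : ℕ, ∀ N ≥ N0, ∀ B ∈ Gam p n N, (H⁻¹).1 * B * H.1 ∈ Mat0 p n := by
  have hp : (1 : ℝ) < p := by exact_mod_cast (Fact.out : p.Prime).one_lt
  obtain ⟨C, hC⟩ : ∃ C : ℝ, ∀ i j, ‖H.1 i j‖ ≤ C ∧ ‖(H⁻¹).1 i j‖ ≤ C := by
    refine ⟨(∑ i, ∑ j, ‖H.1 i j‖) + ∑ i, ∑ j, ‖(H⁻¹).1 i j‖, fun i j => ?_⟩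
    have h1 : ∀ M : Matrix (Fin n) (Fin n) ℚ_[p], ‖M i j‖ ≤ ∑ i, ∑ j, ‖M i j‖ := fun M =>
      (Finset.single_le_sum (f := fun j => ‖M i j‖) (fun _ _ => norm_nonneg _)
        (Finset.mem_univ j)).trans
      (Finset.single_le_sum (f := fun i => ∑ j, ‖M i j‖)
        (fun _ _ => Finset.sum_nonneg fun _ _ => norm_nonneg _) (Finset.mem_univ i))
    have h2 : ∀ M : Matrix (Fin n) (Fin n) ℚ_[p], 0 ≤ ∑ i, ∑ j, ‖M i j‖ := fun M =>
      Finset.sum_nonneg fun _ _ => Finset.sum_nonneg fun _ _ => norm_nonneg _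
    exact ⟨(h1 _).trans (le_add_of_nonneg_right (h2 _)),
      (h1 _).trans (le_add_of_nonneg_left (h2 _))⟩
  obtain ⟨N0, hN0⟩ := pow_unbounded_of_one_lt (C * C) hp
  refine ⟨N0, fun N hN B hB i j => ?_⟩
  have hC0 : 0 ≤ C := (norm_nonneg _).trans (hC i j).1
  have hCN : C * (p : ℝ) ^ (-N : ℤ) * C ≤ 1 := by
    rw [zpow_neg, zpow_natCast]
    have h3 : C * C ≤ (p : ℝ) ^ N := hN0.le.trans (pow_le_pow_right₀ hp.le hN)
    have h4 : (0 : ℝ) < (p : ℝ) ^ N := by positivity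
    rw [mul_right_comm, ← div_eq_mul_inv, div_le_one h4]
    exact h3
  have hsplit : (H⁻¹).1 * B * H.1 = 1 + (H⁻¹).1 * (B - 1) * H.1 := by
    rw [mul_sub, sub_mul, mul_one, ← Units.val_mul]
    simp
  rw [hsplit, Matrix.add_apply]
  refine (IsUltrametricDist.norm_add_le_max _ _).trans (max_le (norm_one_le i j) ?_)
  refine le_trans ?_ hCN
  rw [Matrix.mul_apply]
  refine IsUltrametricDist.norm_sum_le_of_forall_le_of_nonneg (by positivity) fun k _ => ?_
  rw [norm_mul]
  refine mul_le_mul ?_ (hC k j).1 (norm_nonneg _) (by positivity)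
  rw [Matrix.mul_apply]
  refine IsUltrametricDist.norm_sum_le_of_forall_le_of_nonneg (by positivity) fun l _ => ?_
  rw [norm_mul]
  exact mul_le_mul (hC i l).2 (hB l k) (norm_nonneg _) hC0

theorem rowScale_of_mem_IntGL {g : GL (Fin n) ℚ_[p]} (hg : g.1 ∈ IntGL p n) : rowScale g = 1 := by
  obtain ⟨g', h, h1, h2⟩ := hg
  obtain rfl := Units.ext h
  exact rowScale_eq_one_of_integral h1 h2

/-- The Krylov measure of `H GL_m(ℤ_p)`. -/
theorem krylovMeasure_mul_IntGL {N0 : ℕ} {S0 : Set (Fin (m + 1) → ℚ_[p])}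
    (hS : S0 ⊆ L0 p (m + 1))
    (hS' : ∀ a ∈ S0, ∀ b : Fin (m + 1) → ℚ_[p],
      (∀ k, ‖b k - a k‖ ≤ (p : ℝ) ^ (-N0 : ℤ)) → b ∈ S0) (H : GL (Fin (m + 1)) ℚ_[p]) :
    krylovMeasure S0 (mulLeftEquiv H '' IntGL p (m + 1)) =
      rowScale H * volume S0 * volume (IntGL p (m + 1)) := by
  have hp : (1 : ℝ) < p := by exact_mod_cast (Fact.out : p.Prime).one_lt
  obtain ⟨N1, hN1⟩ := exists_conj_Gam_integral H
  let N := max (max N0 N1) 1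
  have hN : N ≠ 0 := by simp [N]
  have hSN : ∀ a ∈ S0, ∀ b : Fin (m + 1) → ℚ_[p],
      (∀ k, ‖b k - a k‖ ≤ (p : ℝ) ^ (-N : ℤ)) → b ∈ S0 := fun a ha b hb =>
    hS' a ha b fun k => (hb k).trans
      (zpow_le_zpow_right₀ hp.le (by simp only [neg_le_neg_iff, N]; norm_cast; omega))
  let U : Set (GL (Fin (m + 1)) ℚ_[p]) := {b | (H⁻¹).1 * b.1 ∈ IntGL p (m + 1)}
  have hU : mulLeftEquiv H '' IntGL p (m + 1) = Units.val '' U := by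
    ext B
    constructor
    · rintro ⟨_, ⟨g, rfl, hg, hg'⟩, rfl⟩
      refine ⟨H * g, ?_, rfl⟩
      change (H⁻¹).1 * (H * g).1 ∈ IntGL p (m + 1)
      rw [← Units.val_mul, inv_mul_cancel_left]
      exact ⟨g, rfl, hg, hg'⟩
    · rintro ⟨b, hb, rfl⟩
      refine ⟨_, hb, ?_⟩
      change H.1 * ((H⁻¹).1 * b.1) = b.1
      rw [← mul_assoc, ← Units.val_mul]
      simp
  have hscale : ∀ b ∈ U, rowScale b = rowScale H := by
    intro b hb
    have : b = H * (H⁻¹ * b) := by simp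
    rw [this, rowScale_mul, rowScale_of_mem_IntGL (g := H⁻¹ * b) hb, mul_one]
  obtain ⟨hH0, hHt, -⟩ := rowScale_spec H
  -- For `b` in `H GL(ℤ_p)` the coset `Gam b` has Krylov mass `rowScale H · vol S0 · vol Gam` and
  -- Haar volume `rowScale H ^ (m + 1) · vol Gam`; the constant is their quotient.
  have key := measure_eq_of_cosets hN (krylovMeasure S0) volume
    (rowScale H * volume S0 * (rowScale H ^ (m + 1))⁻¹) U ?_ ?_
  · rw [hU, key, ← hU, volume_mulLeft_image]
    rw [← mul_assoc, mul_assoc (rowScale H * volume S0), ENNReal.inv_mul_cancel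
      (pow_ne_zero _ hH0) (ENNReal.pow_ne_top hHt), mul_one]
  · rintro b hb _ ⟨B, hB, rfl⟩
    obtain ⟨gB, rfl, hgB⟩ := exists_inv_Gam hN hB
    refine ⟨gB * b, ?_, rfl⟩
    obtain ⟨k, hk, hk1, hk2⟩ := hb
    have hB1 := hN1 N (by simp [N]) _ hB
    have hB2 := hN1 N (by simp [N]) _ hgB
    have hkb : b = H * k := by
      have : k = H⁻¹ * b := Units.ext hk
      rw [this]; simp
    refine ⟨H⁻¹ * gB * H * k, ?_, ?_, ?_⟩
    · rw [hkb, ← Units.val_mul]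
      simp only [mul_assoc]
    · exact mul_mem_Mat0 hB1 hk1
    · have : (H⁻¹ * gB * H * k)⁻¹ = k⁻¹ * (H⁻¹ * gB⁻¹ * H) := by
        simp only [mul_inv_rev, inv_inv, mul_assoc]
      rw [this]
      exact mul_mem_Mat0 hk2 hB2
  · intro b hb
    rw [krylovMeasure_mulRight b (isOpen_Gam N), krylovMeasure_Gam hN hS hSN,
      volume_mulRight_image, hscale b hb]
    rw [← mul_assoc, ← mul_assoc, mul_assoc (rowScale H * volume S0), ENNReal.inv_mul_cancel
      (pow_ne_zero _ hH0) (ENNReal.pow_ne_top hHt), mul_one]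

end KrylovMeasure

end

section

open Metric Polynomial

/-! ### Ultrametric bounds for polynomials -/

section Ultra

variable {F : Type*} [NormedField F] [IsUltrametricDist F]

theorem norm_coeff_prod_X_sub_C_le {α : Type*} (s : Finset α) (z : α → F)
    (hz : ∀ a, ‖z a‖ ≤ 1) (k : ℕ) : ‖(∏ b ∈ s, (X - C (z b))).coeff k‖ ≤ 1 := by
  classical
  induction s using Finset.induction_on generalizing k with
  | empty => rw [Finset.prod_empty, coeff_one]; split_ifs <;> simp
  | insert a s ha ih =>
    rw [Finset.prod_insert ha, sub_mul, coeff_sub, coeff_C_mul]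
    rw [sub_eq_add_neg]
    refine (IsUltrametricDist.norm_add_le_max _ _).trans (max_le ?_ ?_)
    · cases k with
      | zero => simp
      | succ k => rw [coeff_X_mul]; exact ih k
    · rw [norm_neg, norm_mul]
      exact mul_le_one₀ (hz a) (norm_nonneg _) (ih k)

/-- Lagrange interpolation bounds the coefficients of a polynomial by its values. -/
theorem norm_coeff_le_of_eval {α : Type*} [Fintype α] [DecidableEq α] (z : α → F)
    (hz : ∀ a, ‖z a‖ ≤ 1) {d : ℝ} (hd : 0 < d)
    (hsep : ∀ a, d ≤ ∏ b ∈ Finset.univ.erase a, ‖z a - z b‖) (h : F[X])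
    (hdeg : h.degree < Fintype.card α) {c : ℝ} (hc : ∀ a, ‖h.eval (z a)‖ ≤ c) (hc0 : 0 ≤ c)
    (k : ℕ) : ‖h.coeff k‖ ≤ c / d := by
  have hinj : Function.Injective z := by
    intro a b hab
    by_contra hne
    have h1 := hsep a
    rw [Finset.prod_eq_zero (i := b) (by simp [Ne.symm hne]) (by simp [hab])] at h1
    linarith
  have hint := Lagrange.eq_interpolate (s := Finset.univ) (v := z) (f := h) hinj.injOn
    (by simpa using hdeg)
  rw [hint, Lagrange.interpolate_apply, finsetSum_coeff]
  refine IsUltrametricDist.norm_sum_le_of_forall_le_of_nonneg (by positivity) fun a _ => ?_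
  have hb : Lagrange.basis Finset.univ z a =
      C (∏ b ∈ Finset.univ.erase a, (z a - z b))⁻¹ * ∏ b ∈ Finset.univ.erase a, (X - C (z b)) := by
    rw [Lagrange.basis, ← Finset.prod_inv_distrib, map_prod, ← Finset.prod_mul_distrib]
    rfl
  rw [hb, coeff_C_mul, coeff_C_mul, norm_mul, norm_mul, norm_inv, norm_prod]
  have h1 := norm_coeff_prod_X_sub_C_le (Finset.univ.erase a) z hz k
  have h2 : (∏ b ∈ Finset.univ.erase a, ‖z a - z b‖)⁻¹ ≤ d⁻¹ := inv_anti₀ hd (hsep a)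
  rw [div_eq_mul_inv]
  refine mul_le_mul (hc a) ?_ (by positivity) hc0
  calc _ ≤ d⁻¹ * 1 := mul_le_mul h2 h1 (norm_nonneg _) (by positivity)
    _ = d⁻¹ := mul_one _

end Ultra

/-! ### Ultrametric estimates for differences of powers. -/

section UltraRing

variable {E : Type*} [NormedCommRing E] [IsUltrametricDist E]

omit [IsUltrametricDist E] in
theorem norm_pow_le_one' [NormOneClass E] {x : E} (hx : ‖x‖ ≤ 1) (k : ℕ) : ‖x ^ k‖ ≤ 1 :=
  (norm_pow_le x k).trans (pow_le_one₀ (norm_nonneg _) hx)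

theorem norm_pow_sub_pow_le [NormOneClass E] {x y : E} (hx : ‖x‖ ≤ 1) (hy : ‖y‖ ≤ 1) (k : ℕ) :
    ‖x ^ k - y ^ k‖ ≤ ‖x - y‖ := by
  induction k with
  | zero => simp
  | succ k ih =>
    have : x ^ (k + 1) - y ^ (k + 1) = x ^ k * (x - y) + (x ^ k - y ^ k) * y := by ring
    rw [this]
    refine (IsUltrametricDist.norm_add_le_max _ _).trans (max_le ?_ ?_)
    · refine (norm_mul_le _ _).trans ?_
      exact mul_le_of_le_one_left (norm_nonneg _) (norm_pow_le_one' hx k)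
    · refine (norm_mul_le _ _).trans ?_
      exact (mul_le_of_le_one_right (norm_nonneg _) hy).trans ih

/-- Exponents at least `2` gain a factor `ε`, which makes the higher Taylor terms contracting on a
small ball. -/
theorem norm_pow_sub_pow_le_mul [NormOneClass E] {x y : E} {ε : ℝ} (hε : ε ≤ 1) (hx : ‖x‖ ≤ ε)
    (hy : ‖y‖ ≤ ε) (k : ℕ) : ‖x ^ (k + 2) - y ^ (k + 2)‖ ≤ ε * ‖x - y‖ := by
  have : x ^ (k + 2) - y ^ (k + 2) = x * (x ^ (k + 1) - y ^ (k + 1)) + (x - y) * y ^ (k + 1) := by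
    ring
  have hε0 : 0 ≤ ε := (norm_nonneg _).trans hx
  rw [this]
  refine (IsUltrametricDist.norm_add_le_max _ _).trans (max_le ?_ ?_)
  · refine (norm_mul_le _ _).trans ?_
    exact mul_le_mul hx (norm_pow_sub_pow_le (hx.trans hε) (hy.trans hε) _) (norm_nonneg _) hε0
  · refine (norm_mul_le _ _).trans ?_
    rw [mul_comm]
    refine mul_le_mul_of_nonneg_right ?_ (norm_nonneg _)
    rw [pow_succ]
    refine (norm_mul_le _ _).trans ?_
    exact (mul_le_of_le_one_left (norm_nonneg _) (norm_pow_le_one' (hy.trans hε) k)).trans hy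

end UltraRing

/-! ### Hensel's lemma over a complete ultrametric field. -/

section Hensel

variable {F : Type*} [NormedField F] [IsUltrametricDist F] [CompleteSpace F]

omit [CompleteSpace F] in
theorem norm_eval_le_one {G : F[X]} (hG : ∀ k, ‖G.coeff k‖ ≤ 1) {x : F} (hx : ‖x‖ ≤ 1) :
    ‖G.eval x‖ ≤ 1 := by
  rw [eval_eq_sum_range]
  refine IsUltrametricDist.norm_sum_le_of_forall_le_of_nonneg zero_le_one fun k _ => ?_
  rw [norm_mul, norm_pow]
  exact mul_le_one₀ (hG k) (by positivity) (pow_le_one₀ (norm_nonneg _) hx)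

omit [CompleteSpace F] in
theorem norm_natCast_le_one' (k : ℕ) : ‖(k : F)‖ ≤ 1 :=
  IsUltrametricDist.norm_natCast_le_one F k

omit [CompleteSpace F] in
theorem norm_taylor_coeff_le_one {G : F[X]} (hG : ∀ k, ‖G.coeff k‖ ≤ 1) {x : F} (hx : ‖x‖ ≤ 1)
    (k : ℕ) : ‖(taylor x G).coeff k‖ ≤ 1 := by
  rw [taylor_coeff]
  refine norm_eval_le_one (fun j => ?_) hx
  rw [hasseDeriv_coeff, norm_mul]
  exact mul_le_one₀ (norm_natCast_le_one' _) (norm_nonneg _) (hG _)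

/-- Hensel's lemma in Newton's form. -/
theorem exists_root_of_norm_eval_lt {G : F[X]} (hG : ∀ k, ‖G.coeff k‖ ≤ 1) {x : F}
    (hx : ‖x‖ ≤ 1) {d : ℝ} (hd : 0 < d) (hd' : d ≤ ‖G.derivative.eval x‖)
    (hlt : ‖G.eval x‖ < d ^ 2) : ∃ y, G.eval y = 0 ∧ ‖y - x‖ ≤ ‖G.eval x‖ / d := by
  set c : ℕ → F := fun k => (taylor x G).coeff k with hc
  have hc1 : ∀ k, ‖c k‖ ≤ 1 := norm_taylor_coeff_le_one hG hx
  have hcd : d ≤ ‖c 1‖ := by simpa [hc] using hd'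
  have hc0 : c 0 = G.eval x := by simp [hc]
  have hd1 : d ≤ 1 := hcd.trans (hc1 1)
  have hne : c 1 ≠ 0 := by
    intro h0
    rw [h0, norm_zero] at hcd
    linarith
  set ε : ℝ := ‖G.eval x‖ / d with hε
  have hε0 : 0 ≤ ε := by positivity
  have hεd : ε < d := by rw [hε, div_lt_iff₀ hd, ← sq]; exact hlt
  have hε1 : ε ≤ 1 := hεd.le.trans hd1
  let n := (taylor x G).natDegree
  let Q : F → F := fun h => ∑ k ∈ Finset.range n, c (k + 2) * h ^ (k + 2)
  have hexp : ∀ h, G.eval (x + h) = c 0 + c 1 * h + Q h := by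
    intro h
    have h1 : G.eval (x + h) = (taylor x G).eval h := by rw [taylor_eval, add_comm]
    rw [h1, eval_eq_sum_range' (n := n + 2) (by omega), Finset.sum_range_succ',
      Finset.sum_range_succ']
    simp only [Q, c]
    ring
  have hQ : ∀ h h', ‖h‖ ≤ ε → ‖h'‖ ≤ ε → ‖Q h - Q h'‖ ≤ ε * ‖h - h'‖ := by
    intro h h' hh hh'
    simp only [Q]
    rw [← Finset.sum_sub_distrib]
    refine IsUltrametricDist.norm_sum_le_of_forall_le_of_nonneg (by positivity) fun k _ => ?_
    rw [← mul_sub, norm_mul]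
    exact (mul_le_of_le_one_left (norm_nonneg _) (hc1 _)).trans
      (norm_pow_sub_pow_le_mul hε1 hh hh' k)
  have hQ0 : Q 0 = 0 := by simp [Q]
  -- `x + h` is a root exactly when `T h = h`. On the ball of radius `ε` the map `T` has Lipschitz
  -- constant `ε / d < 1`, by the bound on `Q` and `d ≤ ‖c 1‖`.
  let T : F → F := fun h => -(c 0 + Q h) / c 1
  have hmaps : Set.MapsTo T (closedBall 0 ε) (closedBall 0 ε) := by
    intro h hh
    rw [mem_closedBall_zero_iff] at hh ⊢
    have h1 : ‖Q h‖ ≤ ‖G.eval x‖ := by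
      have h2 := hQ h 0 hh (by simpa using hε0)
      rw [hQ0, sub_zero, sub_zero] at h2
      refine h2.trans ?_
      calc ε * ‖h‖ ≤ ε * d := by
            exact mul_le_mul_of_nonneg_left (hh.trans hεd.le) hε0
        _ = ‖G.eval x‖ := by rw [hε]; field_simp
    simp only [T]
    rw [norm_div, norm_neg]
    refine div_le_div₀ (norm_nonneg _) ?_ hd hcd
    exact (IsUltrametricDist.norm_add_le_max _ _).trans (max_le (by rw [hc0]) h1)
  have hcontr : ∀ h h', ‖h‖ ≤ ε → ‖h'‖ ≤ ε → ‖T h - T h'‖ ≤ ε / d * ‖h - h'‖ := by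
    intro h h' hh hh'
    have : T h - T h' = -(Q h - Q h') / c 1 := by simp only [T]; ring
    rw [this, norm_div, norm_neg, div_mul_eq_mul_div]
    exact div_le_div₀ (by positivity) (hQ h h' hh hh') hd hcd
  have hclosed : IsComplete (closedBall (0 : F) ε) := isClosed_closedBall.isComplete
  let Kc : NNReal := ⟨ε / d, by positivity⟩
  have hcw : ContractingWith Kc (hmaps.restrict T (closedBall 0 ε) (closedBall 0 ε)) := by
    constructor
    · rw [← NNReal.coe_lt_coe]
      change ε / d < 1
      rwa [div_lt_one hd]
    · refine LipschitzWith.of_dist_le_mul fun a b => ?_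
      have ha := mem_closedBall_zero_iff.1 a.2
      have hb := mem_closedBall_zero_iff.1 b.2
      have := hcontr a b ha hb
      rw [Subtype.dist_eq, Subtype.dist_eq, dist_eq_norm, dist_eq_norm]
      exact this
  obtain ⟨h, hh, hfix, -⟩ := hcw.exists_fixedPoint' hclosed hmaps (x := 0) (by simpa using hε0)
    (edist_ne_top _ _)
  refine ⟨x + h, ?_, ?_⟩
  · have h1 : T h = h := hfix
    have h2 : h * c 1 = -(c 0 + Q h) := by
      exact ((div_eq_iff hne).1 h1).symm
    rw [hexp]
    linear_combination h2
  · rw [add_sub_cancel_left]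
    exact mem_closedBall_zero_iff.1 hh

end Hensel

end

section

open Metric Polynomial

/-! ### Étale algebras and conjugates -/

/-- The pairs of a factor of an étale algebra and an embedding of it into `PadicAlgCl p`. -/
abbrev Node (p : ℕ) [Fact p.Prime] {ι : Type*} (K : ι → Type*) [∀ i, Field (K i)]
    [∀ i, Algebra ℚ_[p] (K i)] : Type _ :=
  Σ i, K i →ₐ[ℚ_[p]] PadicAlgCl p

theorem norm_algHom {p : ℕ} [Fact p.Prime] {L : Type*} [NormedField L] [NormedAlgebra ℚ_[p] L]
    [FiniteDimensional ℚ_[p] L] (σ : L →ₐ[ℚ_[p]] PadicAlgCl p) (y : L) : ‖σ y‖ = ‖y‖ := by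
  rw [NormedAlgebra.norm_eq_spectralNorm ℚ_[p] y, ← PadicAlgCl.spectralNorm_eq, spectralNorm,
    spectralNorm, minpoly.algHom_eq σ σ.toRingHom.injective]

/-- The polynomial with the given coefficients in degrees `< n`. -/
def polyOf {R : Type*} [CommRing R] {n : ℕ} (w : Fin n → R) : R[X] := ∑ k, C (w k) * X ^ (k : ℕ)

theorem coeff_polyOf {R : Type*} [CommRing R] {n : ℕ} (w : Fin n → R) (k : Fin n) :
    (polyOf w).coeff k = w k := by
  simp [polyOf, finsetSum_coeff, coeff_X_pow, Fin.val_inj]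

theorem degree_polyOf_lt {R : Type*} [CommRing R] {n : ℕ} (w : Fin n → R) :
    (polyOf w).degree < n := by
  rw [polyOf, ← mem_degreeLT]
  refine Submodule.sum_mem _ fun k _ => mem_degreeLT.2 ?_
  exact (degree_C_mul_X_pow_le _ _).trans_lt (by exact_mod_cast k.2)

theorem coeff_polyOf_of_le {R : Type*} [CommRing R] {n : ℕ} (w : Fin n → R) {k : ℕ} (hk : n ≤ k) :
    (polyOf w).coeff k = 0 :=
  coeff_eq_zero_of_degree_lt ((degree_polyOf_lt w).trans_le (by exact_mod_cast hk))

/-- The map `w ↦ ∑ w_k y^k`. -/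
def theta (p : ℕ) [Fact p.Prime] {E : Type*} [CommRing E] [Algebra ℚ_[p] E] (n : ℕ) (y : E) :
    (Fin n → ℚ_[p]) →ₗ[ℚ_[p]] E :=
  Fintype.linearCombination ℚ_[p] fun k : Fin n => y ^ (k : ℕ)

theorem theta_apply {p : ℕ} [Fact p.Prime] {E : Type*} [CommRing E] [Algebra ℚ_[p] E] {n : ℕ}
    (y : E) (w : Fin n → ℚ_[p]) : theta p n y w = ∑ k, w k • y ^ (k : ℕ) := rfl

theorem aeval_polyOf {p : ℕ} [Fact p.Prime] {E : Type*} [CommRing E] [Algebra ℚ_[p] E] {n : ℕ}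
    (y : E) (w : Fin n → ℚ_[p]) : aeval y (polyOf w) = theta p n y w := by
  simp [polyOf, theta_apply, Algebra.smul_def]

section Etale

variable {p : ℕ} [Fact p.Prime] {ι : Type*} [Fintype ι] {K : ι → Type*}
  [∀ i, NormedField (K i)] [∀ i, NormedAlgebra ℚ_[p] (K i)] [∀ i, FiniteDimensional ℚ_[p] (K i)]

/-- The conjugates of an element of an étale algebra. -/
def node (y : ∀ i, K i) (a : Node p K) : PadicAlgCl p := a.2 (y a.1)

theorem card_node : Fintype.card (Node p K) = Module.finrank ℚ_[p] (∀ i, K i) := by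
  rw [Fintype.card_sigma, Module.finrank_pi_fintype]
  exact Finset.sum_congr rfl fun i _ => AlgHom.card ℚ_[p] (K i) (PadicAlgCl p)

theorem exists_node (i : ι) : ∃ _σ : K i →ₐ[ℚ_[p]] PadicAlgCl p, True :=
  ⟨IsAlgClosed.lift, trivial⟩

theorem theta_apply_pi {n : ℕ} (y : ∀ i, K i) (w : Fin n → ℚ_[p]) (i : ι) :
    theta p n y w i = theta p n (y i) w := by
  simp [theta_apply]

theorem eval_node_map (y : ∀ i, K i) (G : ℚ_[p][X]) (a : Node p K) :
    (G.map (algebraMap ℚ_[p] (PadicAlgCl p))).eval (node y a) = a.2 (aeval (y a.1) G) := by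
  rw [eval_map_algebraMap, node, aeval_algHom_apply]

theorem norm_node_le (y : ∀ i, K i) (a : Node p K) : ‖node y a‖ ≤ ‖y‖ := by
  rw [node, norm_algHom]
  exact norm_le_pi_norm y _

theorem norm_node_sub (x y : ∀ i, K i) (a : Node p K) :
    ‖node y a - node x a‖ = ‖y a.1 - x a.1‖ := by
  rw [node, node, ← map_sub, norm_algHom]

open Classical in
/-- The conjugates of `y` are separated, with bound `d`. -/
def Sep (d : ℝ) (y : ∀ i, K i) : Prop :=
  0 < d ∧ ∀ a : Node p K, d ≤ ∏ b ∈ Finset.univ.erase a, ‖node y a - node y b‖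

variable {d : ℝ} {x y : ∀ i, K i} {n : ℕ}

theorem norm_node_sub_le_one (hy : ‖y‖ ≤ 1) (a b : Node p K) : ‖node y a - node y b‖ ≤ 1 := by
  rw [sub_eq_add_neg]
  refine (IsUltrametricDist.norm_add_le_max _ _).trans (max_le ((norm_node_le y a).trans hy) ?_)
  rw [norm_neg]
  exact (norm_node_le y b).trans hy

theorem Sep.le_one (hs : Sep (p := p) d y) (hy : ‖y‖ ≤ 1) (i : ι) : d ≤ 1 := by
  obtain ⟨σ, -⟩ := exists_node (p := p) (K := K) i
  exact (hs.2 ⟨i, σ⟩).trans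
    (Finset.prod_le_one (fun _ _ => norm_nonneg _) fun _ _ => norm_node_sub_le_one hy _ _)

theorem Sep.le_sub (hs : Sep (p := p) d y) (hy : ‖y‖ ≤ 1) {a b : Node p K} (hab : a ≠ b) :
    d ≤ ‖node y a - node y b‖ := by
  classical
  refine (hs.2 a).trans ?_
  rw [← Finset.mul_prod_erase _ _ (Finset.mem_erase.2 ⟨hab.symm, Finset.mem_univ b⟩)]
  exact mul_le_of_le_one_right (norm_nonneg _)
    (Finset.prod_le_one (fun _ _ => norm_nonneg _) fun _ _ => norm_node_sub_le_one hy _ _)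

/-- The conjugates of `∑ w_k y^k` are values of one polynomial at the conjugates of `y`, so Lagrange
interpolation recovers its coefficients at the cost of `1 / d`. Consequently `ℤ_p[y]` contains the
ball of radius `d` of `E`, on which all comparisons of lattices rest. -/
theorem Sep.norm_coeff_le (hs : Sep (p := p) d y) (hy : ‖y‖ ≤ 1)
    (hn : Fintype.card (Node p K) = n) (w : Fin n → ℚ_[p]) (k : Fin n) :
    ‖w k‖ ≤ ‖theta p n y w‖ / d := by
  classical
  have h := norm_coeff_le_of_eval (node (p := p) y) (fun a => (norm_node_le y a).trans hy) hs.1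
    hs.2 ((polyOf w).map (algebraMap ℚ_[p] (PadicAlgCl p))) (c := ‖theta p n y w‖)
    (by rw [degree_map, hn]; exact degree_polyOf_lt w) (fun a => ?_) (norm_nonneg _) k
  · rwa [coeff_map, norm_algebraMap', coeff_polyOf] at h
  · rw [eval_node_map, norm_algHom, aeval_polyOf, ← theta_apply_pi]
    exact norm_le_pi_norm (theta p n y w) _

/-- The isomorphism `w ↦ ∑ w_k y^k` attached to a separated element. -/
def Sep.thetaEquiv (hs : Sep (p := p) d y) (hy : ‖y‖ ≤ 1)
    (hn : Fintype.card (Node p K) = n) : (Fin n → ℚ_[p]) ≃ₗ[ℚ_[p]] ∀ i, K i :=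
  LinearEquiv.ofInjectiveOfFinrankEq (theta p n y)
    ((injective_iff_map_eq_zero _).2 fun w hw => by
      ext k
      have := hs.norm_coeff_le hy hn w k
      rw [hw, norm_zero, zero_div] at this
      exact norm_le_zero_iff.1 this)
    (by rw [← card_node (p := p) (K := K), hn, Module.finrank_fin_fun])

theorem Sep.thetaEquiv_apply (hs : Sep (p := p) d y) (hy : ‖y‖ ≤ 1)
    (hn : Fintype.card (Node p K) = n) (w : Fin n → ℚ_[p]) :
    hs.thetaEquiv hy hn w = theta p n y w := rfl

theorem Sep.exists_theta (hs : Sep (p := p) d y) (hy : ‖y‖ ≤ 1)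
    (hn : Fintype.card (Node p K) = n) (e : ∀ i, K i) : ∃ w, theta p n y w = e :=
  ⟨(hs.thetaEquiv hy hn).symm e, by
    rw [← hs.thetaEquiv_apply hy hn, LinearEquiv.apply_symm_apply]⟩

theorem Sep.exists_integral_theta (hs : Sep (p := p) d y) (hy : ‖y‖ ≤ 1)
    (hn : Fintype.card (Node p K) = n) {e : ∀ i, K i} (he : ‖e‖ ≤ d) :
    ∃ w ∈ L0 p n, theta p n y w = e := by
  obtain ⟨w, hw⟩ := hs.exists_theta hy hn e
  refine ⟨w, fun k => (hs.norm_coeff_le hy hn w k).trans ?_, hw⟩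
  rw [hw]
  exact (div_le_one hs.1).2 he

/-- Distinct conjugates of `x` are at distance at least `d`, and moving each by less than `d` leaves
such an ultrametric distance unchanged. -/
theorem Sep.of_close (hs : Sep (p := p) d x) (hx : ‖x‖ ≤ 1) (hxy : ∀ i, ‖y i - x i‖ < d) :
    Sep (p := p) d y := by
  classical
  refine ⟨hs.1, fun a => (hs.2 a).trans_eq (Finset.prod_congr rfl fun b hb => ?_)⟩
  have h1 := hs.le_sub hx (Finset.ne_of_mem_erase hb).symm
  have h2 : ‖(node y a - node y b) - (node x a - node x b)‖ < d := by
    have : (node y a - node y b) - (node x a - node x b) =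
      (node y a - node x a) + -(node y b - node x b) := by ring
    rw [this]
    refine (IsUltrametricDist.norm_add_le_max _ _).trans_lt (max_lt ?_ ?_)
    · rw [norm_node_sub]; exact hxy _
    · rw [norm_neg, norm_node_sub]; exact hxy _
  have h3 : node y a - node y b = (node x a - node x b) +
    ((node y a - node y b) - (node x a - node x b)) := by ring
  rw [h3, IsUltrametricDist.norm_add_eq_max_of_norm_ne_norm (h2.trans_le h1).ne',
    max_eq_left (h2.trans_le h1).le]

/-- The monic polynomial of degree `n` vanishing at all conjugates of `y`. -/
theorem Sep.map_eq_prod (hs : Sep (p := p) d y) (hy : ‖y‖ ≤ 1)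
    (hn : Fintype.card (Node p K) = n) {f : Fin n → ℚ_[p]} (hf : y ^ n = theta p n y f) :
    (X ^ n - polyOf f).map (algebraMap ℚ_[p] (PadicAlgCl p)) =
      ∏ a : Node p K, (X - C (node y a)) := by
  set G := (X ^ n - polyOf f).map (algebraMap ℚ_[p] (PadicAlgCl p)) with hG
  have hmon : G.Monic := (monic_X_pow_sub (degree_polyOf_lt f)).map _
  have hdeg : G.natDegree = n := by
    rw [hG, natDegree_map]
    exact natDegree_eq_of_degree_eq_some (degree_sub_eq_left_of_degree_lt
      (by rw [degree_X_pow]; exact degree_polyOf_lt f) |>.trans (degree_X_pow n))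
  have hroot : ∀ a : Node p K, G.IsRoot (node y a) := by
    intro a
    rw [IsRoot, hG, eval_node_map, map_sub, map_pow, aeval_X, aeval_polyOf, ← theta_apply_pi,
      ← hf, Pi.pow_apply, sub_self, map_zero]
  have hinj : Function.Injective (node (p := p) y) := by
    intro a b hab
    by_contra hne
    have := hs.le_sub hy hne
    rw [hab, sub_self, norm_zero] at this
    exact absurd hs.1 (not_lt.2 this)
  have hdvd : (∏ a : Node p K, (X - C (node y a))) ∣ G := by
    refine Finset.prod_dvd_of_coprime (fun a _ b _ hab => ?_) fun a _ => dvd_iff_isRoot.2 (hroot a)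
    exact pairwise_coprime_X_sub_C hinj hab
  have hmon' : (∏ a : Node p K, (X - C (node y a))).Monic :=
    monic_prod_of_monic _ _ fun a _ => monic_X_sub_C _
  refine eq_of_monic_of_dvd_of_natDegree_le hmon' hmon hdvd ?_
  rw [hdeg, natDegree_prod_of_monic _ _ fun a _ => monic_X_sub_C _]
  simp [hn]

theorem Sep.norm_charCoeff_le_one (hs : Sep (p := p) d y) (hy : ‖y‖ ≤ 1)
    (hn : Fintype.card (Node p K) = n) {f : Fin n → ℚ_[p]} (hf : y ^ n = theta p n y f)
    (k : Fin n) : ‖f k‖ ≤ 1 := by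
  have h := congrArg (fun G => ‖G.coeff k‖) (hs.map_eq_prod hy hn hf)
  simp only [coeff_map, norm_algebraMap', coeff_sub, coeff_X_pow, coeff_polyOf, k.2.ne,
    if_false, zero_sub, norm_neg] at h
  rw [h]
  exact norm_coeff_prod_X_sub_C_le _ _ (fun a => (norm_node_le y a).trans hy) _

/-- At a root, the derivative of a product of linear factors is the product of the differences with
the other roots. -/
theorem Sep.le_norm_derivative (hs : Sep (p := p) d y) (hy : ‖y‖ ≤ 1)
    (hn : Fintype.card (Node p K) = n) {f : Fin n → ℚ_[p]} (hf : y ^ n = theta p n y f) (i : ι) :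
    d ≤ ‖aeval (y i) (derivative (X ^ n - polyOf f))‖ := by
  classical
  obtain ⟨σ, -⟩ := exists_node (p := p) (K := K) i
  rw [← norm_algHom σ, ← eval_node_map y _ ⟨i, σ⟩, ← derivative_map, hs.map_eq_prod hy hn hf,
    ← Finset.mul_prod_erase _ _ (Finset.mem_univ (⟨i, σ⟩ : Node p K)), derivative_mul]
  simp only [eval_add, eval_mul, derivative_sub, derivative_X, derivative_C, sub_zero, one_mul, eval_sub, eval_X, eval_C, sub_self, zero_mul, add_zero, eval_prod, norm_prod]
  exact hs.2 ⟨i, σ⟩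

variable [∀ i, IsUltrametricDist (K i)]

/-- A polynomial which almost vanishes at a separated element has a root nearby. -/
theorem Sep.exists_root (hs : Sep (p := p) d x) (hx : ‖x‖ ≤ 1)
    (hn : Fintype.card (Node p K) = n) {ρ : ι → ℝ} (hρ : ∀ i, ρ i < d ^ 2)
    {a : Fin n → ℚ_[p]} (ha : ∀ i, ‖x i ^ n - theta p n x a i‖ ≤ ρ i) :
    a ∈ L0 p n ∧ ∃ y : ∀ i, K i, y ^ n = theta p n y a ∧ ∀ i, ‖y i - x i‖ ≤ ρ i / d := by
  have hd := hs.1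
  obtain ⟨f, hf⟩ := hs.exists_theta hx hn (x ^ n)
  have hf1 := hs.norm_charCoeff_le_one hx hn hf.symm
  have hsub : ∀ i, theta p n x (f - a) i = x i ^ n - theta p n x a i := by
    intro i
    rw [map_sub, hf]; rfl
  have hlt : ‖theta p n x (f - a)‖ < d ^ 2 := by
    rw [pi_norm_lt_iff (by positivity)]
    intro i
    rw [hsub]
    exact (ha i).trans_lt (hρ i)
  -- `theta p n x (f - a)` is the value at `x` of `X ^ n - polyOf a`, of size below `d ^ 2`; passing
  -- to coefficients costs a factor `1 / d`.
  have hfa : ∀ k, ‖f k - a k‖ < d := by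
    intro k
    refine (hs.norm_coeff_le hx hn (f - a) k).trans_lt ?_
    rw [div_lt_iff₀ hd, ← sq]
    exact hlt
  -- The index `i` serves only to obtain `d ≤ 1`; without factors `n = 0` and integrality is
  -- vacuous.
  have hLa : ∀ i : ι, a ∈ L0 p n := by
    intro i k
    have : a k = f k + -(f k - a k) := by ring
    rw [this]
    refine (IsUltrametricDist.norm_add_le_max _ _).trans (max_le (hf1 k) ?_)
    rw [norm_neg]
    exact (hfa k).le.trans (hs.le_one hx i)
  refine ⟨fun k => ?_, ?_⟩
  · have : 0 < Fintype.card (Node p K) := hn ▸ (Nat.zero_le _).trans_lt k.2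
    obtain ⟨b⟩ := Fintype.card_pos_iff.1 this
    exact hLa b.1 k
  have hex : ∀ i, ∃ z : K i, z ^ n = theta p n z a ∧ ‖z - x i‖ ≤ ρ i / d := by
    intro i
    have : CompleteSpace (K i) := FiniteDimensional.complete ℚ_[p] (K i)
    have hxi : ‖x i‖ ≤ 1 := (norm_le_pi_norm x i).trans hx
    have hcoef : ∀ b : Fin n → ℚ_[p], b ∈ L0 p n → ∀ k, ‖(polyOf b).coeff k‖ ≤ 1 := by
      intro b hb k
      rcases lt_or_ge k n with hk | hk
      · have h1 := hb ⟨k, hk⟩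
        have h2 := coeff_polyOf b ⟨k, hk⟩
        simp only at h2
        rw [h2]; exact h1
      · rw [coeff_polyOf_of_le _ hk, norm_zero]; exact zero_le_one
    let G : ℚ_[p][X] := X ^ n - polyOf a
    let F : ℚ_[p][X] := X ^ n - polyOf f
    have hG : ∀ k, ‖(G.map (algebraMap ℚ_[p] (K i))).coeff k‖ ≤ 1 := by
      intro k
      rw [coeff_map, norm_algebraMap']
      rw [show G.coeff k = (X ^ n : ℚ_[p][X]).coeff k + -(polyOf a).coeff k by
        rw [← sub_eq_add_neg, ← coeff_sub]]
      refine (IsUltrametricDist.norm_add_le_max _ _).trans (max_le ?_ ?_)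
      · rw [coeff_X_pow]; split_ifs <;> simp
      · rw [norm_neg]; exact hcoef a (hLa i) k
    have hev : ∀ z : K i, (G.map (algebraMap ℚ_[p] (K i))).eval z = z ^ n - theta p n z a := by
      intro z
      rw [eval_map_algebraMap, map_sub, map_pow, aeval_X, aeval_polyOf]
    have hevx : ‖(G.map (algebraMap ℚ_[p] (K i))).eval (x i)‖ ≤ ρ i := by
      rw [hev, ← theta_apply_pi]; exact ha i
    -- At `x i` the derivatives of `G` and of the characteristic polynomial `F` of `x` differ by
    -- less than `d`, while that of `F` has size at least `d`; so the two have the same absolute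
    -- value.
    have hder : d ≤ ‖(G.map (algebraMap ℚ_[p] (K i))).derivative.eval (x i)‖ := by
      have h1 := hs.le_norm_derivative hx hn hf.symm i
      have h2 : aeval (x i) (derivative G) = aeval (x i) (derivative F) +
          aeval (x i) (derivative (polyOf (f - a))) := by
        have : polyOf (f - a) = polyOf f - polyOf a := by
          simp [polyOf, sub_mul, Finset.sum_sub_distrib]
        rw [this, ← map_add, ← map_add]
        congr 2
        simp only [F, G]; ring
      have h3 : ‖aeval (x i) (derivative (polyOf (f - a)))‖ < d := by
        rw [← eval_map_algebraMap, eval_eq_sum_range]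
        refine (IsUltrametricDist.exists_norm_finsetSum_le _ _).choose_spec.2.trans_lt ?_
        generalize (IsUltrametricDist.exists_norm_finsetSum_le (Finset.range
          ((map (algebraMap ℚ_[p] (K i)) (derivative (polyOf (f - a)))).natDegree + 1))
          fun k => (map (algebraMap ℚ_[p] (K i)) (derivative (polyOf (f - a)))).coeff k *
            x i ^ k).choose = k
        rw [norm_mul, norm_pow, coeff_map, norm_algebraMap', coeff_derivative, norm_mul]
        have h4 : ‖(polyOf (f - a)).coeff (k + 1)‖ < d := by
          rcases lt_or_ge (k + 1) n with hk | hk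
          · have h5 := coeff_polyOf (f - a) ⟨k + 1, hk⟩
            simp only at h5
            rw [h5]; exact hfa _
          · rw [coeff_polyOf_of_le _ hk, norm_zero]; exact hd
        refine lt_of_le_of_lt ?_ h4
        have h6 : ‖(k : ℚ_[p]) + 1‖ ≤ 1 := by
          exact_mod_cast IsUltrametricDist.norm_natCast_le_one ℚ_[p] (k + 1)
        have h7 : ‖x i‖ ^ k ≤ 1 := pow_le_one₀ (norm_nonneg _) hxi
        calc _ ≤ ‖(polyOf (f - a)).coeff (k + 1)‖ * 1 * 1 := by gcongr
          _ = _ := by ring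
      rw [derivative_map, eval_map_algebraMap, h2,
        IsUltrametricDist.norm_add_eq_max_of_norm_ne_norm (h3.trans_le h1).ne', max_eq_left
        (h3.trans_le h1).le]
      exact h1
    obtain ⟨z, hz, hzx⟩ := exists_root_of_norm_eval_lt hG hxi hd hder (hevx.trans_lt (hρ i))
    refine ⟨z, ?_, hzx.trans (div_le_div_of_nonneg_right hevx hd.le)⟩
    rw [hev] at hz
    exact sub_eq_zero.1 hz
  choose z hz hzx using hex
  refine ⟨z, ?_, hzx⟩
  ext i
  rw [theta_apply_pi, ← hz i, Pi.pow_apply]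

end Etale

end

section

open Metric Polynomial

/-! ### Lattices in normed spaces over `ℚ_p` -/

section Lattice

variable {p : ℕ} [Fact p.Prime] {X : Type*} [NormedAddCommGroup X] [NormedSpace ℚ_[p] X]
  [FiniteDimensional ℚ_[p] X] [IsUltrametricDist X] [Module ℤ_[p] X] [IsScalarTower ℤ_[p] ℚ_[p] X]

theorem padicInt_smul (c : ℤ_[p]) (e : X) : c • e = (c : ℚ_[p]) • e :=
  (algebraMap_smul ℚ_[p] c e).symm

theorem smul_mem_of_norm_le_one (M : Submodule ℤ_[p] X) {c : ℚ_[p]} (hc : ‖c‖ ≤ 1) {e : X}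
    (he : e ∈ M) : c • e ∈ M := by
  have := M.smul_mem (⟨c, hc⟩ : ℤ_[p]) he
  have h2 := padicInt_smul (⟨c, hc⟩ : ℤ_[p]) e
  exact h2 ▸ this

theorem exists_padic_norm_mul_le (p : ℕ) [Fact p.Prime] {C ε : ℝ} (hε : 0 < ε) :
    ∃ c : ℚ_[p], c ≠ 0 ∧ ‖c‖ ≤ 1 ∧ ‖c‖ * C ≤ ε := by
  have hp : (1 : ℝ) < p := by exact_mod_cast (Fact.out : p.Prime).one_lt
  obtain ⟨k, hk⟩ := pow_unbounded_of_one_lt (C / ε) hp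
  refine ⟨(p : ℚ_[p]) ^ k, pow_ne_zero _ (by exact_mod_cast (Fact.out : p.Prime).ne_zero), ?_, ?_⟩
  · rw [norm_pow, Padic.norm_p]
    exact pow_le_one₀ (by positivity) (inv_le_one_of_one_le₀ hp.le)
  · rw [norm_pow, Padic.norm_p, inv_pow, inv_mul_le_iff₀ (by positivity)]
    exact ((div_lt_iff₀ hε).1 hk).le

/-- Boundedness places `M` inside the `ℤ_p`-span of a rescaled basis, and `ℤ_p` is noetherian; a
ball around `0` spans the space. -/
theorem isLattice_of_bounds {M : Submodule ℤ_[p] X} {ε C : ℝ} (hε : 0 < ε)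
    (h1 : ∀ e : X, ‖e‖ ≤ ε → e ∈ M) (h2 : ∀ e ∈ M, ‖e‖ ≤ C) : Submodule.IsLattice ℚ_[p] M := by
  constructor
  · let b := Module.finBasis ℚ_[p] X
    let f : X →L[ℚ_[p]] (Fin (Module.finrank ℚ_[p] X) → ℚ_[p]) :=
      LinearMap.toContinuousLinearMap b.equivFun.toLinearMap
    obtain ⟨c, hc0, -, hc⟩ := exists_padic_norm_mul_le p (C := ‖f‖ * C) one_pos
    have hle : M ≤ Submodule.span ℤ_[p] (Set.range fun j => c⁻¹ • b j) := by
      intro e he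
      have h3 : e = ∑ j, (c * b.repr e j) • (c⁻¹ • b j) := by
        conv_lhs => rw [← b.sum_repr e]
        refine Finset.sum_congr rfl fun j _ => ?_
        rw [smul_smul]; congr 1; field_simp
      rw [h3]
      refine Submodule.sum_mem _ fun j _ => ?_
      refine smul_mem_of_norm_le_one _ ?_ (Submodule.subset_span ⟨j, rfl⟩)
      rw [norm_mul]
      refine (mul_le_mul_of_nonneg_left ?_ (norm_nonneg c)).trans hc
      calc ‖b.repr e j‖ = ‖f e j‖ := rfl
        _ ≤ ‖f e‖ := norm_le_pi_norm _ _
        _ ≤ ‖f‖ * ‖e‖ := f.le_opNorm e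
        _ ≤ ‖f‖ * C := mul_le_mul_of_nonneg_left (h2 e he) (norm_nonneg _)
    have hfg : (Submodule.span ℤ_[p] (Set.range fun j => c⁻¹ • b j)).FG :=
      Submodule.fg_span (Set.finite_range _)
    exact Submodule.FG.of_le hfg hle
  · rw [eq_top_iff]
    intro e _
    obtain ⟨c, hc0, -, hc⟩ := exists_padic_norm_mul_le p (C := ‖e‖) hε
    have : e = c⁻¹ • (c • e) := by rw [smul_smul, inv_mul_cancel₀ hc0, one_smul]
    rw [this]
    refine Submodule.smul_mem _ _ (Submodule.subset_span (h1 _ ?_))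
    rwa [norm_smul]

/-- A member of `S` is a union of `ε`-balls inside the ball of radius `C`, hence is determined by
the points it contains of a finite `ε`-net. -/
theorem finite_of_bounds {S : Set (Submodule ℤ_[p] X)} {ε C : ℝ} (hε : 0 < ε)
    (h1 : ∀ M ∈ S, ∀ e : X, ‖e‖ ≤ ε → e ∈ M) (h2 : ∀ M ∈ S, ∀ e ∈ M, ‖e‖ ≤ C) : S.Finite := by
  have hprop : ProperSpace X := FiniteDimensional.proper ℚ_[p] _
  obtain ⟨T, -, hT, hcov⟩ := (isCompact_closedBall (0 : X) C).finite_cover_balls hε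
  refine Set.Finite.of_finite_image (f := fun M : Submodule ℤ_[p] X => T ∩ M)
    (hT.finite_subsets.subset ?_) ?_
  · rintro _ ⟨M, -, rfl⟩
    exact Set.inter_subset_left
  · have key : ∀ M ∈ S, ∀ M' ∈ S, T ∩ (M : Set X) = T ∩ M' → M ≤ M' := by
      intro M hM M' hM' h e he
      obtain ⟨t, ht, het⟩ := Set.mem_iUnion₂.1 (hcov (mem_closedBall_zero_iff.2 (h2 M hM e he)))
      have h3 : ‖e - t‖ ≤ ε := (mem_ball_iff_norm.1 het).le
      have h4 : t ∈ M := by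
        have := sub_mem he (h1 M hM _ h3)
        simpa using this
      have h5 : t ∈ M' := ((Set.ext_iff.1 h t).1 ⟨ht, h4⟩).2
      have := add_mem h5 (h1 M' hM' _ h3)
      simpa using this
    exact fun M hM M' hM' h => le_antisymm (key M hM M' hM' h) (key M' hM' M hM h.symm)

theorem exists_basis_of_isLattice (M : Submodule ℤ_[p] X) [hM : Submodule.IsLattice ℚ_[p] M]
    {n : ℕ} (hn : Module.finrank ℚ_[p] X = n) :
    ∃ B : Module.Basis (Fin n) ℚ_[p] X, ∀ e, e ∈ M ↔ ∀ j, ‖B.repr e j‖ ≤ 1 := by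
  have hfree : Module.Free ℤ_[p] M := Submodule.IsLattice.free ℚ_[p] M
  have hfin : Module.Finite ℤ_[p] M := Module.Finite.iff_fg.2 hM.fg
  have hrank : Module.finrank ℤ_[p] M = n := by
    rw [← hn, Module.finrank, Module.finrank, Submodule.IsLattice.rank' ℚ_[p] M]
  let b := Module.finBasisOfFinrankEq ℤ_[p] M hrank
  let B := b.extendOfIsLattice ℚ_[p]
  have hB : ∀ k, B k = (b k : X) := fun k => b.extendOfIsLattice_apply ℚ_[p] k
  refine ⟨B, fun e => ⟨fun he j => ?_, fun h => ?_⟩⟩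
  · have h3 : e = ∑ k, (b.repr ⟨e, he⟩ k : ℚ_[p]) • B k := by
      refine (congrArg Subtype.val (b.sum_repr ⟨e, he⟩)).symm.trans ?_
      rw [AddSubmonoidClass.coe_finsetSum]
      exact Finset.sum_congr rfl fun k _ => by rw [hB, ← padicInt_smul]; rfl
    have h5 : B.repr e j = (b.repr ⟨e, he⟩ j : ℚ_[p]) := by
      conv_lhs => rw [h3]
      rw [B.repr_sum_self]
    rw [h5]
    exact PadicInt.norm_le_one _
  · rw [← B.sum_repr e]
    refine Submodule.sum_mem _ fun j _ => smul_mem_of_norm_le_one _ (h j) ?_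
    rw [hB]
    exact (b j).2

theorem bounds_of_isLattice (M : Submodule ℤ_[p] X) [Submodule.IsLattice ℚ_[p] M] :
    ∃ ε C : ℝ, 0 < ε ∧ (∀ e : X, ‖e‖ ≤ ε → e ∈ M) ∧ ∀ e ∈ M, ‖e‖ ≤ C := by
  obtain ⟨B, hB⟩ := exists_basis_of_isLattice M rfl
  let f : X →L[ℚ_[p]] (Fin (Module.finrank ℚ_[p] X) → ℚ_[p]) :=
    LinearMap.toContinuousLinearMap B.equivFun.toLinearMap
  refine ⟨(‖f‖ + 1)⁻¹, ∑ j, ‖B j‖, by positivity, fun e he => (hB e).2 fun j => ?_,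
    fun e he => ?_⟩
  · calc ‖B.repr e j‖ = ‖f e j‖ := rfl
      _ ≤ ‖f e‖ := norm_le_pi_norm _ _
      _ ≤ ‖f‖ * ‖e‖ := f.le_opNorm e
      _ ≤ (‖f‖ + 1) * (‖f‖ + 1)⁻¹ := by gcongr; linarith
      _ = 1 := mul_inv_cancel₀ (by positivity)
  · rw [← B.sum_repr e]
    refine (norm_sum_le _ _).trans (Finset.sum_le_sum fun j _ => ?_)
    rw [norm_smul]
    exact mul_le_of_le_one_left (norm_nonneg _) ((hB e).1 he j)

theorem exists_GL_vecMul {n : ℕ} (f : (Fin n → ℚ_[p]) ≃ₗ[ℚ_[p]] (Fin n → ℚ_[p])) :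
    ∃ H : GL (Fin n) ℚ_[p], ∀ v, f v = Matrix.vecMul v H.1 := by
  have key : ∀ g h : (Fin n → ℚ_[p]) ≃ₗ[ℚ_[p]] (Fin n → ℚ_[p]), (∀ v, g (h v) = v) →
      LinearMap.toMatrixRight' h.toLinearMap * LinearMap.toMatrixRight' g.toLinearMap = 1 := by
    intro g h hgh
    apply Matrix.toLinearMapRight'.injective
    refine LinearMap.ext fun v => ?_
    have hg := LinearMap.toMatrixRight'.symm_apply_apply g.toLinearMap
    have hh := LinearMap.toMatrixRight'.symm_apply_apply h.toLinearMap
    rw [Matrix.toLinearMapRight'_mul_apply, Matrix.toLinearMapRight'_one]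
    have h1 := DFunLike.congr_fun hh v
    have h2 := DFunLike.congr_fun hg (h v)
    exact (congrArg _ h1).trans (h2.trans (hgh v))
  refine ⟨⟨LinearMap.toMatrixRight' f.toLinearMap, LinearMap.toMatrixRight' f.symm.toLinearMap,
    key _ _ (by simp), key _ _ (by simp)⟩, fun v => ?_⟩
  have := LinearMap.toMatrixRight'.symm_apply_apply f.toLinearMap
  exact (DFunLike.congr_fun this v).symm

/-- `H` encodes the lattice in the coordinates `θ`; by `mem_mulLeft_IntGL_iff` it is unique up to a
right factor in `GL_n(ℤ_p)`, so lattices correspond to cosets `H GL_n(ℤ_p)`. -/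
theorem exists_GL_lattice (M : Submodule ℤ_[p] X) [Submodule.IsLattice ℚ_[p] M] {n : ℕ}
    (θ : (Fin n → ℚ_[p]) ≃ₗ[ℚ_[p]] X) :
    ∃ H : GL (Fin n) ℚ_[p], ∀ w, θ w ∈ M ↔ Matrix.vecMul w H.1 ∈ L0 p n := by
  obtain ⟨B, hB⟩ := exists_basis_of_isLattice M (n := n)
    (by rw [← θ.finrank_eq, Module.finrank_fin_fun])
  obtain ⟨H, hH⟩ := exists_GL_vecMul (θ.trans B.equivFun)
  refine ⟨H, fun w => ?_⟩
  rw [hB, ← hH]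
  rfl

/-- The matrices carrying the lattice `{w | w H ∈ ℤ_p^n}` onto `ℤ_p^n`. -/
theorem mem_mulLeft_IntGL_iff {n : ℕ} (H B : GL (Fin n) ℚ_[p]) :
    B.1 ∈ mulLeftEquiv H '' IntGL p n ↔
      ∀ w, Matrix.vecMul w H.1 ∈ L0 p n ↔ Matrix.vecMul w B.1 ∈ L0 p n := by
  have rows : ∀ g : GL (Fin n) ℚ_[p], (∀ w ∈ L0 p n, Matrix.vecMul w g.1 ∈ L0 p n) →
      g.1 ∈ Mat0 p n := by
    intro g hg i j
    have := hg (Pi.single i 1) (norm_single_le i) j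
    rwa [Matrix.single_one_vecMul] at this
  constructor
  · rintro ⟨_, ⟨g, rfl, hg, hg'⟩, hB⟩ w
    have hB' : B.1 = H.1 * g.1 := hB.symm
    constructor
    · intro hw
      rw [hB', ← Matrix.vecMul_vecMul]
      exact integral_vecMul hw hg
    · intro hw
      have : Matrix.vecMul w H.1 = Matrix.vecMul (Matrix.vecMul w B.1) (g⁻¹).1 := by
        rw [hB', Matrix.vecMul_vecMul, mul_assoc, ← Units.val_mul, mul_inv_cancel]
        simp
      rw [this]
      exact integral_vecMul hw hg'
  · intro h
    refine ⟨(H⁻¹ * B).1, ⟨H⁻¹ * B, rfl, rows _ fun w hw => ?_, rows _ fun w hw => ?_⟩, ?_⟩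
    · rw [Units.val_mul, ← Matrix.vecMul_vecMul]
      refine (h _).1 ?_
      rw [Matrix.vecMul_vecMul, ← Units.val_mul, inv_mul_cancel]
      simpa using hw
    · rw [mul_inv_rev, inv_inv, Units.val_mul, ← Matrix.vecMul_vecMul]
      refine (h _).2 ?_
      rw [Matrix.vecMul_vecMul, ← Units.val_mul, inv_mul_cancel]
      simpa using hw
    · change H.1 * (H⁻¹ * B).1 = B.1
      rw [← Units.val_mul, mul_inv_cancel_left]

end Lattice

/-! ### Normalized lattices in étale algebras -/

theorem theta_mul_mem {p : ℕ} [Fact p.Prime] {E : Type*} [NormedCommRing E]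
    [NormedAlgebra ℚ_[p] E] [FiniteDimensional ℚ_[p] E] [IsUltrametricDist E] [Module ℤ_[p] E]
    [IsScalarTower ℤ_[p] ℚ_[p] E] {M : Submodule ℤ_[p] E} {x : E} (hx : ∀ e ∈ M, x * e ∈ M)
    {n : ℕ} {w : Fin n → ℚ_[p]} (hw : w ∈ L0 p n) {e : E} (he : e ∈ M) :
    theta p n x w * e ∈ M := by
  rw [theta_apply, Finset.sum_mul]
  refine Submodule.sum_mem _ fun k _ => ?_
  rw [smul_mul_assoc]
  refine smul_mem_of_norm_le_one M (hw k) ?_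
  induction (k : ℕ) with
  | zero => simpa using he
  | succ k ih => rw [pow_succ', mul_assoc]; exact hx _ ih

section NormLat

variable {p : ℕ} [Fact p.Prime] {ι : Type*} [Fintype ι] {K : ι → Type*}
  [∀ i, NormedField (K i)] [∀ i, NormedAlgebra ℚ_[p] (K i)] [∀ i, FiniteDimensional ℚ_[p] (K i)]
  [∀ i, IsUltrametricDist (K i)] [∀ i, Algebra ℤ_[p] (K i)]
  [∀ i, IsScalarTower ℤ_[p] ℚ_[p] (K i)]

/-- The lattices stable under `x` which are contained in the unit ball and in no smaller polydisc. -/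
def NormLat (p : ℕ) [Fact p.Prime] {K : ι → Type*} [∀ i, NormedField (K i)]
    [∀ i, Algebra ℤ_[p] (K i)] (x : ∀ i, K i) : Set (Submodule ℤ_[p] (∀ i, K i)) :=
  {M | (∀ e ∈ M, x * e ∈ M) ∧ (∀ e ∈ M, ‖e‖ ≤ 1) ∧ ∀ i, ∃ e ∈ M, ‖e i‖ = 1}

variable {d : ℝ} {x y : ∀ i, K i} {n : ℕ}

/-- Split `e` into components. If `c ∈ M` has `‖c i‖ = 1`, then `e i / c i` placed in the `i`-th
factor has norm at most `d`; it is therefore an integral polynomial in `x`, and it carries `c` to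
the `i`-th component of `e`. -/
theorem Sep.mem_of_norm_le (hs : Sep (p := p) d x) (hx : ‖x‖ ≤ 1)
    (hn : Fintype.card (Node p K) = n) {M : Submodule ℤ_[p] (∀ i, K i)}
    (hM : ∀ e ∈ M, x * e ∈ M) (hM1 : ∀ i, ∃ e ∈ M, ‖e i‖ = 1) {e : ∀ i, K i} (he : ‖e‖ ≤ d) :
    e ∈ M := by
  classical
  have h1 : e = ∑ i, Pi.single i (e i) := (Finset.univ_sum_single e).symm
  rw [h1]
  refine Submodule.sum_mem _ fun i _ => ?_
  obtain ⟨c, hc, hci⟩ := hM1 i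
  have hci0 : c i ≠ 0 := by
    intro h0
    rw [h0, norm_zero] at hci
    exact zero_ne_one hci
  obtain ⟨w, hw, hwe⟩ := hs.exists_integral_theta hx hn (e := Pi.single i (e i / c i)) (by
    rw [pi_norm_le_iff_of_nonneg hs.1.le]
    intro j
    rcases eq_or_ne j i with rfl | hj
    · rw [Pi.single_eq_same, norm_div, hci, div_one]
      exact (norm_le_pi_norm e j).trans he
    · rw [Pi.single_eq_of_ne hj, norm_zero]; exact hs.1.le)
  have h2 : Pi.single i (e i) = theta p n x w * c := by
    rw [hwe]
    ext j
    rcases eq_or_ne j i with rfl | hj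
    · simp [hci0]
    · simp [hj]
  rw [h2]
  exact theta_mul_mem hM hw hc

/-- `y - x` has norm at most `d`, hence lies in `ℤ_p[x]`. -/
theorem stable_of_close (hs : Sep (p := p) d x) (hx : ‖x‖ ≤ 1)
    (hn : Fintype.card (Node p K) = n) (hxy : ‖y - x‖ ≤ d) {M : Submodule ℤ_[p] (∀ i, K i)}
    (hM : ∀ e ∈ M, x * e ∈ M) : ∀ e ∈ M, y * e ∈ M := by
  intro e he
  obtain ⟨w, hw, hwe⟩ := hs.exists_integral_theta hx hn hxy
  have : y * e = theta p n x w * e + x * e := by rw [hwe]; ring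
  rw [this]
  exact add_mem (theta_mul_mem hM hw he) (hM e he)

/-- The coefficients of `w` are at most `1 / d` and the powers of `x` and `y` differ by at most `d ^
2`, so the two values differ by at most `d`, that is, by an element of `M`. As the root given by
`Sep.exists_root` is within `ρ i / d` of `x i`, this is the origin of the condition `ρ i ≤ d ^ 3`.
-/
theorem theta_mem_of_close (hs : Sep (p := p) d x) (hx : ‖x‖ ≤ 1) (hy : ‖y‖ ≤ 1)
    (hn : Fintype.card (Node p K) = n) (hxy : ‖y - x‖ ≤ d ^ 2) {M : Submodule ℤ_[p] (∀ i, K i)}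
    (hM : ∀ e, ‖e‖ ≤ d → e ∈ M) (hM1 : ∀ e ∈ M, ‖e‖ ≤ 1) {w : Fin n → ℚ_[p]}
    (hw : theta p n x w ∈ M) : theta p n y w ∈ M := by
  have hd := hs.1
  have h1 : theta p n y w = theta p n x w + (theta p n y w - theta p n x w) := by ring
  rw [h1]
  refine add_mem hw (hM _ ((pi_norm_le_iff_of_nonneg hd.le).2 fun i => ?_))
  have h2 : (theta p n y w - theta p n x w) i = ∑ k, w k • (y i ^ (k : ℕ) - x i ^ (k : ℕ)) := by
    simp [theta_apply, smul_sub]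
  rw [h2]
  refine IsUltrametricDist.norm_sum_le_of_forall_le_of_nonneg hd.le fun k _ => ?_
  rw [norm_smul]
  have h3 : ‖w k‖ ≤ 1 / d := (hs.norm_coeff_le hx hn w k).trans (by gcongr; exact hM1 _ hw)
  have h4 : ‖y i ^ (k : ℕ) - x i ^ (k : ℕ)‖ ≤ d ^ 2 :=
    (norm_pow_sub_pow_le ((norm_le_pi_norm y i).trans hy) ((norm_le_pi_norm x i).trans hx) _).trans
      ((norm_le_pi_norm (y - x) i).trans hxy)
  calc _ ≤ 1 / d * d ^ 2 := by gcongr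
    _ = d := by field_simp

theorem NormLat.finite (hs : Sep (p := p) d x) (hx : ‖x‖ ≤ 1)
    (hn : Fintype.card (Node p K) = n) : (NormLat p x).Finite :=
  finite_of_bounds hs.1 (fun _ hM _ he => hs.mem_of_norm_le hx hn hM.1 hM.2.2 he)
    fun _ hM => hM.2.1

theorem NormLat.isLattice (hs : Sep (p := p) d x) (hx : ‖x‖ ≤ 1)
    (hn : Fintype.card (Node p K) = n) {M : Submodule ℤ_[p] (∀ i, K i)} (hM : M ∈ NormLat p x) :
    Submodule.IsLattice ℚ_[p] M :=
  isLattice_of_bounds hs.1 (fun _ he => hs.mem_of_norm_le hx hn hM.1 hM.2.2 he) hM.2.1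

theorem normLat_eq_of_close (hs : Sep (p := p) d x) (hs' : Sep (p := p) d y) (hx : ‖x‖ ≤ 1)
    (hy : ‖y‖ ≤ 1) (hn : Fintype.card (Node p K) = n) (hxy : ‖y - x‖ ≤ d) :
    NormLat p x = NormLat p y := by
  ext M
  refine and_congr_left fun _ => ⟨stable_of_close hs hx hn hxy, stable_of_close hs' hy hn ?_⟩
  rwa [norm_sub_rev]

end NormLat

end

section

open Metric Polynomial
open scoped ENNReal

/-! ### Matrices as multiplication operators -/

theorem charpoly_eq {F : Type*} [Field F] {n : ℕ} (A : Matrix (Fin n) (Fin n) F) :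
    A.charpoly = X ^ n - polyOf (charCoeff A) := by
  ext k
  rw [coeff_sub, coeff_X_pow]
  rcases lt_trichotomy k n with hk | rfl | hk
  · have := coeff_polyOf (charCoeff A) ⟨k, hk⟩
    simp only at this
    rw [this, if_neg hk.ne, charCoeff, zero_sub, neg_neg]
  · have h1 := A.charpoly_monic
    rw [Monic, leadingCoeff, Matrix.charpoly_natDegree_eq_dim, Fintype.card_fin] at h1
    rw [h1, coeff_polyOf_of_le _ le_rfl, if_pos rfl, sub_zero]
  · rw [coeff_polyOf_of_le _ hk.le, if_neg hk.ne', sub_zero]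
    refine coeff_eq_zero_of_natDegree_lt ?_
    rwa [Matrix.charpoly_natDegree_eq_dim, Fintype.card_fin]

section Operator

variable {p : ℕ} [Fact p.Prime] {ι : Type*} [Fintype ι] {K : ι → Type*}
  [∀ i, NormedField (K i)] [∀ i, NormedAlgebra ℚ_[p] (K i)] [∀ i, FiniteDimensional ℚ_[p] (K i)]
  {d : ℝ} {x y : ∀ i, K i} {n : ℕ}

theorem exists_left_eigenvector {L : Type*} [Field L] [Algebra ℚ_[p] L]
    {A : Matrix (Fin n) (Fin n) ℚ_[p]} {z : L} (hz : z ^ n = theta p n z (charCoeff A)) :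
    ∃ w : Fin n → L, w ≠ 0 ∧ Matrix.vecMul w (A.map (algebraMap ℚ_[p] L)) = z • w := by
  have hdet : ((Matrix.scalar (Fin n)) z - A.map (algebraMap ℚ_[p] L)).det = 0 := by
    rw [← Matrix.eval_charpoly, Matrix.charpoly_map, eval_map_algebraMap, charpoly_eq, map_sub,
      map_pow, aeval_X, aeval_polyOf, hz, sub_self]
  obtain ⟨w, hw0, hw⟩ := Matrix.exists_vecMul_eq_zero_iff.2 hdet
  refine ⟨w, hw0, ?_⟩
  rw [Matrix.vecMul_sub, sub_eq_zero] at hw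
  rw [← hw]
  ext j
  simp [Matrix.scalar_apply, Matrix.vecMul_diagonal, mul_comm]

/-- A matrix whose characteristic polynomial vanishes at the conjugates of `y` is the matrix of
the multiplication by `y`. -/
theorem Sep.exists_mul_equiv (hs : Sep (p := p) d y) (hy : ‖y‖ ≤ 1)
    (hn : Fintype.card (Node p K) = n) {A : Matrix (Fin n) (Fin n) ℚ_[p]}
    (hA : y ^ n = theta p n y (charCoeff A)) :
    ∃ φ : (∀ i, K i) ≃ₗ[ℚ_[p]] (Fin n → ℚ_[p]), ∀ e, φ (y * e) = Matrix.vecMul (φ e) A := by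
  classical
  have hA' : ∀ i, y i ^ n = theta p n (y i) (charCoeff A) := fun i => by
    rw [← theta_apply_pi, ← hA, Pi.pow_apply]
  choose w hw0 hw using fun i => exists_left_eigenvector (hA' i)
  -- `w i` is a left eigenvector of `A` over `K i` with eigenvalue `y i`. Pairing with it through
  -- the trace intertwines multiplication by `y` with `A`, because the entries of `A` lie in `ℚ_p`.
  let φ0 : (∀ i, K i) →ₗ[ℚ_[p]] (Fin n → ℚ_[p]) := LinearMap.pi fun k => ∑ i,
    (Algebra.trace ℚ_[p] (K i)) ∘ₗ (LinearMap.mulRight ℚ_[p] (w i k)) ∘ₗ LinearMap.proj i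
  have hφ0 : ∀ e k, φ0 e k = ∑ i, Algebra.trace ℚ_[p] (K i) (e i * w i k) := by
    intro e k
    simp [φ0]
  have hmul : ∀ e, φ0 (y * e) = Matrix.vecMul (φ0 e) A := by
    intro e
    ext k
    have h1 : Matrix.vecMul (φ0 e) A k = ∑ j, φ0 e j * A j k := rfl
    rw [h1, hφ0]
    simp_rw [hφ0, Finset.sum_mul]
    rw [Finset.sum_comm]
    refine Finset.sum_congr rfl fun i _ => ?_
    have h2 : y i * w i k = ∑ j, w i j * algebraMap ℚ_[p] (K i) (A j k) :=
      (congrFun (hw i) k).symm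
    have h3 : (y * e) i * w i k = ∑ j, A j k • (e i * w i j) := by
      rw [Pi.mul_apply, mul_comm (y i), mul_assoc, h2, Finset.mul_sum]
      refine Finset.sum_congr rfl fun j _ => ?_
      rw [Algebra.smul_def]; ring
    rw [h3, map_sum]
    refine Finset.sum_congr rfl fun j _ => ?_
    rw [map_smul, smul_eq_mul, mul_comm]
  -- The kernel is an ideal, since `y` generates `E`. A nonzero ideal contains a whole factor `K i`,
  -- and nondegeneracy of the trace form would then force `w i = 0`.
  have hpow : ∀ e, φ0 e = 0 → ∀ f, φ0 (f * e) = 0 := by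
    intro e he f
    obtain ⟨u, rfl⟩ := hs.exists_theta hy hn f
    rw [theta_apply, Finset.sum_mul, map_sum]
    refine Finset.sum_eq_zero fun k _ => ?_
    rw [smul_mul_assoc, map_smul]
    have : φ0 (y ^ (k : ℕ) * e) = 0 := by
      induction (k : ℕ) with
      | zero => simpa using he
      | succ k ih => rw [pow_succ', mul_assoc, hmul, ih, Matrix.zero_vecMul]
    rw [this, smul_zero]
  have hinj : Function.Injective φ0 := by
    rw [injective_iff_map_eq_zero]
    intro e he
    by_contra hne
    obtain ⟨i, hi⟩ := Function.ne_iff.1 hne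
    refine hw0 i (funext fun k => ?_)
    refine (traceForm_nondegenerate ℚ_[p] (K i)).2 (w i k) fun t => ?_
    have h1 := congrFun (hpow e he (Pi.single i (t / e i))) k
    rw [hφ0, Finset.sum_eq_single i] at h1
    · rw [Pi.mul_apply, Pi.single_eq_same, div_mul_cancel₀ _ hi] at h1
      rw [Algebra.traceForm_apply]
      exact h1
    · intro j _ hj
      rw [Pi.mul_apply, Pi.single_eq_of_ne hj, zero_mul, zero_mul, map_zero]
    · simp
  exact ⟨LinearEquiv.ofInjectiveOfFinrankEq φ0 hinj
    (by rw [← card_node (p := p) (K := K), hn, Module.finrank_fin_fun]), hmul⟩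

end Operator

/-! ### Haar measure on étale algebras -/

section Mul

variable {p : ℕ} [Fact p.Prime] {ι : Type*} {K : ι → Type*}
  [∀ i, NormedField (K i)] [∀ i, NormedAlgebra ℚ_[p] (K i)]

/-- Multiplication by a unit of an étale algebra. -/
def unitMul (p : ℕ) [Fact p.Prime] {K : ι → Type*} [∀ i, NormedField (K i)]
    [∀ i, NormedAlgebra ℚ_[p] (K i)] (c : ∀ i, K i) (hc : ∀ i, c i ≠ 0) :
    (∀ i, K i) ≃ₗ[ℚ_[p]] ∀ i, K i where
  toFun e := c * e
  map_add' _ _ := mul_add _ _ _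
  map_smul' _ _ := mul_smul_comm _ _ _
  invFun e := c⁻¹ * e
  left_inv e := by ext i; simp [hc i]
  right_inv e := by ext i; simp [hc i]

theorem unitMul_apply (c : ∀ i, K i) (hc : ∀ i, c i ≠ 0) (e : ∀ i, K i) :
    unitMul p c hc e = c * e := rfl

variable [Fintype ι] [∀ i, FiniteDimensional ℚ_[p] (K i)]
  [∀ i, MeasurableSpace (K i)] [∀ i, BorelSpace (K i)] [∀ i, SecondCountableTopology (K i)]
  (ν : Measure (∀ i, K i)) [ν.IsAddHaarMeasure]

/-- Elements with the same absolute value in every factor map the unit ball onto the same set, hence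
have the same scale. -/
theorem exists_unitMul_scale (c : ∀ i, K i) (hc : ∀ i, c i ≠ 0) :
    ∃ k : ℝ≥0∞, k ≠ 0 ∧ k ≠ ∞ ∧ ∀ (b : ∀ i, K i) (hb : ∀ i, b i ≠ 0), (∀ i, ‖b i‖ = ‖c i‖) →
      ∀ S, ν (unitMul p b hb '' S) = k * ν S := by
  have hprop : ProperSpace (∀ i, K i) := FiniteDimensional.proper ℚ_[p] _
  have hscale : ∀ (b : ∀ i, K i) (hb : ∀ i, b i ≠ 0), ∃ k : ℝ≥0∞, k ≠ 0 ∧ k ≠ ∞ ∧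
      ∀ S, ν (unitMul p b hb '' S) = k * ν S := fun b hb =>
    exists_scale (contEquiv (unitMul p b hb)) ν ν
  obtain ⟨k, hk0, hk, h⟩ := hscale c hc
  refine ⟨k, hk0, hk, fun b hb hbc S => ?_⟩
  obtain ⟨k', -, -, h'⟩ := hscale b hb
  have hball : unitMul p b hb '' closedBall 0 1 = unitMul p c hc '' closedBall 0 1 := by
    have key : ∀ (b c : ∀ i, K i) (hb : ∀ i, b i ≠ 0) (hc : ∀ i, c i ≠ 0),
        (∀ i, ‖b i‖ = ‖c i‖) →
        unitMul p b hb '' closedBall 0 1 ⊆ unitMul p c hc '' closedBall 0 1 := by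
      rintro b c hb hc hbc _ ⟨e, he, rfl⟩
      refine ⟨fun i => (c i)⁻¹ * (b i * e i), ?_, ?_⟩
      · rw [mem_closedBall_zero_iff, pi_norm_le_iff_of_nonneg zero_le_one] at he ⊢
        intro i
        have : ‖c i‖ ≠ 0 := norm_ne_zero_iff.2 (hc i)
        rw [norm_mul, norm_mul, norm_inv, hbc, inv_mul_cancel_left₀ this]
        exact he i
      · ext i
        simp [unitMul_apply, hc i]
    exact (key b c hb hc hbc).antisymm (key c b hc hb fun i => (hbc i).symm)
  have hpos : ν (closedBall (0 : ∀ i, K i) 1) ≠ 0 :=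
    (measure_closedBall_pos ν _ one_pos).ne'
  have hfin : ν (closedBall (0 : ∀ i, K i) 1) ≠ ∞ := (isCompact_closedBall _ _).measure_ne_top
  have : k' = k := by
    have h1 := h' (closedBall 0 1)
    rw [hball, h] at h1
    exact (ENNReal.mul_left_inj hpos hfin).1 h1.symm
  rw [h', this]

end Mul

end

section

open Metric Polynomial
open scoped ENNReal

/-! ### The main volume identity -/

section Core

variable {p : ℕ} [Fact p.Prime] {ι : Type*} [Fintype ι] {K : ι → Type*}
  [∀ i, NormedField (K i)] [∀ i, NormedAlgebra ℚ_[p] (K i)] [∀ i, FiniteDimensional ℚ_[p] (K i)]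
  [∀ i, IsUltrametricDist (K i)] [∀ i, Algebra ℤ_[p] (K i)]
  [∀ i, IsScalarTower ℤ_[p] ℚ_[p] (K i)]
  [∀ i, MeasurableSpace (K i)] [∀ i, BorelSpace (K i)] [∀ i, SecondCountableTopology (K i)]
  {d : ℝ} {x y : ∀ i, K i} {n : ℕ}

/-- This identifies the Krylov matrix of `φ e` with multiplication by `e`, read through `theta p n
y` on the source and `φ` on the target; conditions on the matrix become conditions on the lattice
`e⁻¹ φ⁻¹(ℤ_p^n)`. -/
theorem vecMul_krylov {φ : (∀ i, K i) ≃ₗ[ℚ_[p]] (Fin n → ℚ_[p])}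
    {A : Matrix (Fin n) (Fin n) ℚ_[p]} (hφ : ∀ e, φ (y * e) = Matrix.vecMul (φ e) A)
    (e : ∀ i, K i) (w : Fin n → ℚ_[p]) :
    Matrix.vecMul w (krylov A (φ e)) = φ (theta p n y w * e) := by
  have hpow : ∀ k : ℕ, φ (y ^ k * e) = Matrix.vecMul (φ e) (A ^ k) := by
    intro k
    induction k with
    | zero => simp
    | succ k ih => rw [pow_succ', mul_assoc, hφ, ih, Matrix.vecMul_vecMul, ← pow_succ]
  rw [theta_apply, Finset.sum_mul, map_sum]
  simp_rw [smul_mul_assoc, map_smul, hpow]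
  ext j
  simp only [Finset.sum_apply, Pi.smul_apply, smul_eq_mul]
  rfl

/-- The vectors `v` for which the Krylov matrix of `v` carries a lattice onto `ℤ_p^n`. -/
theorem krylov_mem_iff (hs : Sep (p := p) d y) (hy : ‖y‖ ≤ 1)
    (hn : Fintype.card (Node p K) = n) {φ : (∀ i, K i) ≃ₗ[ℚ_[p]] (Fin n → ℚ_[p])}
    {A : Matrix (Fin n) (Fin n) ℚ_[p]} (hφ : ∀ e, φ (y * e) = Matrix.vecMul (φ e) A)
    {M : Submodule ℤ_[p] (∀ i, K i)} {H : GL (Fin n) ℚ_[p]}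
    (hH : ∀ w, theta p n y w ∈ M ↔ Matrix.vecMul w H.1 ∈ L0 p n) (e : ∀ i, K i) :
    krylov A (φ e) ∈ mulLeftEquiv H '' IntGL p n ↔
      (∀ i, e i ≠ 0) ∧ ∀ f, f ∈ M ↔ φ (f * e) ∈ L0 p n := by
  classical
  have hlat : ∀ B : GL (Fin n) ℚ_[p], B.1 = krylov A (φ e) →
      (krylov A (φ e) ∈ mulLeftEquiv H '' IntGL p n ↔ ∀ f, f ∈ M ↔ φ (f * e) ∈ L0 p n) := by
    intro B hB
    rw [← hB, mem_mulLeft_IntGL_iff]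
    constructor
    · intro h f
      obtain ⟨w, rfl⟩ := hs.exists_theta hy hn f
      rw [hH, h, hB, vecMul_krylov hφ]
    · intro h w
      rw [← hH, h, hB, vecMul_krylov hφ]
  constructor
  · intro h
    obtain ⟨B, hB⟩ : ∃ B : GL (Fin n) ℚ_[p], B.1 = krylov A (φ e) := by
      obtain ⟨_, ⟨g, rfl, -⟩, h⟩ := h
      exact ⟨H * g, h⟩
    -- If `e i = 0`, the idempotent of the factor `i` annihilates `e`, which produces a nonzero row
    -- vector killed by the invertible matrix `B`.
    refine ⟨fun i hi => ?_, (hlat B hB).1 h⟩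
    obtain ⟨w, hw⟩ := hs.exists_theta hy hn (Pi.single i 1)
    have h1 : Matrix.vecMul w B.1 = 0 := by
      rw [hB, vecMul_krylov hφ, hw]
      convert map_zero φ
      ext j
      rcases eq_or_ne j i with rfl | hj
      · simp [hi]
      · simp [hj]
    have h2 : w = 0 := (rowMul B).injective (h1.trans (map_zero (rowMul B)).symm)
    rw [h2, map_zero] at hw
    have := congrFun hw i
    simp at this
  · rintro ⟨he, h⟩
    obtain ⟨B, hB⟩ := exists_GL_vecMul (((hs.thetaEquiv hy hn).trans (unitMul p e he)).trans φ)
    have hB' : B.1 = krylov A (φ e) := by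
      ext k j
      have h1 := congrFun (hB (Pi.single k 1)) j
      have h2 := congrFun (vecMul_krylov hφ e (Pi.single k 1)) j
      rw [Matrix.single_one_vecMul] at h1 h2
      refine h1.symm.trans (Eq.trans ?_ h2.symm)
      rw [mul_comm]
      rfl
    exact (hlat B hB').2 h

variable (ν : Measure (∀ i, K i)) [ν.IsAddHaarMeasure]

/-- Put `Λ = φ⁻¹(ℤ_p^n)`. The vector `φ e` is counted for `M` when `e` is invertible and `M = e⁻¹
Λ`; stability of `M` under `y` then means that `A` preserves `ℤ_p^n`, so only integral `A`
contribute. For those, `e⁻¹ Λ` is normalized exactly when each `‖e i‖` is the maximum `‖c i‖` of the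
`i`-th coordinate on `Λ`. As `ν (e⁻¹ Λ)` is `ν Λ` divided by the scale `k` of `c`, and `φ`
multiplies `ν` by `1 / ν Λ`, the dependence on `Λ` cancels and `ν {‖e i‖ = ‖c i‖} / k = ν {‖e i‖ =
1}` is left. -/
theorem sum_measure_krylov (hs : Sep (p := p) d y) (hy : ‖y‖ ≤ 1)
    (hn : Fintype.card (Node p K) = n) {A : Matrix (Fin n) (Fin n) ℚ_[p]}
    (hA : y ^ n = theta p n y (charCoeff A)) (T : Finset (Submodule ℤ_[p] (∀ i, K i)))
    (hT : ∀ M, M ∈ T ↔ M ∈ NormLat p y) (H : Submodule ℤ_[p] (∀ i, K i) → GL (Fin n) ℚ_[p])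
    (hH : ∀ M ∈ T, ∀ w, theta p n y w ∈ M ↔ Matrix.vecMul w (H M).1 ∈ L0 p n) :
    ∑ M ∈ T, ν M * volume {v | krylov A v ∈ mulLeftEquiv (H M) '' IntGL p n} =
      (Mat0 p n).indicator (fun _ => ν {e | ∀ i, ‖e i‖ = 1}) A := by
  classical
  obtain ⟨φ, hφ⟩ := hs.exists_mul_equiv hy hn hA
  have hprop : ProperSpace (∀ i, K i) := FiniteDimensional.proper ℚ_[p] _
  have hVS : ∀ M ∈ T, {v | krylov A v ∈ mulLeftEquiv (H M) '' IntGL p n} =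
      φ '' {e | (∀ i, e i ≠ 0) ∧ ∀ f, f ∈ M ↔ φ (f * e) ∈ L0 p n} := by
    intro M hM
    ext v
    obtain ⟨e, rfl⟩ := φ.surjective v
    rw [Set.mem_ofPred_eq, krylov_mem_iff hs hy hn hφ (hH M hM)]
    constructor
    · exact fun h => ⟨e, h, rfl⟩
    · rintro ⟨e', h, he'⟩
      rwa [← φ.injective he']
  by_cases hA0 : A ∈ Mat0 p n
  swap
  · rw [Set.indicator_of_notMem hA0]
    refine Finset.sum_eq_zero fun M hM => ?_
    have hempty : {e : ∀ i, K i | (∀ i, e i ≠ 0) ∧ ∀ f, f ∈ M ↔ φ (f * e) ∈ L0 p n} = ∅ := by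
      refine Set.eq_empty_of_forall_notMem fun e he => hA0 ?_
      have h1 : ∀ v ∈ L0 p n, Matrix.vecMul v A ∈ L0 p n := by
        intro v hv
        obtain ⟨g, rfl⟩ := φ.surjective v
        have h2 : g = e⁻¹ * g * e := by
          ext i; simp [he.1 i, mul_comm]
        rw [h2] at hv
        have h3 := (he.2 _).1 (((hT M).1 hM).1 _ ((he.2 _).2 hv))
        rw [← hφ]
        convert h3 using 2
        conv_lhs => rw [h2]
        ring
      intro i j
      have := h1 (Pi.single i 1) (norm_single_le i) j
      rwa [Matrix.single_one_vecMul] at this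
    rw [hVS M hM, hempty, Set.image_empty, measure_empty, mul_zero]
  rw [Set.indicator_of_mem hA0]
  obtain ⟨s, hs0, hs1, hsc⟩ := exists_scale (contEquiv φ) ν volume
  have hsc' : ∀ S : Set (∀ i, K i), volume (φ '' S) = s * ν S := hsc
  let Λ : Set (∀ i, K i) := {g | φ g ∈ L0 p n}
  have hφΛ : φ '' Λ = L0 p n := by
    ext v
    constructor
    · rintro ⟨g, hg, rfl⟩; exact hg
    · intro hv; obtain ⟨g, rfl⟩ := φ.surjective v; exact ⟨g, hv, rfl⟩
  have hcont : Continuous φ.symm := (contEquiv φ).continuous_invFun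
  have hΛc : IsCompact Λ := by
    have h1 : Λ = φ.symm '' L0 p n := by
      rw [← hφΛ, ← Set.image_comp]
      simp
    rw [h1, L0_eq]
    exact (isCompact_closedBall _ _).image hcont
  have h0Λ : (0 : ∀ i, K i) ∈ Λ := by
    intro k
    simp
  choose g hgΛ hgmax using fun i => hΛc.exists_isMaxOn ⟨0, h0Λ⟩
    (f := fun e : ∀ i, K i => ‖e i‖) (by fun_prop)
  have hmax : ∀ i, ∀ e ∈ Λ, ‖e i‖ ≤ ‖g i i‖ := fun i e he => hgmax i he
  let c : ∀ i, K i := fun i => g i i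
  have hc : ∀ i, c i ≠ 0 := by
    intro i h0
    obtain ⟨t, ht0, -, ht⟩ := exists_padic_norm_mul_le p (C := ‖φ (Pi.single i 1)‖) one_pos
    have h1 : t • (Pi.single i 1 : ∀ i, K i) ∈ Λ := by
      intro k
      rw [map_smul]
      refine (norm_le_pi_norm _ k).trans ?_
      rwa [norm_smul]
    have h2 := hmax i _ h1
    change _ ≤ ‖c i‖ at h2
    rw [h0, norm_zero, Pi.smul_apply, Pi.single_eq_same, norm_smul, norm_one, mul_one] at h2
    exact ht0 (norm_le_zero_iff.1 h2)
  -- For invertible `e` this is the lattice `e⁻¹ Λ`.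
  let M' : (∀ i, K i) → Submodule ℤ_[p] (∀ i, K i) := fun e =>
    { carrier := {f | φ (f * e) ∈ L0 p n}
      add_mem' := by
        intro a b ha hb k
        rw [add_mul, map_add, Pi.add_apply]
        exact (IsUltrametricDist.norm_add_le_max _ _).trans (max_le (ha k) (hb k))
      zero_mem' := by intro k; simp
      smul_mem' := by
        intro t a ha k
        rw [padicInt_smul, smul_mul_assoc, map_smul, Pi.smul_apply, norm_smul]
        exact mul_le_one₀ t.2 (norm_nonneg _) (ha k) }
  have hM'mem : ∀ e f, f ∈ M' e ↔ f * e ∈ Λ := fun e f => Iff.rfl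
  have hne : ∀ {e : ∀ i, K i}, (∀ i, ‖e i‖ = ‖c i‖) → ∀ i, e i ≠ 0 := by
    intro e he i h0
    have := he i
    rw [h0, norm_zero] at this
    exact hc i (norm_eq_zero.1 this.symm)
  have hM'lat : ∀ e : ∀ i, K i, (∀ i, ‖e i‖ = ‖c i‖) → M' e ∈ NormLat p y := by
    intro e he
    refine ⟨fun f hf => ?_, fun f hf => ?_, fun i => ?_⟩
    · rw [hM'mem, mul_assoc]
      change φ (y * (f * e)) ∈ L0 p n
      rw [hφ]
      exact integral_vecMul hf hA0
    · rw [pi_norm_le_iff_of_nonneg zero_le_one]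
      intro i
      have h1 := hmax i _ hf
      change _ ≤ ‖c i‖ at h1
      rw [Pi.mul_apply, norm_mul, he] at h1
      exact le_of_mul_le_mul_right (by rwa [one_mul]) (norm_pos_iff.2 (hc i))
    · refine ⟨g i * e⁻¹, ?_, ?_⟩
      · rw [hM'mem]
        convert hgΛ i using 1
        ext j; simp [hne he j]
      · rw [Pi.mul_apply, norm_mul, Pi.inv_apply, norm_inv, he]
        exact mul_inv_cancel₀ (norm_ne_zero_iff.2 (hc i))
  have hiff : ∀ M ∈ T, ∀ e, ((∀ i, e i ≠ 0) ∧ ∀ f, f ∈ M ↔ φ (f * e) ∈ L0 p n) ↔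
      (∀ i, ‖e i‖ = ‖c i‖) ∧ M' e = M := by
    intro M hM e
    constructor
    · rintro ⟨he, h⟩
      have hMe : M' e = M := by ext f; exact (h f).symm
      refine ⟨fun i => le_antisymm ?_ ?_, hMe⟩
      · obtain ⟨f, hf, hf1⟩ := ((hT M).1 hM).2.2 i
        have h1 := hmax i _ ((h f).1 hf)
        rwa [Pi.mul_apply, norm_mul, hf1, one_mul] at h1
      · have h1 : g i * e⁻¹ ∈ M := by
          rw [← hMe, hM'mem]
          convert hgΛ i using 1
          ext j; simp [he j]
        have h2 := (norm_le_pi_norm _ i).trans (((hT M).1 hM).2.1 _ h1)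
        rw [Pi.mul_apply, norm_mul, Pi.inv_apply, norm_inv, ← div_eq_mul_inv,
          div_le_one (norm_pos_iff.2 (he i))] at h2
        exact h2
    · rintro ⟨he, h⟩
      exact ⟨hne he, fun f => by rw [← h]; rfl⟩
  obtain ⟨k, hk0, hk1, hk⟩ := exists_unitMul_scale (p := p) ν c hc
  have hkc : ν {e | ∀ i, ‖e i‖ = ‖c i‖} = k * ν {e | ∀ i, ‖e i‖ = 1} := by
    rw [← hk c hc (fun _ => rfl)]
    congr 1
    ext e
    constructor
    · intro he
      refine ⟨c⁻¹ * e, fun i => ?_, ?_⟩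
      · rw [Pi.mul_apply, norm_mul, Pi.inv_apply, norm_inv, he]
        exact inv_mul_cancel₀ (norm_ne_zero_iff.2 (hc i))
      · ext i; simp [unitMul_apply, hc i]
    · rintro ⟨f, hf, rfl⟩ i
      rw [unitMul_apply, Pi.mul_apply, norm_mul, hf, mul_one]
  have hsΛ : s * ν Λ = 1 := by rw [← hsc', hφΛ, volume_L0]
  have hterm : ∀ M ∈ T, k * (ν M * volume {v | krylov A v ∈ mulLeftEquiv (H M) '' IntGL p n}) =
      ν {e | (∀ i, ‖e i‖ = ‖c i‖) ∧ M' e = M} := by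
    intro M hM
    have h1 : {v | krylov A v ∈ mulLeftEquiv (H M) '' IntGL p n} =
        φ '' {e | (∀ i, ‖e i‖ = ‖c i‖) ∧ M' e = M} := by
      rw [hVS M hM]
      congr 1
      ext e
      exact hiff M hM e
    rw [h1, hsc']
    rcases Set.eq_empty_or_nonempty {e | (∀ i, ‖e i‖ = ‖c i‖) ∧ M' e = M} with h2 | ⟨e, he, heM⟩
    · rw [h2, measure_empty, mul_zero, mul_zero, mul_zero]
    · have h3 : k * ν M = ν Λ := by
        rw [← hk e (hne he) he]
        congr 1
        ext f
        constructor
        · rintro ⟨f, hf, rfl⟩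
          rw [unitMul_apply, mul_comm, ← hM'mem, heM]
          exact hf
        · intro hf
          have h4 : e * (e⁻¹ * f) = f := by ext i; simp [hne he i]
          refine ⟨e⁻¹ * f, ?_, h4⟩
          rw [SetLike.mem_coe, ← heM, hM'mem, mul_comm, h4]
          exact hf
      rw [← mul_assoc, h3, ← mul_assoc, mul_comm (ν Λ), hsΛ, one_mul]
  -- After multiplication by `k`, the terms are the measures of the disjoint pieces of `{‖e i‖ = ‖c
  -- i‖}` on which `e⁻¹ Λ` is a given lattice.
  rw [← ENNReal.mul_right_inj hk0 hk1, Finset.mul_sum, Finset.sum_congr rfl hterm, ← hkc]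
  have hmeas : ∀ M ∈ T, MeasurableSet {e | (∀ i, ‖e i‖ = ‖c i‖) ∧ M' e = M} := by
    intro M hM
    have h1 : {e | (∀ i, ‖e i‖ = ‖c i‖) ∧ M' e = M} =
        φ ⁻¹' {v | krylov A v ∈ mulLeftEquiv (H M) '' IntGL p n} := by
      ext e
      rw [Set.mem_preimage, Set.mem_ofPred_eq, Set.mem_ofPred_eq,
        krylov_mem_iff hs hy hn hφ (hH M hM), hiff M hM]
    have h2 : IsOpen (mulLeftEquiv (H M) '' IntGL p n) :=
      (contEquiv (mulLeftEquiv (H M))).toHomeomorph.isOpenMap _ isOpen_IntGL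
    have h3 : Continuous fun e : ∀ i, K i => krylov A (φ e) :=
      continuous_krylov.comp (continuous_const.prodMk (contEquiv φ).continuous_toFun)
    rw [h1]
    exact (h2.preimage h3).measurableSet
  rw [← measure_biUnion_finset _ hmeas]
  · congr 1
    ext e
    simp only [Set.mem_iUnion, Set.mem_ofPred_eq]
    constructor
    · rintro ⟨M, -, he, -⟩; exact he
    · intro he
      exact ⟨M' e, (hT _).2 (hM'lat e he), he, rfl⟩
  · intro M _ N _ hMN
    refine Set.disjoint_left.2 fun e he he' => hMN (he.2.symm.trans he'.2)

end Core

end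

section

open Metric Polynomial
open scoped ENNReal

/-! ### Double counting over matrices and lattices. -/

section Core

variable {p : ℕ} [Fact p.Prime] {ι : Type*} [Fintype ι] {K : ι → Type*}
  [∀ i, NormedField (K i)] [∀ i, NormedAlgebra ℚ_[p] (K i)] [∀ i, FiniteDimensional ℚ_[p] (K i)]
  [∀ i, IsUltrametricDist (K i)] [∀ i, Algebra ℤ_[p] (K i)]
  [∀ i, IsScalarTower ℤ_[p] ℚ_[p] (K i)]
  [∀ i, MeasurableSpace (K i)] [∀ i, BorelSpace (K i)] [∀ i, SecondCountableTopology (K i)]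
  {d : ℝ} {x : ∀ i, K i} (ν : Measure (∀ i, K i)) [ν.IsAddHaarMeasure]

theorem isOpen_coeffSet (n : ℕ) (x : ∀ i, K i) {ρ : ι → ℝ} (hρ0 : ∀ i, 0 < ρ i) :
    IsOpen {a : Fin n → ℚ_[p] | ∀ i, ‖x i ^ n - theta p n x a i‖ ≤ ρ i} := by
  have h1 : {a : Fin n → ℚ_[p] | ∀ i, ‖x i ^ n - theta p n x a i‖ ≤ ρ i} =
      ⋂ i, (fun a : Fin n → ℚ_[p] => x i ^ n - theta p n x a i) ⁻¹' closedBall 0 (ρ i) := by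
    ext a; simp
  have h2 : Continuous (theta p n x) := LinearMap.continuous_of_finiteDimensional _
  rw [h1]
  refine isOpen_iInter_of_finite fun i => ?_
  exact (IsUltrametricDist.isOpen_closedBall _ (hρ0 i).ne').preimage (by fun_prop)

/-- The volume of the matrices whose characteristic polynomial is small at `x`. -/
theorem volume_charpoly_small {m : ℕ} (hs : Sep (p := p) d x) (hx : ‖x‖ ≤ 1)
    (hn : Fintype.card (Node p K) = m + 1) {ρ : ι → ℝ} (hρ0 : ∀ i, 0 < ρ i)
    (hρ : ∀ i, ρ i < d ^ 2) (hρ3 : ∀ i, ρ i ≤ d ^ 3) :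
    volume {A ∈ Mat0 p (m + 1) |
        ∀ i, ‖x i ^ (m + 1) - theta p (m + 1) x (charCoeff A) i‖ ≤ ρ i} *
      ν {e | ∀ i, ‖e i‖ = 1} =
    (NormLat p x).ncard * volume (IntGL p (m + 1)) * ν {e | ∀ i, ‖e i‖ ≤ ρ i} := by
  classical
  have hprop : ProperSpace (∀ i, K i) := FiniteDimensional.proper ℚ_[p] _
  have hd := hs.1
  set S0 : Set (Fin (m + 1) → ℚ_[p]) :=
    {a | ∀ i, ‖x i ^ (m + 1) - theta p (m + 1) x a i‖ ≤ ρ i} with hS0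
  have hSL : S0 ⊆ L0 p (m + 1) := fun a ha => (hs.exists_root hx hn hρ ha).1
  -- As `x` is integral, a change of the coefficients by at most `p ^ (-N0)` moves the value at `x
  -- i` by at most `ρ i`, so `S0` is invariant under it.
  obtain ⟨N0, hN0⟩ : ∃ N0 : ℕ, ∀ i, (p : ℝ) ^ (-N0 : ℤ) ≤ ρ i := by
    have hp : (1 : ℝ) < p := by exact_mod_cast (Fact.out : p.Prime).one_lt
    obtain ⟨N0, hN0⟩ := pow_unbounded_of_one_lt (∑ i, (ρ i)⁻¹) hp
    refine ⟨N0, fun i => ?_⟩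
    rw [zpow_neg, zpow_natCast, inv_le_comm₀ (by positivity) (hρ0 i)]
    refine le_trans ?_ hN0.le
    exact Finset.single_le_sum (f := fun i => (ρ i)⁻¹) (fun j _ => (inv_pos.2 (hρ0 j)).le)
      (Finset.mem_univ i)
  have hSinv : ∀ a ∈ S0, ∀ b : Fin (m + 1) → ℚ_[p],
      (∀ k, ‖b k - a k‖ ≤ (p : ℝ) ^ (-N0 : ℤ)) → b ∈ S0 := by
    intro a ha b hab i
    have h1 : x i ^ (m + 1) - theta p (m + 1) x b i =
        (x i ^ (m + 1) - theta p (m + 1) x a i) + -∑ k, (b k - a k) • x i ^ (k : ℕ) := by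
      simp only [theta_apply_pi, theta_apply, sub_smul, Finset.sum_sub_distrib]
      ring
    rw [h1]
    refine (IsUltrametricDist.norm_add_le_max _ _).trans (max_le (ha i) ?_)
    rw [norm_neg]
    refine IsUltrametricDist.norm_sum_le_of_forall_le_of_nonneg (hρ0 i).le fun k _ => ?_
    rw [norm_smul, norm_pow]
    refine le_trans ?_ ((hab k).trans (hN0 i))
    exact mul_le_of_le_one_right (norm_nonneg _)
      (pow_le_one₀ (norm_nonneg _) ((norm_le_pi_norm x i).trans hx))
  have hfin : (NormLat p x).Finite := NormLat.finite hs hx hn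
  let T := hfin.toFinset
  have hT : ∀ M, M ∈ T ↔ M ∈ NormLat p x := fun M => hfin.mem_toFinset
  have hexH : ∀ M : Submodule ℤ_[p] (∀ i, K i), ∃ H : GL (Fin (m + 1)) ℚ_[p], M ∈ NormLat p x →
      ∀ w, theta p (m + 1) x w ∈ M ↔ Matrix.vecMul w H.1 ∈ L0 p (m + 1) := by
    intro M
    by_cases hM : M ∈ NormLat p x
    · have := NormLat.isLattice hs hx hn hM
      obtain ⟨H, hH⟩ := exists_GL_lattice M (hs.thetaEquiv hx hn)
      exact ⟨H, fun _ => hH⟩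
    · exact ⟨1, fun h => absurd h hM⟩
  choose H hH using hexH
  let U := fun M => mulLeftEquiv (H M) '' IntGL p (m + 1)
  have hUo : ∀ M, IsOpen (U M) := fun M =>
    (contEquiv (mulLeftEquiv (H M))).toHomeomorph.isOpenMap _ isOpen_IntGL
  obtain ⟨t, ht0, ht1, hsc⟩ := exists_scale (contEquiv (hs.thetaEquiv hx hn)) volume ν
  have htheta : ∀ S, ν (theta p (m + 1) x '' S) = t * volume S := hsc
  -- The volume of a lattice and the scale of its matrix compensate, so all lattices contribute
  -- equally.
  have hνM : ∀ M ∈ NormLat p x, ν M * rowScale (H M) = t := by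
    intro M hM
    have h1 : (M : Set (∀ i, K i)) = theta p (m + 1) x '' {w | theta p (m + 1) x w ∈ M} := by
      ext e
      constructor
      · intro he
        obtain ⟨w, rfl⟩ := hs.exists_theta hx hn e
        exact ⟨w, he, rfl⟩
      · rintro ⟨w, hw, rfl⟩; exact hw
    have h2 : rowMul (H M) '' {w | theta p (m + 1) x w ∈ M} = L0 p (m + 1) := by
      ext v
      constructor
      · rintro ⟨w, hw, rfl⟩; exact (hH M hM w).1 hw
      · intro hv
        obtain ⟨w, rfl⟩ := (rowMul (H M)).surjective v
        exact ⟨w, (hH M hM w).2 hv, rfl⟩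
    rw [h1, htheta, mul_assoc, mul_comm (volume _), ← volume_rowMul_image, h2, volume_L0, mul_one]
  -- `theta p (m + 1) x` maps `S0` onto the translate by `x ^ (m + 1)` of the polydisc with radii
  -- `ρ`.
  have hSvol : t * volume S0 = ν {e | ∀ i, ‖e i‖ ≤ ρ i} := by
    rw [← htheta]
    have h1 : theta p (m + 1) x '' S0 =
        (fun e => -x ^ (m + 1) + e) ⁻¹' {e : ∀ i, K i | ∀ i, ‖e i‖ ≤ ρ i} := by
      ext e
      obtain ⟨w, rfl⟩ := hs.exists_theta hx hn e
      refine ((hs.thetaEquiv hx hn).injective.mem_set_image (s := S0) (a := w)).trans ?_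
      refine forall_congr' fun i => ?_
      rw [← norm_neg]
      congr! 2
      simp only [Pi.add_apply, Pi.neg_apply, Pi.pow_apply]
      ring
    rw [h1, measure_preimage_add]
  have hfub : ∀ M, krylovMeasure S0 (U M) = ∫⁻ A in {A | charCoeff A ∈ S0},
      volume {v | krylov A v ∈ U M} := by
    intro M
    have hSo : IsOpen {A : Matrix (Fin (m + 1)) (Fin (m + 1)) ℚ_[p] | charCoeff A ∈ S0} :=
      (isOpen_coeffSet _ x hρ0).preimage continuous_charCoeff
    have hmeas : MeasurableSet {z : Matrix (Fin (m + 1)) (Fin (m + 1)) ℚ_[p] ×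
        (Fin (m + 1) → ℚ_[p]) | krylov z.1 z.2 ∈ U M ∧ charCoeff z.1 ∈ S0} :=
      (((hUo M).preimage continuous_krylov).inter (hSo.preimage continuous_fst)).measurableSet
    rw [krylovMeasure_apply (hUo M).measurableSet, Measure.volume_eq_prod,
      Measure.prod_apply hmeas, ← lintegral_indicator hSo.measurableSet]
    refine lintegral_congr fun A => ?_
    by_cases hA : charCoeff A ∈ S0
    · rw [Set.indicator_of_mem (by exact hA)]
      congr 1
      ext v
      simp [hA]
    · rw [Set.indicator_of_notMem (by exact hA)]
      convert measure_empty (μ := (volume : Measure (Fin (m + 1) → ℚ_[p])))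
      ext v
      simp [hA]
  have hmeasA : ∀ M, Measurable fun A : Matrix (Fin (m + 1)) (Fin (m + 1)) ℚ_[p] =>
      volume {v | krylov A v ∈ U M} := fun M =>
    measurable_measure_prodMk_left ((hUo M).preimage continuous_krylov).measurableSet
  -- `sum_measure_krylov` is applied to a root `y` near `x`. The matrices `H M`, chosen for `x`,
  -- serve for `y` too, since by `theta_mem_of_close` in both directions the same coordinate vectors
  -- represent elements of `M`.
  have hper : ∀ A, charCoeff A ∈ S0 → ∑ M ∈ T, ν M * volume {v | krylov A v ∈ U M} =
      (Mat0 p (m + 1)).indicator (fun _ => ν {e | ∀ i, ‖e i‖ = 1}) A := by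
    intro A hA
    obtain ⟨-, y, hy, hyx⟩ := hs.exists_root hx hn hρ hA
    have hyx2 : ‖y - x‖ ≤ d ^ 2 := by
      rw [pi_norm_le_iff_of_nonneg (by positivity)]
      intro i
      refine (hyx i).trans ((div_le_iff₀ hd).2 ((hρ3 i).trans_eq (by ring)))
    have hcl : ∀ i, ‖y i - x i‖ < d := fun i =>
      (hyx i).trans_lt ((div_lt_iff₀ hd).2 ((hρ i).trans_eq (sq d)))
    have hyx1 : ‖y - x‖ ≤ d := (pi_norm_le_iff_of_nonneg hd.le).2 fun i => (hcl i).le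
    have hy1 : ‖y‖ ≤ 1 := by
      rw [pi_norm_le_iff_of_nonneg zero_le_one]
      intro i
      have : y i = x i + (y i - x i) := by ring
      rw [this]
      exact (IsUltrametricDist.norm_add_le_max _ _).trans (max_le ((norm_le_pi_norm x i).trans hx)
        ((hcl i).le.trans (hs.le_one hx i)))
    have hsy := hs.of_close hx hcl
    have hNL := normLat_eq_of_close hs hsy hx hy1 hn hyx1
    refine sum_measure_krylov ν hsy hy1 hn hy T (fun M => by rw [hT, hNL]) H fun M hM w => ?_
    have hMx := (hT M).1 hM
    rw [← hH M hMx]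
    have hMy := hNL ▸ hMx
    exact ⟨theta_mem_of_close hsy hy1 hx hn (by rwa [norm_sub_rev])
        (fun e he => hs.mem_of_norm_le hx hn hMx.1 hMx.2.2 he) hMx.2.1,
      theta_mem_of_close hs hx hy1 hn hyx2
        (fun e he => hs.mem_of_norm_le hx hn hMx.1 hMx.2.2 he) hMx.2.1⟩
  have hSo : MeasurableSet {A : Matrix (Fin (m + 1)) (Fin (m + 1)) ℚ_[p] | charCoeff A ∈ S0} :=
    ((isOpen_coeffSet _ x hρ0).preimage continuous_charCoeff).measurableSet
  -- The same sum is evaluated twice: here by summing over lattices for fixed `A` and then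
  -- integrating, in `hsum2` lattice by lattice from the mass of `H M GL(ℤ_p)`.
  have hsum1 : ∑ M ∈ T, ν M * krylovMeasure S0 (U M) =
      volume {A ∈ Mat0 p (m + 1) | charCoeff A ∈ S0} * ν {e | ∀ i, ‖e i‖ = 1} := by
    have h1 : ∀ M ∈ T, ν M * krylovMeasure S0 (U M) = ∫⁻ A in {A | charCoeff A ∈ S0},
        ν M * volume {v | krylov A v ∈ U M} := fun M _ => by
      rw [hfub, lintegral_const_mul _ (hmeasA M)]
    rw [Finset.sum_congr rfl h1,
      ← lintegral_finsetSum _ fun M _ => (hmeasA M).const_mul _, setLIntegral_congr_fun hSo hper,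
      lintegral_indicator_const isOpen_Mat0.measurableSet,
      Measure.restrict_apply isOpen_Mat0.measurableSet, mul_comm]
    rfl
  have hsum2 : ∑ M ∈ T, ν M * krylovMeasure S0 (U M) =
      (NormLat p x).ncard * volume (IntGL p (m + 1)) * ν {e | ∀ i, ‖e i‖ ≤ ρ i} := by
    rw [Finset.sum_congr rfl (g := fun _ => ν {e | ∀ i, ‖e i‖ ≤ ρ i} *
      volume (IntGL p (m + 1)))]
    · rw [Finset.sum_const, nsmul_eq_mul, Set.ncard_eq_toFinset_card _ hfin]
      ring
    · intro M hM
      rw [krylovMeasure_mul_IntGL hSL hSinv, ← hSvol, ← hνM M ((hT M).1 hM)]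
      ring
  rw [← hsum2, hsum1]
  rfl

end Core

end

section

open Metric Polynomial
open scoped ENNReal

/-! ### Haar measure and determinants -/

section Det

variable {p : ℕ} [Fact p.Prime]

theorem volume_closedBall_inv_p : volume (closedBall (0 : ℚ_[p]) (p : ℝ)⁻¹) = (p : ℝ≥0∞)⁻¹ := by
  have hp := (Fact.out : p.Prime)
  have hlt : ∀ x : ℚ_[p], ‖x‖ ≤ (p : ℝ)⁻¹ ↔ ‖x‖ < 1 := by
    intro x
    have := Padic.norm_le_pow_iff_norm_lt_pow_add_one x (-1)
    simpa using this
  have hun : closedBall (0 : ℚ_[p]) 1 = ⋃ j ∈ Finset.range p, closedBall (j : ℚ_[p]) (p : ℝ)⁻¹ := by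
    ext x
    rw [mem_closedBall_zero_iff]
    simp only [Set.mem_iUnion, mem_closedBall, dist_eq_norm, hlt]
    constructor
    · intro hx
      obtain ⟨j, hj, hjx⟩ := PadicInt.exists_mem_range (⟨x, hx⟩ : ℤ_[p])
      refine ⟨j, Finset.mem_range.2 hj, ?_⟩
      rw [PadicInt.maximalIdeal_eq_span_p, Ideal.mem_span_singleton,
        ← PadicInt.norm_lt_one_iff_dvd] at hjx
      exact hjx
    · rintro ⟨j, -, hj⟩
      have : x = (x - j) + j := by ring
      rw [this]
      exact (IsUltrametricDist.norm_add_le_max _ _).trans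
        (max_le hj.le (IsUltrametricDist.norm_natCast_le_one ℚ_[p] j))
  have hdisj : (↑(Finset.range p) : Set ℕ).PairwiseDisjoint
      fun j : ℕ => closedBall (j : ℚ_[p]) (p : ℝ)⁻¹ := by
    intro i hi j hj hij
    refine Set.disjoint_left.2 fun x hxi hxj => hij ?_
    rw [mem_closedBall, dist_eq_norm, hlt] at hxi hxj
    have h2 : ‖(((i : ℤ) - j : ℤ) : ℚ_[p])‖ < 1 := by
      have : (((i : ℤ) - j : ℤ) : ℚ_[p]) = (x - j) + -(x - i) := by push_cast; ring
      rw [this]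
      refine (IsUltrametricDist.norm_add_le_max _ _).trans_lt (max_lt hxj ?_)
      rwa [norm_neg]
    rw [Padic.norm_intCast_lt_one_iff] at h2
    have hi' := Finset.mem_range.1 hi
    have hj' := Finset.mem_range.1 hj
    have h3 := Int.eq_zero_of_abs_lt_dvd h2 (by rw [abs_lt]; constructor <;> omega)
    omega
  have hsum := measure_biUnion_finset (μ := volume) hdisj fun j _ => measurableSet_closedBall
  rw [← hun, volume_unitBall] at hsum
  have htr : ∀ j ∈ Finset.range p, volume (closedBall (j : ℚ_[p]) (p : ℝ)⁻¹) =
      volume (closedBall (0 : ℚ_[p]) (p : ℝ)⁻¹) := by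
    intro j _
    rw [← measure_preimage_add volume (j : ℚ_[p]) (closedBall _ _)]
    congr 1
    ext x
    simp [dist_eq_norm]
  rw [Finset.sum_congr rfl htr, Finset.sum_const, Finset.card_range, nsmul_eq_mul] at hsum
  exact ENNReal.eq_inv_of_mul_eq_one_left (by rw [mul_comm]; exact hsum.symm)

/-- Multiplication by `p` maps balls onto balls and scales volume by `1 / p`; starting from the unit
ball, induction in both directions reaches every radius `p ^ k`. -/
theorem volume_closedBall_norm (c : ℚ_[p]) (hc : c ≠ 0) :
    volume (closedBall (0 : ℚ_[p]) ‖c‖) = ENNReal.ofReal ‖c‖ := by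
  have hp0 : (p : ℝ) ≠ 0 := by exact_mod_cast (Fact.out : p.Prime).ne_zero
  have hpos : (0 : ℝ) < p := by exact_mod_cast (Fact.out : p.Prime).pos
  have hpQ : (p : ℚ_[p]) ≠ 0 := by exact_mod_cast (Fact.out : p.Prime).ne_zero
  obtain ⟨s, hs0, hs1, hs⟩ := exists_scale
    (contEquiv (LinearEquiv.smulOfNeZero ℚ_[p] ℚ_[p] (p : ℚ_[p]) hpQ)) volume volume
  have himg : ∀ r : ℝ, (contEquiv (LinearEquiv.smulOfNeZero ℚ_[p] ℚ_[p] (p : ℚ_[p]) hpQ)) ''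
      closedBall 0 r = closedBall (0 : ℚ_[p]) ((p : ℝ)⁻¹ * r) := by
    intro r
    ext x
    constructor
    · rintro ⟨y, hy, rfl⟩
      change (p : ℚ_[p]) • y ∈ _
      rw [mem_closedBall_zero_iff] at hy ⊢
      rw [norm_smul, Padic.norm_p]
      exact mul_le_mul_of_nonneg_left hy (by positivity)
    · intro hx
      refine ⟨(p : ℚ_[p])⁻¹ * x, ?_, ?_⟩
      · rw [mem_closedBall_zero_iff] at hx ⊢
        rw [norm_mul, norm_inv, Padic.norm_p, inv_inv]
        calc (p : ℝ) * ‖x‖ ≤ p * ((p : ℝ)⁻¹ * r) := by gcongr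
          _ = r := by field_simp
      · change (p : ℚ_[p]) • ((p : ℚ_[p])⁻¹ * x) = x
        rw [smul_eq_mul, mul_inv_cancel_left₀ hpQ]
  have hs' : s = (p : ℝ≥0∞)⁻¹ := by
    have := hs (closedBall 0 1)
    rw [himg, mul_one, volume_closedBall_inv_p, volume_unitBall, mul_one] at this
    exact this.symm
  have hstep : ∀ r : ℝ, volume (closedBall (0 : ℚ_[p]) ((p : ℝ)⁻¹ * r)) =
      (p : ℝ≥0∞)⁻¹ * volume (closedBall (0 : ℚ_[p]) r) := fun r => by rw [← himg, hs, hs']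
  have hpe : (p : ℝ≥0∞)⁻¹ = ENNReal.ofReal (p : ℝ)⁻¹ := by
    rw [ENNReal.ofReal_inv_of_pos hpos, ENNReal.ofReal_natCast]
  have hall : ∀ k : ℤ, volume (closedBall (0 : ℚ_[p]) ((p : ℝ) ^ (-k))) =
      ENNReal.ofReal ((p : ℝ) ^ (-k)) := by
    have hst : ∀ k : ℤ, (p : ℝ) ^ (-(k + 1)) = (p : ℝ)⁻¹ * (p : ℝ) ^ (-k) := by
      intro k
      rw [neg_add, zpow_add₀ hp0, zpow_neg_one, mul_comm]
    have hcancel : ∀ a b : ℝ≥0∞, (p : ℝ≥0∞)⁻¹ * a = (p : ℝ≥0∞)⁻¹ * b → a = b := fun a b h =>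
      (ENNReal.mul_right_inj (ENNReal.inv_ne_zero.2 (ENNReal.natCast_ne_top p))
        (ENNReal.inv_ne_top.2 (by exact_mod_cast (Fact.out : p.Prime).ne_zero))).1 h
    have hiff : ∀ k : ℤ, volume (closedBall (0 : ℚ_[p]) ((p : ℝ) ^ (-(k + 1)))) =
        ENNReal.ofReal ((p : ℝ) ^ (-(k + 1))) ↔ volume (closedBall (0 : ℚ_[p]) ((p : ℝ) ^ (-k))) =
        ENNReal.ofReal ((p : ℝ) ^ (-k)) := by
      intro k
      rw [hst, hstep, ENNReal.ofReal_mul (by positivity), ← hpe]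
      exact ⟨hcancel _ _, fun h => by rw [h]⟩
    intro k
    induction k using Int.induction_on with
    | zero => simp [volume_unitBall]
    | succ k ih => exact (hiff _).2 ih
    | pred k ih =>
      refine (hiff _).1 ?_
      rw [sub_add_cancel]
      exact ih
  rw [Padic.norm_eq_zpow_neg_valuation hc]
  exact hall _

/-- Both sides are multiplicative. A diagonal matrix maps `ℤ_p^n` onto a product of balls, and for
transvections both sides are `1`. -/
theorem rowScale_eq {n : ℕ} (g : GL (Fin n) ℚ_[p]) :
    rowScale g = ENNReal.ofReal ‖g.1.det‖ := by
  suffices H : ∀ M : Matrix (Fin n) (Fin n) ℚ_[p], M.det ≠ 0 →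
      ∀ g : GL (Fin n) ℚ_[p], g.1 = M → rowScale g = ENNReal.ofReal ‖M.det‖ by
    refine H g.1 ?_ g rfl
    exact ((Matrix.isUnit_iff_isUnit_det _).1 g.isUnit).ne_zero
  intro M hM
  refine Matrix.diagonal_transvection_induction_of_det_ne_zero
    (fun M => ∀ g : GL (Fin n) ℚ_[p], g.1 = M → rowScale g = ENNReal.ofReal ‖M.det‖) M hM ?_ ?_ ?_
  · intro D hD g hg
    rw [Matrix.det_diagonal] at hD ⊢
    have hD' : ∀ i, D i ≠ 0 := fun i => Finset.prod_ne_zero_iff.1 hD i (Finset.mem_univ i)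
    have h1 : rowMul g '' L0 p n = Set.univ.pi fun i => closedBall (0 : ℚ_[p]) ‖D i‖ := by
      have hmul : ∀ v i, rowMul g v i = v i * D i := by
        intro v i
        change Matrix.vecMul v g.1 i = _
        rw [hg, Matrix.vecMul_diagonal]
      ext w
      constructor
      · rintro ⟨v, hv, rfl⟩ i -
        rw [mem_closedBall_zero_iff, hmul, norm_mul]
        exact mul_le_of_le_one_left (norm_nonneg _) (hv i)
      · intro hw
        refine ⟨fun i => w i / D i, fun i => ?_, ?_⟩
        · have := mem_closedBall_zero_iff.1 (hw i trivial)
          rw [norm_div]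
          exact (div_le_one (norm_pos_iff.2 (hD' i))).2 this
        · ext i
          rw [hmul, div_mul_cancel₀ _ (hD' i)]
    rw [rowScale, h1, volume_pi_pi, norm_prod,
      ENNReal.ofReal_prod_of_nonneg fun _ _ => norm_nonneg _]
    exact Finset.prod_congr rfl fun i _ => volume_closedBall_norm _ (hD' i)
  · intro t g hg
    rw [rowScale_transvection t.hij t.c g hg]
    simp
  · intro A B hA hB hPA hPB g hg
    let gA : GL (Fin n) ℚ_[p] := Matrix.GeneralLinearGroup.mkOfDetNeZero A hA
    let gB : GL (Fin n) ℚ_[p] := Matrix.GeneralLinearGroup.mkOfDetNeZero B hB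
    have h1 : g = gA * gB := Units.ext hg
    rw [h1, rowScale_mul, hPA gA rfl, hPB gB rfl, Matrix.det_mul, norm_mul,
      ENNReal.ofReal_mul (norm_nonneg _)]

theorem measure_image_linearEquiv {X : Type*} [AddCommGroup X] [TopologicalSpace X]
    [IsTopologicalAddGroup X] [Module ℚ_[p] X] [ContinuousSMul ℚ_[p] X] [FiniteDimensional ℚ_[p] X]
    [T2Space X] [MeasurableSpace X] [BorelSpace X] (ν : Measure X) [ν.IsAddHaarMeasure]
    (f : X ≃ₗ[ℚ_[p]] X) (S : Set X) :
    ν (f '' S) = ENNReal.ofReal ‖LinearMap.det (f : X →ₗ[ℚ_[p]] X)‖ * ν S := by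
  let θ := (Module.finBasis ℚ_[p] X).equivFun
  obtain ⟨s, hs0, hs1, hs⟩ := exists_scale (contEquiv θ) ν volume
  have hs' : ∀ S : Set X, volume (θ '' S) = s * ν S := hs
  obtain ⟨H, hH⟩ := exists_GL_vecMul ((θ.symm.trans f).trans θ)
  have hdet : LinearMap.det (f : X →ₗ[ℚ_[p]] X) = H.1.det := by
    rw [← LinearMap.det_conj (f : X →ₗ[ℚ_[p]] X) θ, ← Matrix.det_transpose,
      ← LinearMap.det_toLin' H.1.transpose]
    congr 1
    refine LinearMap.ext fun v => ?_
    rw [Matrix.toLin'_apply, Matrix.mulVec_transpose]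
    exact hH v
  have himg : θ '' (f '' S) = rowMul H '' (θ '' S) := by
    rw [← Set.image_comp, ← Set.image_comp]
    congr 1
    ext1 e
    have := hH (θ e)
    simp only [LinearEquiv.trans_apply, LinearEquiv.symm_apply_apply] at this
    exact this
  have h1 := hs' (f '' S)
  rw [himg, volume_rowMul_image, hs', rowScale_eq, ← hdet] at h1
  refine (ENNReal.mul_right_inj hs0 hs1).1 ?_
  rw [← h1]
  ring

end Det

/-! ### Absolute values of algebra norms, obtained from Haar measure. -/

section Norm

variable {p : ℕ} [Fact p.Prime]

theorem norm_algebraNorm {L : Type*} [NormedField L] [NormedAlgebra ℚ_[p] L]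
    [FiniteDimensional ℚ_[p] L] (y : L) :
    ‖Algebra.norm ℚ_[p] y‖ = ‖y‖ ^ Module.finrank ℚ_[p] L := by
  have h := congrArg norm (Algebra.norm_eq_prod_embeddings ℚ_[p] (PadicAlgCl p) y)
  rw [norm_algebraMap', norm_prod] at h
  rw [h, Finset.prod_congr rfl fun σ _ => norm_algHom σ y, Finset.prod_const, Finset.card_univ,
    AlgHom.card]

theorem measure_mul_image {L : Type*} [NormedField L] [NormedAlgebra ℚ_[p] L]
    [FiniteDimensional ℚ_[p] L] [MeasurableSpace L] [BorelSpace L] (ν : Measure L)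
    [ν.IsAddHaarMeasure] {c : L} (hc : c ≠ 0) (S : Set L) :
    ν ((fun e => c * e) '' S) = ENNReal.ofReal (‖c‖ ^ Module.finrank ℚ_[p] L) * ν S := by
  have h := measure_image_linearEquiv ν ((Units.mk0 c hc).mulLeftLinearEquiv ℚ_[p] L) S
  rw [← norm_algebraNorm (p := p), Algebra.norm_apply]
  exact h

variable {ι : Type*} [Fintype ι] {K : ι → Type*}
  [∀ i, NormedField (K i)] [∀ i, NormedAlgebra ℚ_[p] (K i)] [∀ i, FiniteDimensional ℚ_[p] (K i)]

/-- Multiplication by `y` scales the product Haar measure by the absolute value of its determinant,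
which is the algebra norm, and also factor by factor by `‖y i‖ ^ [K i : ℚ_p]`; the two scales are
compared. -/
theorem norm_algebraNorm_pi (y : ∀ i, K i) (hy : ∀ i, y i ≠ 0) :
    ‖Algebra.norm ℚ_[p] y‖ = ∏ a : Node p K, ‖node y a‖ := by
  let : ∀ i, MeasurableSpace (K i) := fun i => borel _
  have : ∀ i, BorelSpace (K i) := fun i => ⟨rfl⟩
  have hprop : ∀ i, ProperSpace (K i) := fun i => FiniteDimensional.proper ℚ_[p] (K i)
  let ν : ∀ i, Measure (K i) := fun i => Measure.addHaar
  have hball : ∀ i, ν i (closedBall 0 1) ≠ 0 ∧ ν i (closedBall 0 1) ≠ ∞ :=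
    fun i => ⟨(measure_closedBall_pos _ _ one_pos).ne', (isCompact_closedBall _ _).measure_ne_top⟩
  have h1 := measure_image_linearEquiv (Measure.pi ν) (unitMul p y hy)
    (Set.univ.pi fun i => closedBall 0 1)
  have h2 : unitMul p y hy '' (Set.univ.pi fun i => closedBall (0 : K i) 1) =
      Set.univ.pi fun i => (fun e => y i * e) '' closedBall (0 : K i) 1 :=
    Set.piMap_image_univ_pi (fun i e => y i * e) _
  have hpos : ∀ i, (0 : ℝ) ≤ ‖y i‖ ^ Module.finrank ℚ_[p] (K i) := fun i => by positivity
  rw [h2, Measure.pi_pi, Measure.pi_pi,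
    Finset.prod_congr rfl fun i _ => measure_mul_image (p := p) (ν i) (hy i) _,
    Finset.prod_mul_distrib, ← ENNReal.ofReal_prod_of_nonneg fun i _ => hpos i,
    ENNReal.mul_left_inj (Finset.prod_ne_zero_iff.2 fun i _ => (hball i).1)
      (ENNReal.prod_ne_top fun i _ => (hball i).2),
    ENNReal.ofReal_eq_ofReal_iff (Finset.prod_nonneg fun i _ => hpos i) (norm_nonneg _)] at h1
  rw [Algebra.norm_apply, Fintype.prod_sigma]
  refine h1.symm.trans (Finset.prod_congr rfl fun i _ => ?_)
  have h3 : ∀ σ : K i →ₐ[ℚ_[p]] PadicAlgCl p, ‖node y ⟨i, σ⟩‖ = ‖y i‖ := fun σ =>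
    norm_algHom σ (y i)
  simp_rw [h3]
  rw [Finset.prod_const, Finset.card_univ, AlgHom.card]

end Norm

end

section

open Metric Polynomial
open scoped ENNReal

/-! ### Normalizations of lattices -/

/-- Choosing elements of given absolute value compatibly with inversion makes renormalizing a
lattice and then returning to the first normalization the identity. -/
theorem exists_norm_section (L : Type*) [NormedField L] :
    ∃ s : ℝ → L, (∀ v, s v ≠ 0) ∧ (∀ u : L, u ≠ 0 → ‖s ‖u‖‖ = ‖u‖) ∧
      ∀ v, 0 < v → s v⁻¹ = (s v)⁻¹ := by
  classical
  have h0 : ∀ v : ℝ, ∃ u : L, u ≠ 0 ∧ ((∃ u' : L, u' ≠ 0 ∧ ‖u'‖ = v) → ‖u‖ = v) := by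
    intro v
    by_cases h : ∃ u' : L, u' ≠ 0 ∧ ‖u'‖ = v
    · obtain ⟨u, hu, huv⟩ := h
      exact ⟨u, hu, fun _ => huv⟩
    · exact ⟨1, one_ne_zero, fun h' => absurd h' h⟩
  choose s0 hs0 hs0' using h0
  refine ⟨fun v => if v = 1 then 1 else if v < 1 then s0 v else (s0 v⁻¹)⁻¹, fun v => ?_,
    fun u hu => ?_, fun v hv => ?_⟩
  · dsimp only
    split_ifs
    · exact one_ne_zero
    · exact hs0 _
    · exact inv_ne_zero (hs0 _)
  · dsimp only
    split_ifs with h1 h2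
    · rw [h1, norm_one]
    · exact hs0' _ ⟨u, hu, rfl⟩
    · rw [norm_inv, hs0' _ ⟨u⁻¹, inv_ne_zero hu, norm_inv u⟩, inv_inv]
  · dsimp only
    rcases lt_trichotomy v 1 with h | rfl | h
    · have h1 : 1 < v⁻¹ := (one_lt_inv₀ hv).2 h
      rw [if_neg h1.ne', if_neg h1.not_gt, if_neg h.ne, if_pos h, inv_inv]
    · simp
    · have h1 : v⁻¹ < 1 := inv_lt_one_of_one_lt₀ h
      rw [if_neg h1.ne, if_pos h1, if_neg h.ne', if_neg h.not_gt, inv_inv]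

section Normalize

variable {p : ℕ} [Fact p.Prime] {ι : Type*} [Fintype ι] {K : ι → Type*}
  [∀ i, NormedField (K i)] [∀ i, NormedAlgebra ℚ_[p] (K i)] [∀ i, FiniteDimensional ℚ_[p] (K i)]
  [∀ i, IsUltrametricDist (K i)] [∀ i, Algebra ℤ_[p] (K i)]
  [∀ i, IsScalarTower ℤ_[p] ℚ_[p] (K i)]

/-- The absolute values of the `i`-th coordinates of the elements of `M ∩ Z_i`. -/
def normSet (Z : ∀ _ : ι, Set (∀ i, K i)) (M : Submodule ℤ_[p] (∀ i, K i)) (i : ι) : Set ℝ :=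
  (fun e : ∀ i, K i => ‖e i‖) '' {e | e ∈ M ∧ e ∈ Z i}

/-- The stable lattices normalized with respect to the sets `Z_i`. -/
def normalized (p : ℕ) [Fact p.Prime] {K : ι → Type*} [∀ i, NormedField (K i)]
    [∀ i, NormedAlgebra ℚ_[p] (K i)] [∀ i, Algebra ℤ_[p] (K i)]
    [∀ i, IsScalarTower ℤ_[p] ℚ_[p] (K i)] (x : ∀ i, K i)
    (Z : ∀ _ : ι, Set (∀ i, K i)) : Set (Submodule ℤ_[p] (∀ i, K i)) :=
  {M | (∀ e ∈ M, x * e ∈ M) ∧ Submodule.IsLattice ℚ_[p] M ∧ ∀ i, IsGreatest (normSet Z M i) 1}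

/-- Families of closed ideals with which stable lattices can be normalized. -/
structure Admissible (Z : ∀ _ : ι, Set (∀ i, K i)) : Prop where
  isClosed : ∀ i, IsClosed (Z i)
  exists_ne : ∀ i, ∃ e ∈ Z i, e i ≠ 0
  mul_mem : ∀ i, ∀ u, ∀ e ∈ Z i, u * e ∈ Z i

/-- The lattice `u⁻¹ M`. -/
def scaleLat (u : ∀ i, K i) (M : Submodule ℤ_[p] (∀ i, K i)) : Submodule ℤ_[p] (∀ i, K i) :=
  M.comap (LinearMap.mulLeft ℤ_[p] u)

theorem mem_scaleLat {u e : ∀ i, K i} {M : Submodule ℤ_[p] (∀ i, K i)} :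
    e ∈ scaleLat u M ↔ u * e ∈ M := Iff.rfl

theorem scaleLat_scaleLat {u u' : ∀ i, K i} (h : ∀ i, u i * u' i = 1)
    (M : Submodule ℤ_[p] (∀ i, K i)) : scaleLat u' (scaleLat u M) = M := by
  ext e
  rw [mem_scaleLat, mem_scaleLat, ← mul_assoc, show u * u' = 1 from funext h, one_mul]

theorem isLattice_scaleLat {u : ∀ i, K i} (hu : ∀ i, u i ≠ 0) {M : Submodule ℤ_[p] (∀ i, K i)}
    (hM : Submodule.IsLattice ℚ_[p] M) : Submodule.IsLattice ℚ_[p] (scaleLat u M) := by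
  obtain ⟨ε, C, hε, h1, h2⟩ := bounds_of_isLattice M
  refine isLattice_of_bounds (ε := ε / (‖u‖ + 1)) (C := ‖u⁻¹‖ * C) (by positivity)
    (fun e he => ?_) fun e he => ?_
  · rw [mem_scaleLat]
    refine h1 _ ((norm_mul_le _ _).trans ?_)
    rw [le_div_iff₀ (by positivity)] at he
    nlinarith [norm_nonneg e]
  · have h3 : e = u⁻¹ * (u * e) := by ext i; simp [hu i]
    rw [h3]
    refine (norm_mul_le _ _).trans (mul_le_mul_of_nonneg_left (h2 _ he) (norm_nonneg _))

theorem Admissible.exists_isGreatest {Z : ∀ _ : ι, Set (∀ i, K i)} (hZ : Admissible Z)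
    {M : Submodule ℤ_[p] (∀ i, K i)} (hM : Submodule.IsLattice ℚ_[p] M) (i : ι) :
    ∃ u : K i, u ≠ 0 ∧ IsGreatest (normSet Z M i) ‖u‖ := by
  have hprop : ProperSpace (∀ i, K i) := FiniteDimensional.proper ℚ_[p] _
  obtain ⟨ε, C, hε, h1, h2⟩ := bounds_of_isLattice M
  have hopen : IsOpen (M.toAddSubgroup : Set (∀ i, K i)) :=
    AddSubgroup.isOpen_of_mem_nhds _ (g := 0) (Filter.mem_of_superset (closedBall_mem_nhds 0 hε)
      fun e he => h1 e (mem_closedBall_zero_iff.1 he))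
  have hclosed : IsClosed (M : Set (∀ i, K i)) := AddSubgroup.isClosed_of_isOpen _ hopen
  have hcomp : IsCompact {e : ∀ i, K i | e ∈ M ∧ e ∈ Z i} := by
    refine isCompact_of_isClosed_isBounded (hclosed.inter (hZ.isClosed i)) ?_
    exact (isBounded_closedBall (x := (0 : ∀ i, K i)) (r := C)).subset fun e he =>
      mem_closedBall_zero_iff.2 (h2 e he.1)
  obtain ⟨e0, he0, hne⟩ := hZ.exists_ne i
  obtain ⟨c, hc0, -, hc⟩ := exists_padic_norm_mul_le p (C := ‖e0‖) hε
  have hce : c • e0 ∈ M := h1 _ (by rwa [norm_smul])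
  have hceZ : c • e0 ∈ Z i := by
    have := hZ.mul_mem i (algebraMap ℚ_[p] _ c) e0 he0
    rwa [← Algebra.smul_def] at this
  obtain ⟨g, hg, hmax⟩ := hcomp.exists_isMaxOn ⟨_, hce, hceZ⟩
    (f := fun e : ∀ i, K i => ‖e i‖) (by fun_prop)
  refine ⟨g i, ?_, ⟨g, hg, rfl⟩, ?_⟩
  · have h3 : ‖(c • e0) i‖ ≤ ‖g i‖ := hmax ⟨hce, hceZ⟩
    intro h0
    rw [h0, norm_zero, Pi.smul_apply, norm_smul] at h3
    have : 0 < ‖c‖ * ‖e0 i‖ := mul_pos (norm_pos_iff.2 hc0) (norm_pos_iff.2 hne)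
    linarith
  · rintro _ ⟨e, he, rfl⟩
    exact hmax he

theorem Admissible.isGreatest_scaleLat {Z : ∀ _ : ι, Set (∀ i, K i)} (hZ : Admissible Z)
    {u : ∀ i, K i} (hu : ∀ i, u i ≠ 0) {M : Submodule ℤ_[p] (∀ i, K i)} {i : ι} {v : ℝ}
    (h : IsGreatest (normSet Z M i) v) :
    IsGreatest (normSet Z (scaleLat u M) i) (‖u i‖⁻¹ * v) := by
  have hi : 0 < ‖u i‖ := norm_pos_iff.2 (hu i)
  constructor
  · obtain ⟨e, ⟨heM, heZ⟩, rfl⟩ := h.1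
    refine ⟨u⁻¹ * e, ⟨?_, hZ.mul_mem i _ _ heZ⟩, by simp⟩
    rw [mem_scaleLat]
    convert heM using 1
    ext j; simp [hu j]
  · rintro _ ⟨e, ⟨heM, heZ⟩, rfl⟩
    have := h.2 ⟨u * e, ⟨heM, hZ.mul_mem i _ _ heZ⟩, rfl⟩
    simp only [Pi.mul_apply, norm_mul] at this
    rw [inv_mul_eq_div, le_div_iff₀ hi, mul_comm]
    exact this

/-- The number of normalized stable lattices does not depend on the normalization. -/
theorem ncard_normalized_eq (x : ∀ i, K i) {Z Z' : ∀ _ : ι, Set (∀ i, K i)} (hZ : Admissible Z)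
    (hZ' : Admissible Z') : (normalized p x Z).ncard = (normalized p x Z').ncard ∧
      ((normalized p x Z).Finite → (normalized p x Z').Finite) := by
  choose s hs0 hs1 hs2 using fun i => exists_norm_section (K i)
  let u : (∀ _ : ι, Set (∀ i, K i)) → Submodule ℤ_[p] (∀ i, K i) → ∀ i, K i :=
    fun Z M i => s i (sSup (normSet Z M i))
  let F := fun Z M => scaleLat (u Z M) M
  have hu : ∀ Z M i, u Z M i ≠ 0 := fun Z M i => hs0 _ _
  have hmaps : ∀ Z Z' : ∀ _ : ι, Set (∀ i, K i), Admissible Z' → ∀ M ∈ normalized p x Z,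
      F Z' M ∈ normalized p x Z' := by
    intro Z Z' hZ' M hM
    refine ⟨fun e he => ?_, isLattice_scaleLat (hu _ _) hM.2.1, fun i => ?_⟩
    · rw [mem_scaleLat, mul_left_comm]
      exact hM.1 _ he
    · obtain ⟨w, hw0, hw⟩ := hZ'.exists_isGreatest hM.2.1 i
      have h1 := hZ'.isGreatest_scaleLat (hu Z' M) hw
      have h2 : ‖u Z' M i‖ = ‖w‖ := by
        simp only [u]
        rw [hw.csSup_eq, hs1 i w hw0]
      rwa [h2, inv_mul_cancel₀ (norm_ne_zero_iff.2 hw0)] at h1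
  -- After the first rescaling the maxima for `Z` are the inverses of the maxima of `M` for `Z'`;
  -- since `s` respects inverses, the second rescaling undoes the first.
  have hinv : ∀ Z Z' : ∀ _ : ι, Set (∀ i, K i), Admissible Z → Admissible Z' →
      ∀ M ∈ normalized p x Z, F Z (F Z' M) = M := by
    intro Z Z' hZ hZ' M hM
    refine scaleLat_scaleLat (fun i => ?_) M
    obtain ⟨w, hw0, hw⟩ := hZ'.exists_isGreatest hM.2.1 i
    have h1 := hZ.isGreatest_scaleLat (hu Z' M) (hM.2.2 i)
    have h2 : u Z (F Z' M) i = s i (‖u Z' M i‖⁻¹ * 1) := by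
      simp only [u, F] at h1 ⊢
      rw [h1.csSup_eq]
    have h3 : ‖u Z' M i‖ = ‖w‖ := by
      simp only [u]
      rw [hw.csSup_eq, hs1 i w hw0]
    rw [h2, h3, mul_one, hs2 i _ (norm_pos_iff.2 hw0)]
    simp only [u]
    rw [hw.csSup_eq]
    exact mul_inv_cancel₀ (hs0 i _)
  refine ⟨?_, fun h => (h.image (F Z')).subset fun N hN =>
    ⟨F Z N, hmaps Z' Z hZ N hN, hinv Z' Z hZ' hZ N hN⟩⟩
  refine Set.ncard_congr (fun M _ => F Z' M) (fun M hM => hmaps Z Z' hZ' M hM)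
    (fun M N hM hN h => ?_) fun N hN => ⟨F Z N, hmaps Z' Z hZ N hN, hinv Z' Z hZ' hZ N hN⟩
  exact (hinv Z Z' hZ hZ' M hM).symm.trans ((congrArg (F Z) h).trans (hinv Z Z' hZ hZ' N hN))

theorem admissible_univ : Admissible fun _ : ι => (Set.univ : Set (∀ i, K i)) where
  isClosed _ := isClosed_univ
  exists_ne _ := ⟨1, trivial, one_ne_zero⟩
  mul_mem _ _ _ _ := trivial

theorem normLat_eq_normalized {d : ℝ} {x : ∀ i, K i} {n : ℕ} (hs : Sep (p := p) d x)
    (hx : ‖x‖ ≤ 1) (hn : Fintype.card (Node p K) = n) :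
    NormLat p x = normalized p x fun _ => Set.univ := by
  ext M
  constructor
  · intro hM
    refine ⟨hM.1, NormLat.isLattice hs hx hn hM, fun i => ⟨?_, ?_⟩⟩
    · obtain ⟨e, he, hei⟩ := hM.2.2 i
      exact ⟨e, ⟨he, trivial⟩, hei⟩
    · rintro _ ⟨e, he, rfl⟩
      exact (norm_le_pi_norm e i).trans (hM.2.1 e he.1)
  · intro hM
    refine ⟨hM.1, fun e he => ?_, fun i => ?_⟩
    · rw [pi_norm_le_iff_of_nonneg zero_le_one]
      exact fun i => (hM.2.2 i).2 ⟨e, ⟨he, trivial⟩, rfl⟩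
    · obtain ⟨e, he, hei⟩ := (hM.2.2 i).1
      exact ⟨e, he.1, hei⟩

end Normalize

end

section

open Metric Polynomial
open scoped ENNReal

/-! ### Extensions of lattices -/

theorem eq_prod_X_sub_C_of_roots {F α : Type*} [Field F] [Fintype α] {G : F[X]} (hG : G.Monic)
    (hdeg : G.natDegree = Fintype.card α) {z : α → F} (hz : Function.Injective z)
    (hroot : ∀ a, G.IsRoot (z a)) : G = ∏ a, (X - C (z a)) := by
  have hdvd : (∏ a, (X - C (z a))) ∣ G := by
    refine Finset.prod_dvd_of_coprime (fun a _ b _ hab => ?_) fun a _ => dvd_iff_isRoot.2 (hroot a)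
    exact pairwise_coprime_X_sub_C hz hab
  have hmon' : (∏ a, (X - C (z a))).Monic := monic_prod_of_monic _ _ fun a _ => monic_X_sub_C _
  refine eq_of_monic_of_dvd_of_natDegree_le hmon' hG hdvd ?_
  rw [hdeg, natDegree_prod_of_monic _ _ fun a _ => monic_X_sub_C _]
  simp

section MulMatrix

variable {p : ℕ} [Fact p.Prime] {L : Type*} [NormedField L] [NormedAlgebra ℚ_[p] L]
  [FiniteDimensional ℚ_[p] L]

/-- The matrix of the multiplication by `z`, acting on coordinates on the left. -/
def mulMatrix {q : ℕ} (b : Module.Basis (Fin q) ℚ_[p] L) (z : L) : Matrix (Fin q) (Fin q) ℚ_[p] :=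
  Matrix.of fun k l => b.repr (z * b k) l

/-- The basis, viewed as a vector with entries in `L`, is an eigenvector for the eigenvalue `z`. So
all conjugates of `z` are roots, and there are as many as the degree. -/
theorem charpoly_mulMatrix {q : ℕ} (b : Module.Basis (Fin q) ℚ_[p] L) {z : L}
    (hz : Function.Injective fun τ : L →ₐ[ℚ_[p]] PadicAlgCl p => τ z) :
    (mulMatrix b z).charpoly.map (algebraMap ℚ_[p] (PadicAlgCl p)) =
      ∏ τ : L →ₐ[ℚ_[p]] PadicAlgCl p, (X - C (τ z)) := by
  have hq : Module.finrank ℚ_[p] L = q := by simpa using Module.finrank_eq_card_basis b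
  have hroot : aeval z (mulMatrix b z).charpoly = 0 := by
    rw [← eval_map_algebraMap, ← Matrix.charpoly_map, Matrix.eval_charpoly]
    refine Matrix.exists_mulVec_eq_zero_iff.1 ⟨b, ?_, ?_⟩
    · intro h0
      have h1 : ∀ k, b k = 0 := fun k => congrFun h0 k
      have h2 : (1 : L) = 0 := by
        rw [← b.sum_repr 1]
        simp [h1]
      exact one_ne_zero h2
    · rw [Matrix.sub_mulVec, sub_eq_zero]
      ext k
      have h1 : z * b k = ∑ l, b.repr (z * b k) l • b l := (b.sum_repr _).symm
      have h2 : ((Matrix.scalar (Fin q)) z).mulVec b k = z * b k := by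
        simp [Matrix.scalar_apply, Matrix.mulVec_diagonal]
      rw [h2, h1]
      simp [Matrix.mulVec, dotProduct, mulMatrix, Algebra.smul_def]
  refine eq_prod_X_sub_C_of_roots ((Matrix.charpoly_monic _).map _) ?_ hz fun τ => ?_
  · rw [natDegree_map, Matrix.charpoly_natDegree_eq_dim, Fintype.card_fin, AlgHom.card, hq]
  · rw [IsRoot, eval_map_algebraMap, aeval_algHom_apply, hroot, map_zero]

end MulMatrix

theorem isOpen_of_isLattice {p : ℕ} [Fact p.Prime] {X : Type*} [NormedAddCommGroup X]
    [NormedSpace ℚ_[p] X] [FiniteDimensional ℚ_[p] X] [IsUltrametricDist X] [Module ℤ_[p] X]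
    [IsScalarTower ℤ_[p] ℚ_[p] X] {M : Submodule ℤ_[p] X} (hM : Submodule.IsLattice ℚ_[p] M) :
    IsOpen (M : Set X) := by
  obtain ⟨ε, C, hε, h1, -⟩ := bounds_of_isLattice M
  exact AddSubgroup.isOpen_of_mem_nhds M.toAddSubgroup (g := 0) (Filter.mem_of_superset
    (closedBall_mem_nhds 0 hε) fun e he => h1 e (mem_closedBall_zero_iff.1 he))

section Fiber

variable {p : ℕ} [Fact p.Prime] {m : ℕ} {K : Fin (m + 1) → Type*}
  [∀ i, NormedField (K i)] [∀ i, NormedAlgebra ℚ_[p] (K i)] [∀ i, FiniteDimensional ℚ_[p] (K i)]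
  [∀ i, IsUltrametricDist (K i)] [∀ i, Algebra ℤ_[p] (K i)]
  [∀ i, IsScalarTower ℤ_[p] ℚ_[p] (K i)]

/-- The inclusion `e ↦ (0, e)`. -/
def consZero (p : ℕ) [Fact p.Prime] (K : Fin (m + 1) → Type*) [∀ i, NormedField (K i)]
    [∀ i, Algebra ℤ_[p] (K i)] : (∀ i : Fin m, K i.succ) →ₗ[ℤ_[p]] ∀ i, K i where
  toFun e := Fin.cons 0 e
  map_add' e f := by
    ext i
    refine Fin.cases ?_ (fun j => ?_) i
    · simp
    · simp
  map_smul' c e := by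
    ext i
    refine Fin.cases ?_ (fun j => ?_) i
    · simp
    · simp

theorem consZero_zero (e : ∀ i : Fin m, K i.succ) : consZero p K e 0 = 0 := rfl

theorem consZero_succ (e : ∀ i : Fin m, K i.succ) (i : Fin m) : consZero p K e i.succ = e i := rfl

/-- The first coordinate. -/
def headMap (p : ℕ) [Fact p.Prime] (K : Fin (m + 1) → Type*) [∀ i, NormedField (K i)]
    [∀ i, Algebra ℤ_[p] (K i)] : (∀ i, K i) →ₗ[ℤ_[p]] K 0 := LinearMap.proj 0

theorem eq_consZero_of_head {e : ∀ i, K i} (he : e 0 = 0) :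
    e = consZero p K (fun i => e i.succ) := by
  ext i
  refine Fin.cases he (fun j => rfl) i

/-- The stable submodules with given kernel and image under the first projection. -/
def fiberSet (x : ∀ i, K i) (M₁ : Submodule ℤ_[p] (∀ i : Fin m, K i.succ))
    (M₂ : Submodule ℤ_[p] (K 0)) : Set (Submodule ℤ_[p] (∀ i, K i)) :=
  {M | (∀ e ∈ M, x * e ∈ M) ∧ M.comap (consZero p K) = M₁ ∧ M.map (headMap p K) = M₂}

theorem isLattice_of_comap_map {M : Submodule ℤ_[p] (∀ i, K i)}
    (h1 : Submodule.IsLattice ℚ_[p] (M.comap (consZero p K)))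
    (h2 : Submodule.IsLattice ℚ_[p] (M.map (headMap p K))) : Submodule.IsLattice ℚ_[p] M := by
  constructor
  · refine Submodule.fg_of_fg_map_of_fg_inf_ker (headMap p K) h2.fg ?_
    have : M ⊓ LinearMap.ker (headMap p K) = (M.comap (consZero p K)).map (consZero p K) := by
      ext e
      constructor
      · rintro ⟨he, h0⟩
        have h3 := eq_consZero_of_head (p := p) h0
        refine ⟨fun i => e i.succ, ?_, h3.symm⟩
        change consZero p K _ ∈ M
        rw [← h3]
        exact he
      · rintro ⟨f, hf, rfl⟩
        exact ⟨hf, rfl⟩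
    rw [this]
    exact h1.fg.map _
  · rw [eq_top_iff]
    rintro e -
    obtain ⟨ε2, -, hε2, hb2, -⟩ := bounds_of_isLattice (M.map (headMap p K))
    obtain ⟨ε1, -, hε1, hb1, -⟩ := bounds_of_isLattice (M.comap (consZero p K))
    obtain ⟨c, hc0, -, hc⟩ := exists_padic_norm_mul_le p (C := ‖e 0‖) hε2
    obtain ⟨f, hf, hfe⟩ := hb2 (c • e 0) (by rwa [norm_smul])
    let u : ∀ i : Fin m, K i.succ := fun i => c • e i.succ - f i.succ
    obtain ⟨c', hc'0, -, hc'⟩ := exists_padic_norm_mul_le p (C := ‖u‖) hε1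
    have hu : consZero p K (c' • u) ∈ M := hb1 (c' • u) (by rwa [norm_smul])
    have he : e = c⁻¹ • (f + c'⁻¹ • consZero p K (c' • u)) := by
      ext i
      refine Fin.cases ?_ (fun j => ?_) i
      · have hfe' : f 0 = c • e 0 := hfe
        simp [consZero_zero, hfe', smul_smul, inv_mul_cancel₀ hc0]
      · simp [consZero_succ, u, smul_smul, inv_mul_cancel₀ hc0, inv_mul_cancel₀ hc'0]
    rw [he]
    exact Submodule.smul_mem _ _ (add_mem (Submodule.subset_span hf)
      (Submodule.smul_mem _ _ (Submodule.subset_span hu)))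

/-- The lattice of the pairs `(v, u)` with `v ∈ M₂` and `u - ψ v ∈ M₁`. -/
def graphLat (M₁ : Submodule ℤ_[p] (∀ i : Fin m, K i.succ)) (M₂ : Submodule ℤ_[p] (K 0))
    (ψ : K 0 →ₗ[ℚ_[p]] ∀ i : Fin m, K i.succ) : Submodule ℤ_[p] (∀ i, K i) where
  carrier := {e | e 0 ∈ M₂ ∧ (fun i : Fin m => e i.succ) - ψ (e 0) ∈ M₁}
  add_mem' := by
    rintro e f ⟨he, he'⟩ ⟨hf, hf'⟩
    refine ⟨add_mem he hf, ?_⟩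
    convert add_mem he' hf' using 1
    rw [Pi.add_apply, map_add]
    ext i
    simp only [Pi.sub_apply, Pi.add_apply]
    ring
  zero_mem' := by
    refine ⟨zero_mem _, ?_⟩
    rw [Pi.zero_apply, map_zero, sub_zero]
    exact zero_mem _
  smul_mem' := by
    rintro c e ⟨he, he'⟩
    refine ⟨Submodule.smul_mem _ c he, ?_⟩
    convert Submodule.smul_mem _ c he' using 1
    rw [Pi.smul_apply, padicInt_smul c (e 0), map_smul, smul_sub, padicInt_smul c (ψ (e 0))]
    rfl

theorem mem_graphLat {M₁ : Submodule ℤ_[p] (∀ i : Fin m, K i.succ)} {M₂ : Submodule ℤ_[p] (K 0)}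
    {ψ : K 0 →ₗ[ℚ_[p]] ∀ i : Fin m, K i.succ} {e : ∀ i, K i} :
    e ∈ graphLat M₁ M₂ ψ ↔ e 0 ∈ M₂ ∧ (fun i : Fin m => e i.succ) - ψ (e 0) ∈ M₁ := Iff.rfl

theorem comap_graphLat (M₁ : Submodule ℤ_[p] (∀ i : Fin m, K i.succ))
    (M₂ : Submodule ℤ_[p] (K 0)) (ψ : K 0 →ₗ[ℚ_[p]] ∀ i : Fin m, K i.succ) :
    (graphLat M₁ M₂ ψ).comap (consZero p K) = M₁ := by
  ext e
  rw [Submodule.mem_comap, mem_graphLat, consZero_zero, map_zero, sub_zero]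
  exact ⟨fun h => h.2, fun h => ⟨zero_mem _, h⟩⟩

theorem map_graphLat (M₁ : Submodule ℤ_[p] (∀ i : Fin m, K i.succ))
    (M₂ : Submodule ℤ_[p] (K 0)) (ψ : K 0 →ₗ[ℚ_[p]] ∀ i : Fin m, K i.succ) :
    (graphLat M₁ M₂ ψ).map (headMap p K) = M₂ := by
  ext v
  constructor
  · rintro ⟨e, he, rfl⟩
    exact he.1
  · intro hv
    refine ⟨Fin.cons v (ψ v), ⟨hv, ?_⟩, rfl⟩
    change ψ v - ψ v ∈ M₁
    rw [sub_self]
    exact zero_mem _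

variable {q : ℕ} {M₁ : Submodule ℤ_[p] (∀ i : Fin m, K i.succ)} {M₂ : Submodule ℤ_[p] (K 0)}
  {b : Module.Basis (Fin q) ℚ_[p] (K 0)}

theorem sum_repr_mem {b : Module.Basis (Fin q) ℚ_[p] (K 0)} {v : K 0}
    (hv : ∀ k, ‖b.repr v k‖ ≤ 1) {g : Fin q → ∀ i : Fin m, K i.succ} (hg : ∀ k, g k ∈ M₁) :
    ∑ k, b.repr v k • g k ∈ M₁ :=
  Submodule.sum_mem _ fun k _ => smul_mem_of_norm_le_one _ (hv k) (hg k)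

theorem constr_eq_sum (b : Module.Basis (Fin q) ℚ_[p] (K 0)) (ψ : Fin q → ∀ i : Fin m, K i.succ)
    (v : K 0) : b.constr ℚ_[p] ψ v = ∑ k, b.repr v k • ψ k := by
  rw [Module.Basis.constr_apply_fintype]
  rfl

/-- Two sections of the same extension differ by a homomorphism `M₂ → M₁`, which can be tested on
the basis `b` of `M₂`. -/
theorem graphLat_eq_iff (hb : ∀ v, v ∈ M₂ ↔ ∀ k, ‖b.repr v k‖ ≤ 1)
    (ψ ψ' : Fin q → ∀ i : Fin m, K i.succ) :
    graphLat M₁ M₂ (b.constr ℚ_[p] ψ) = graphLat M₁ M₂ (b.constr ℚ_[p] ψ') ↔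
      ∀ k, ψ k - ψ' k ∈ M₁ := by
  have hbk : ∀ k, b k ∈ M₂ := fun k => (hb _).2 fun l => by
    rw [b.repr_self, Finsupp.single_apply]; split_ifs <;> simp
  constructor
  · intro h k
    have h1 : (Fin.cons (b k) (ψ k) : ∀ i, K i) ∈ graphLat M₁ M₂ (b.constr ℚ_[p] ψ) := by
      refine ⟨hbk k, ?_⟩
      change ψ k - b.constr ℚ_[p] ψ (b k) ∈ M₁
      rw [Module.Basis.constr_basis, sub_self]
      exact zero_mem _
    rw [h] at h1
    have h2 : ψ k - b.constr ℚ_[p] ψ' (b k) ∈ M₁ := h1.2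
    rwa [Module.Basis.constr_basis] at h2
  · intro h
    ext e
    refine and_congr_right fun he => ?_
    have h1 : (fun i : Fin m => e i.succ) - b.constr ℚ_[p] ψ' (e 0) =
        ((fun i : Fin m => e i.succ) - b.constr ℚ_[p] ψ (e 0)) +
          ∑ k, b.repr (e 0) k • (ψ k - ψ' k) := by
      simp only [constr_eq_sum, smul_sub, Finset.sum_sub_distrib]
      abel
    have h2 : ∑ k, b.repr (e 0) k • (ψ k - ψ' k) ∈ M₁ := sum_repr_mem ((hb _).1 he) h
    rw [h1]
    exact (Submodule.add_mem_iff_left _ h2).symm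

/-- As `M₁` and `M₂` are stable, the only obstruction is the commutator of `ψ` with the action of
`x`, which has to map `M₂` into `M₁`; that commutator is `commOp`. -/
theorem stable_graphLat_iff {x : ∀ i, K i} (hb : ∀ v, v ∈ M₂ ↔ ∀ k, ‖b.repr v k‖ ≤ 1)
    (h1 : ∀ e ∈ M₁, (fun i : Fin m => x i.succ) * e ∈ M₁) (h2 : ∀ v ∈ M₂, x 0 * v ∈ M₂)
    (ψ : Fin q → ∀ i : Fin m, K i.succ) :
    (∀ e ∈ graphLat M₁ M₂ (b.constr ℚ_[p] ψ), x * e ∈ graphLat M₁ M₂ (b.constr ℚ_[p] ψ)) ↔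
      ∀ k, (fun i : Fin m => x i.succ) * ψ k - b.constr ℚ_[p] ψ (x 0 * b k) ∈ M₁ := by
  have hbk : ∀ k, b k ∈ M₂ := fun k => (hb _).2 fun l => by
    rw [b.repr_self, Finsupp.single_apply]; split_ifs <;> simp
  constructor
  · intro h k
    have h3 : (Fin.cons (b k) (ψ k) : ∀ i, K i) ∈ graphLat M₁ M₂ (b.constr ℚ_[p] ψ) := by
      refine ⟨hbk k, ?_⟩
      change ψ k - b.constr ℚ_[p] ψ (b k) ∈ M₁
      rw [Module.Basis.constr_basis, sub_self]
      exact zero_mem _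
    exact (h _ h3).2
  · intro h e he
    refine ⟨h2 _ he.1, ?_⟩
    have h3 : (fun i : Fin m => (x * e) i.succ) - b.constr ℚ_[p] ψ ((x * e) 0) =
        (fun i : Fin m => x i.succ) * ((fun i : Fin m => e i.succ) - b.constr ℚ_[p] ψ (e 0)) +
        ∑ k, b.repr (e 0) k • ((fun i : Fin m => x i.succ) * ψ k -
          b.constr ℚ_[p] ψ (x 0 * b k)) := by
      have h4 : b.constr ℚ_[p] ψ (x 0 * e 0) =
          ∑ k, b.repr (e 0) k • b.constr ℚ_[p] ψ (x 0 * b k) := by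
        conv_lhs => rw [← b.sum_repr (e 0), Finset.mul_sum]
        simp only [mul_smul_comm, map_sum, map_smul]
      have h5 : (fun i : Fin m => x i.succ) * b.constr ℚ_[p] ψ (e 0) =
          ∑ k, b.repr (e 0) k • ((fun i : Fin m => x i.succ) * ψ k) := by
        rw [constr_eq_sum, Finset.mul_sum]
        simp only [mul_smul_comm]
      simp only [smul_sub, Finset.sum_sub_distrib]
      rw [← h5, ← h4, mul_sub]
      change (fun i : Fin m => x i.succ) * (fun i : Fin m => e i.succ) - _ = _
      rw [Pi.mul_apply]
      abel
    rw [h3]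
    exact add_mem (h1 _ he.2) (sum_repr_mem ((hb _).1 he.1) h)

/-- `M₂` is free over `ℤ_p`, so the projection of `M` onto it splits; `ψ` records the remaining
coordinates of lifts of the basis. -/
theorem exists_graphLat_eq (hb : ∀ v, v ∈ M₂ ↔ ∀ k, ‖b.repr v k‖ ≤ 1)
    {M : Submodule ℤ_[p] (∀ i, K i)} (hM₁ : M.comap (consZero p K) = M₁)
    (hM₂ : M.map (headMap p K) = M₂) :
    ∃ ψ : Fin q → ∀ i : Fin m, K i.succ, graphLat M₁ M₂ (b.constr ℚ_[p] ψ) = M := by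
  have hbk : ∀ k, b k ∈ M.map (headMap p K) := fun k => hM₂ ▸ (hb _).2 fun l => by
    rw [b.repr_self, Finsupp.single_apply]; split_ifs <;> simp
  choose g hg hgb using hbk
  refine ⟨fun k (i : Fin m) => g k i.succ, ?_⟩
  ext e
  rw [mem_graphLat]
  have key : ∀ he : e 0 ∈ M₂, ((fun i : Fin m => e i.succ) -
      b.constr ℚ_[p] (fun k (i : Fin m) => g k i.succ) (e 0) ∈ M₁ ↔ e ∈ M) := by
    intro he
    have h1 : ∑ k, b.repr (e 0) k • g k ∈ M :=
      Submodule.sum_mem _ fun k _ => smul_mem_of_norm_le_one _ ((hb _).1 he k) (hg k)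
    have h2 : consZero p K ((fun i : Fin m => e i.succ) -
        b.constr ℚ_[p] (fun k (i : Fin m) => g k i.succ) (e 0)) = e - ∑ k, b.repr (e 0) k • g k := by
      ext i
      refine Fin.cases ?_ (fun j => ?_) i
      · have h3 : ∀ k, g k 0 = b k := hgb
        rw [consZero_zero, Pi.sub_apply, Finset.sum_apply]
        simp only [Pi.smul_apply, h3, b.sum_repr, sub_self]
      · rw [consZero_succ, constr_eq_sum]
        simp [Finset.sum_apply]
    rw [← hM₁, Submodule.mem_comap, h2]
    exact Submodule.sub_mem_iff_left _ h1
  constructor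
  · rintro ⟨he, h⟩
    exact (key he).1 h
  · intro he
    have he0 : e 0 ∈ M₂ := hM₂ ▸ ⟨e, he, rfl⟩
    exact ⟨he0, (key he0).2 he⟩

end Fiber

end

section

open Metric Polynomial
open scoped ENNReal

/-! ### The number of extensions of lattices -/

section FiberCount

variable {p : ℕ} [Fact p.Prime] {m : ℕ} {K : Fin (m + 1) → Type*}
  [∀ i, NormedField (K i)] [∀ i, NormedAlgebra ℚ_[p] (K i)] [∀ i, FiniteDimensional ℚ_[p] (K i)]
  [∀ i, IsUltrametricDist (K i)] [∀ i, Algebra ℤ_[p] (K i)]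
  [∀ i, IsScalarTower ℤ_[p] ℚ_[p] (K i)]

/-- The operator `ψ ↦ y ψ - ψ z`. -/
def commOp {q : ℕ} (b : Module.Basis (Fin q) ℚ_[p] (K 0)) (x : ∀ i, K i) :
    (Fin q → ∀ i : Fin m, K i.succ) →ₗ[ℚ_[p]] (Fin q → ∀ i : Fin m, K i.succ) :=
  (Matrix.toLin' ((Matrix.scalar (Fin q)) (fun i : Fin m => x i.succ) -
    (mulMatrix b (x 0)).map (algebraMap ℚ_[p] (∀ i : Fin m, K i.succ)))).restrictScalars ℚ_[p]

theorem commOp_apply {q : ℕ} (b : Module.Basis (Fin q) ℚ_[p] (K 0)) (x : ∀ i, K i)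
    (ψ : Fin q → ∀ i : Fin m, K i.succ) (k : Fin q) :
    commOp b x ψ k = (fun i : Fin m => x i.succ) * ψ k - b.constr ℚ_[p] ψ (x 0 * b k) := by
  have h1 : commOp b x ψ = ((Matrix.scalar (Fin q)) (fun i : Fin m => x i.succ) -
    (mulMatrix b (x 0)).map (algebraMap ℚ_[p] (∀ i : Fin m, K i.succ))).mulVec ψ :=
    Matrix.toLin'_apply _ _
  rw [h1, Matrix.sub_mulVec, Pi.sub_apply, constr_eq_sum]
  congr 1
  · simp [Matrix.scalar_apply, Matrix.mulVec_diagonal]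
  · simp [Matrix.mulVec, dotProduct, mulMatrix, Algebra.smul_def]

/-- The resultant of the characteristic polynomials of the first and the other coordinates. -/
def crossRes (p : ℕ) [Fact p.Prime] {K : Fin (m + 1) → Type*} [∀ i, NormedField (K i)]
    [∀ i, NormedAlgebra ℚ_[p] (K i)] [∀ i, FiniteDimensional ℚ_[p] (K i)] (x : ∀ i, K i) : ℝ :=
  ∏ a : Node p fun i : Fin m => K i.succ, ∏ τ : K 0 →ₐ[ℚ_[p]] PadicAlgCl p,
    ‖a.2 (x a.1.succ) - τ (x 0)‖

/-- Over the algebra of the remaining factors the operator is a matrix, whose determinant is the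
characteristic polynomial of multiplication by `x 0` evaluated at the tail of `x`. Its norm down to
`ℚ_p` is the product of all mixed differences of conjugates. -/
theorem norm_det_commOp {q : ℕ} (b : Module.Basis (Fin q) ℚ_[p] (K 0)) {x : ∀ i, K i}
    (hx : Function.Injective (node (p := p) x)) :
    ‖LinearMap.det (commOp b x)‖ = crossRes p x ∧ 0 < crossRes p x := by
  have hinj : Function.Injective fun τ : K 0 →ₐ[ℚ_[p]] PadicAlgCl p => τ (x 0) := by
    intro τ τ' h
    have : (⟨0, τ⟩ : Node p K) = ⟨0, τ'⟩ := hx h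
    simpa using this
  have hne : ∀ (a : Node p fun i : Fin m => K i.succ) (τ : K 0 →ₐ[ℚ_[p]] PadicAlgCl p),
      a.2 (x a.1.succ) - τ (x 0) ≠ 0 := by
    intro a τ h
    have h1 : (⟨a.1.succ, a.2⟩ : Node p K) = ⟨0, τ⟩ := hx (sub_eq_zero.1 h)
    exact Fin.succ_ne_zero _ (congrArg Sigma.fst h1)
  set y : ∀ i : Fin m, K i.succ := aeval (fun i : Fin m => x i.succ) (mulMatrix b (x 0)).charpoly
    with hy
  have hyi : ∀ i, y i = aeval (x i.succ) (mulMatrix b (x 0)).charpoly := fun i =>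
    (aeval_algHom_apply (Pi.evalAlgHom ℚ_[p] (fun i : Fin m => K i.succ) i)
      (fun i : Fin m => x i.succ) _).symm
  have hnode : ∀ a : Node p fun i : Fin m => K i.succ,
      node y a = ∏ τ : K 0 →ₐ[ℚ_[p]] PadicAlgCl p, (a.2 (x a.1.succ) - τ (x 0)) := by
    intro a
    rw [node, hyi, ← aeval_algHom_apply, ← eval_map_algebraMap, charpoly_mulMatrix b hinj,
      eval_prod]
    simp
  have hy0 : ∀ i, y i ≠ 0 := by
    intro i h0
    obtain ⟨σ, -⟩ := exists_node (p := p) (K := fun i : Fin m => K i.succ) i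
    have h1 := hnode ⟨i, σ⟩
    rw [node, h0, map_zero] at h1
    exact Finset.prod_ne_zero_iff.2 (fun τ _ => hne ⟨i, σ⟩ τ) h1.symm
  constructor
  · rw [commOp, LinearMap.det_restrictScalars, LinearMap.det_toLin', ← Matrix.eval_charpoly,
      Matrix.charpoly_map, eval_map_algebraMap, ← hy, norm_algebraNorm_pi y hy0]
    refine Finset.prod_congr rfl fun a _ => ?_
    rw [hnode, norm_prod]
  · exact Finset.prod_pos fun a _ => Finset.prod_pos fun τ _ => norm_pos_iff.2 (hne a τ)

/-- The number of extensions of two stable lattices. -/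
theorem ncard_fiberSet {x : ∀ i, K i} (hx : Function.Injective (node (p := p) x))
    {M₁ : Submodule ℤ_[p] (∀ i : Fin m, K i.succ)} {M₂ : Submodule ℤ_[p] (K 0)}
    (hM₁ : Submodule.IsLattice ℚ_[p] M₁) (hM₂ : Submodule.IsLattice ℚ_[p] M₂)
    (h1 : ∀ e ∈ M₁, (fun i : Fin m => x i.succ) * e ∈ M₁) (h2 : ∀ v ∈ M₂, x 0 * v ∈ M₂)
    (hfin : (fiberSet x M₁ M₂).Finite) : ((fiberSet x M₁ M₂).ncard : ℝ) * crossRes p x = 1 := by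
  classical
  obtain ⟨q, hq⟩ : ∃ q, Module.finrank ℚ_[p] (K 0) = q := ⟨_, rfl⟩
  obtain ⟨b, hb⟩ := exists_basis_of_isLattice M₂ hq
  obtain ⟨hdet, hpos⟩ := norm_det_commOp b hx
  let X := Fin q → ∀ i : Fin m, K i.succ
  let : MeasurableSpace X := borel X
  have : BorelSpace X := ⟨rfl⟩
  have hprop : ProperSpace X := FiniteDimensional.proper ℚ_[p] X
  let ν : Measure X := Measure.addHaar
  let L : Set X := {ψ | ∀ k, ψ k ∈ M₁}
  have hLo : IsOpen L := by
    have : L = ⋂ k, (fun ψ : X => ψ k) ⁻¹' (M₁ : Set (∀ i : Fin m, K i.succ)) := by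
      ext ψ; simp [L]
    rw [this]
    exact isOpen_iInter_of_finite fun k => (isOpen_of_isLattice hM₁).preimage (continuous_apply k)
  have hL0 : ν L ≠ 0 := (hLo.measure_pos ν ⟨0, fun k => zero_mem _⟩).ne'
  have hL1 : ν L ≠ ∞ := by
    obtain ⟨ε, C, hε, -, hC⟩ := bounds_of_isLattice M₁
    have hC0 : 0 ≤ C := (norm_nonneg _).trans (hC 0 (zero_mem _))
    refine ((measure_mono ?_).trans_lt (isCompact_closedBall (0 : X) C).measure_lt_top).ne
    intro ψ hψ
    rw [mem_closedBall_zero_iff, pi_norm_le_iff_of_nonneg hC0]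
    exact fun k => hC _ (hψ k)
  have hker : LinearMap.ker (commOp b x) = ⊥ := by
    by_contra h
    have := LinearMap.det_eq_zero_iff_ker_ne_bot.2 h
    rw [this, norm_zero] at hdet
    exact hpos.ne hdet
  let f : X ≃ₗ[ℚ_[p]] X := LinearEquiv.ofInjectiveEndo (commOp b x) (LinearMap.ker_eq_bot.1 hker)
  have hf : ∀ ψ, f ψ = commOp b x ψ := fun ψ => rfl
  have hfdet : ‖LinearMap.det (f : X →ₗ[ℚ_[p]] X)‖ = crossRes p x := by
    rw [← hdet]; rfl
  let Z : Set X := {ψ | commOp b x ψ ∈ L}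
  have hfZ : f '' Z = L := by
    ext ψ
    constructor
    · rintro ⟨ψ, hψ, rfl⟩; exact hψ
    · intro hψ
      obtain ⟨ψ, rfl⟩ := f.surjective ψ
      exact ⟨ψ, hψ, rfl⟩
  -- `L` is `Hom(M₂, M₁)` and `Z` the set of `ψ` with stable graph. `Z` is a disjoint union of
  -- translates of `L`, one for each extension, so their number is `ν Z / ν L`, the inverse of the
  -- determinant.
  have hvol : ν L = ENNReal.ofReal (crossRes p x) * ν Z := by
    rw [← hfZ, measure_image_linearEquiv, hfdet]
  let S : Submodule ℤ_[p] (∀ i, K i) → Set X := fun M =>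
    {ψ | graphLat M₁ M₂ (b.constr ℚ_[p] ψ) = M}
  have hZS : Z = ⋃ M ∈ hfin.toFinset, S M := by
    ext ψ
    have hst := stable_graphLat_iff (x := x) hb h1 h2 ψ
    have hZ : ψ ∈ Z ↔ ∀ e ∈ graphLat M₁ M₂ (b.constr ℚ_[p] ψ),
        x * e ∈ graphLat M₁ M₂ (b.constr ℚ_[p] ψ) := by
      rw [hst]
      exact forall_congr' fun k => by rw [commOp_apply]
    simp only [Set.mem_iUnion, hfin.mem_toFinset]
    rw [hZ]
    constructor
    · exact fun h => ⟨_, ⟨h, comap_graphLat _ _ _, map_graphLat _ _ _⟩, rfl⟩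
    · rintro ⟨M, hM, hψ⟩
      have : graphLat M₁ M₂ (b.constr ℚ_[p] ψ) = M := hψ
      rw [this]
      exact hM.1
  have hSM : ∀ M ∈ hfin.toFinset, MeasurableSet (S M) ∧ ν (S M) = ν L := by
    intro M hM
    obtain ⟨-, hM1, hM2⟩ := hfin.mem_toFinset.1 hM
    obtain ⟨ψ0, rfl⟩ := exists_graphLat_eq hb hM1 hM2
    have hS : S (graphLat M₁ M₂ (b.constr ℚ_[p] ψ0)) = (fun ψ => -ψ0 + ψ) ⁻¹' L := by
      ext ψ
      refine (graphLat_eq_iff hb ψ ψ0).trans (forall_congr' fun k => ?_)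
      change _ ↔ (-ψ0 + ψ) k ∈ M₁
      rw [show (-ψ0 + ψ) k = ψ k - ψ0 k from neg_add_eq_sub _ _]
    rw [hS]
    exact ⟨(hLo.preimage (by fun_prop)).measurableSet, measure_preimage_add _ _ _⟩
  have hZvol : ν Z = hfin.toFinset.card * ν L := by
    rw [hZS, measure_biUnion_finset _ fun M hM => (hSM M hM).1,
      Finset.sum_congr rfl fun M hM => (hSM M hM).2, Finset.sum_const, nsmul_eq_mul]
    intro M _ N _ hMN
    exact Set.disjoint_left.2 fun ψ hψ hψ' => hMN (Eq.trans (Eq.symm hψ) hψ')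
  rw [hZvol, ← mul_assoc] at hvol
  have h3 : ENNReal.ofReal (crossRes p x) * hfin.toFinset.card = 1 := by
    refine (ENNReal.mul_left_inj hL0 hL1).1 ?_
    rw [one_mul]
    exact hvol.symm
  have h4 := congrArg ENNReal.toReal h3
  rw [ENNReal.toReal_mul, ENNReal.toReal_ofReal hpos.le, ENNReal.toReal_natCast,
    ENNReal.toReal_one] at h4
  rw [Set.ncard_eq_toFinset_card _ hfin, mul_comm]
  exact h4

end FiberCount

end

section

open Metric Polynomial
open scoped ENNReal

/-! ### The product formula for the number of lattices -/

section SingleField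

variable {p : ℕ} [Fact p.Prime]

/-- The stable lattices in a field which generate its ring of integers. -/
def NormLat1 (p : ℕ) [Fact p.Prime] {L : Type*} [NormedField L] [Algebra ℤ_[p] L] (y : L) :
    Set (Submodule ℤ_[p] L) :=
  {M | (∀ e ∈ M, y * e ∈ M) ∧ (∀ e ∈ M, ‖e‖ ≤ 1) ∧ ∃ e ∈ M, ‖e‖ = 1}

variable {ι : Type*} [Fintype ι] {K : ι → Type*}
  [∀ i, NormedField (K i)] [∀ i, NormedAlgebra ℚ_[p] (K i)] [∀ i, FiniteDimensional ℚ_[p] (K i)]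
  [∀ i, IsUltrametricDist (K i)] [∀ i, Algebra ℤ_[p] (K i)]
  [∀ i, IsScalarTower ℤ_[p] ℚ_[p] (K i)] {d : ℝ} {x : ∀ i, K i} {n : ℕ}

theorem Sep.injective (hs : Sep (p := p) d x) (hx : ‖x‖ ≤ 1) :
    Function.Injective (node (p := p) x) := by
  intro a b hab
  by_contra h
  have := hs.le_sub hx h
  rw [hab, sub_self, norm_zero] at this
  exact hs.1.not_ge this

theorem Sep.mem_normLat1_of_norm_le (hs : Sep (p := p) d x) (hx : ‖x‖ ≤ 1)
    (hn : Fintype.card (Node p K) = n) {i : ι} {M : Submodule ℤ_[p] (K i)}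
    (hM : M ∈ NormLat1 p (x i)) {e : K i} (he : ‖e‖ ≤ d) : e ∈ M := by
  classical
  obtain ⟨c, hc, hc1⟩ := hM.2.2
  have hc0 : c ≠ 0 := by
    intro h0
    rw [h0, norm_zero] at hc1
    exact zero_ne_one hc1
  obtain ⟨w, hw, hwe⟩ := hs.exists_integral_theta hx hn (e := Pi.single i (e / c)) (by
    rwa [Pi.norm_single, norm_div, hc1, div_one])
  have h2 : e = theta p n (x i) w * c := by
    rw [← theta_apply_pi, hwe, Pi.single_eq_same, div_mul_cancel₀ _ hc0]
  rw [h2]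
  exact theta_mul_mem hM.1 hw hc

theorem Sep.isLattice_normLat1 (hs : Sep (p := p) d x) (hx : ‖x‖ ≤ 1)
    (hn : Fintype.card (Node p K) = n) {i : ι} {M : Submodule ℤ_[p] (K i)}
    (hM : M ∈ NormLat1 p (x i)) : Submodule.IsLattice ℚ_[p] M :=
  isLattice_of_bounds hs.1 (fun _ he => hs.mem_normLat1_of_norm_le hx hn hM he) hM.2.1

theorem Sep.finite_normLat1 (hs : Sep (p := p) d x) (hx : ‖x‖ ≤ 1)
    (hn : Fintype.card (Node p K) = n) (i : ι) : (NormLat1 p (x i)).Finite :=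
  finite_of_bounds hs.1 (fun _ hM _ he => hs.mem_normLat1_of_norm_le hx hn hM he)
    fun _ hM => hM.2.1

end SingleField

/-! ### Splitting off one factor in the lattice count. -/

section Recursion

variable {p : ℕ} [Fact p.Prime] {m : ℕ} {K : Fin (m + 1) → Type*}
  [∀ i, NormedField (K i)] [∀ i, NormedAlgebra ℚ_[p] (K i)] [∀ i, FiniteDimensional ℚ_[p] (K i)]

theorem prod_node_succ (f : Node p K → ℝ) : ∏ a, f a =
    (∏ τ, f ⟨0, τ⟩) * ∏ a : Node p fun i : Fin m => K i.succ, f ⟨a.1.succ, a.2⟩ := by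
  rw [Fintype.prod_sigma, Fin.prod_univ_succ, Fintype.prod_sigma]

variable {d : ℝ} {x : ∀ i, K i}

/-- The factors dropped from each product have size at most `1`, so the bound `d` survives. -/
theorem Sep.tail (hs : Sep (p := p) d x) (hx : ‖x‖ ≤ 1) :
    Sep (p := p) d fun i : Fin m => x i.succ := by
  classical
  refine ⟨hs.1, fun a => (hs.2 ⟨a.1.succ, a.2⟩).trans ?_⟩
  have hinj : Function.Injective
      fun b : Node p (fun i : Fin m => K i.succ) => (⟨b.1.succ, b.2⟩ : Node p K) := by
    rintro ⟨i, σ⟩ ⟨j, τ⟩ h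
    obtain ⟨h1, h2⟩ := Sigma.mk.inj h
    obtain rfl := Fin.succ_injective _ h1
    exact congrArg (Sigma.mk _) (eq_of_heq h2)
  have himg : ∏ b ∈ Finset.univ.erase a,
      ‖node (p := p) (fun i : Fin m => x i.succ) a - node (fun i : Fin m => x i.succ) b‖ =
      ∏ b ∈ (Finset.univ.erase a).image
        (fun b : Node p (fun i : Fin m => K i.succ) => (⟨b.1.succ, b.2⟩ : Node p K)),
        ‖node x ⟨a.1.succ, a.2⟩ - node x b‖ := by
    rw [Finset.prod_image hinj.injOn]
    rfl
  refine le_of_le_of_eq ?_ (himg.symm.trans (Finset.prod_congr (by ext; simp) fun _ _ => rfl))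
  have hsub : (Finset.univ.erase a).image
      (fun b : Node p (fun i : Fin m => K i.succ) => (⟨b.1.succ, b.2⟩ : Node p K)) ⊆
      Finset.univ.erase ⟨a.1.succ, a.2⟩ := by
    intro b hb
    obtain ⟨b', hb', rfl⟩ := Finset.mem_image.1 hb
    exact Finset.mem_erase.2 ⟨fun h => Finset.ne_of_mem_erase hb' (hinj h), Finset.mem_univ _⟩
  have hprod := Finset.prod_sdiff (f := fun b => ‖node x ⟨a.1.succ, a.2⟩ - node x b‖) hsub
  refine le_of_eq_of_le (Eq.trans (Finset.prod_congr (by ext; simp) fun _ _ => rfl) hprod.symm) ?_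
  exact mul_le_of_le_one_left (Finset.prod_nonneg fun _ _ => norm_nonneg _)
    (Finset.prod_le_one (fun _ _ => norm_nonneg _) fun _ _ => norm_node_sub_le_one hx _ _)

theorem norm_tail_le (hx : ‖x‖ ≤ 1) : ‖fun i : Fin m => x i.succ‖ ≤ 1 :=
  (pi_norm_le_iff_of_nonneg zero_le_one).2 fun i => (norm_le_pi_norm x i.succ).trans hx

variable [∀ i, IsUltrametricDist (K i)] [∀ i, Algebra ℤ_[p] (K i)]
  [∀ i, IsScalarTower ℤ_[p] ℚ_[p] (K i)]

/-- The first coordinate is normalized on `E`, the others on the kernel of the first projection. -/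
def flagIdeals (K : Fin (m + 1) → Type*) [∀ i, NormedField (K i)] (i : Fin (m + 1)) :
    Set (∀ i, K i) :=
  {e | i ≠ 0 → e 0 = 0}

theorem admissible_flagIdeals : Admissible (flagIdeals K) where
  isClosed i := by
    by_cases hi : i = 0
    · have : flagIdeals K i = Set.univ := Set.eq_univ_of_forall fun e h => absurd hi h
      rw [this]
      exact isClosed_univ
    · have : flagIdeals K i = {e | e 0 = 0} := by
        ext e
        exact ⟨fun h => h hi, fun h _ => h⟩
      rw [this]
      exact isClosed_eq (continuous_apply 0) continuous_const
  exists_ne i := ⟨Pi.single i 1, fun hi => Pi.single_eq_of_ne (Ne.symm hi) 1, by simp⟩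
  mul_mem i u e he hi := by rw [Pi.mul_apply, he hi, mul_zero]

/-- `flagIdeals` is chosen for this splitting: normalization becomes one condition on the kernel of
the first projection and one on its image, so lattices can be counted over pairs (kernel, image). -/
theorem mem_normalized_flagIdeals {n n' : ℕ} (hs : Sep (p := p) d x) (hx : ‖x‖ ≤ 1)
    (hn : Fintype.card (Node p K) = n)
    (hn' : Fintype.card (Node p fun i : Fin m => K i.succ) = n')
    (M : Submodule ℤ_[p] (∀ i, K i)) : M ∈ normalized p x (flagIdeals K) ↔
      (∀ e ∈ M, x * e ∈ M) ∧ M.comap (consZero p K) ∈ NormLat p (fun i : Fin m => x i.succ) ∧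
        M.map (headMap p K) ∈ NormLat1 p (x 0) := by
  constructor
  · rintro ⟨h1, -, h3⟩
    refine ⟨h1, ⟨?_, ?_, ?_⟩, ?_, ?_, ?_⟩
    · intro e he
      have : consZero p K ((fun i : Fin m => x i.succ) * e) = x * consZero p K e := by
        ext i
        refine Fin.cases ?_ (fun j => rfl) i
        rw [consZero_zero, Pi.mul_apply, consZero_zero, mul_zero]
      rw [Submodule.mem_comap, this]
      exact h1 _ he
    · intro e he
      refine (pi_norm_le_iff_of_nonneg zero_le_one).2 fun i => ?_
      exact (h3 i.succ).2 ⟨consZero p K e, ⟨he, fun _ => rfl⟩, rfl⟩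
    · intro i
      obtain ⟨e, ⟨he, he0⟩, he1⟩ := (h3 i.succ).1
      have h0 := he0 (Fin.succ_ne_zero i)
      refine ⟨fun i => e i.succ, ?_, he1⟩
      rwa [Submodule.mem_comap, ← eq_consZero_of_head h0]
    · rintro _ ⟨e, he, rfl⟩
      exact ⟨x * e, h1 e he, rfl⟩
    · rintro _ ⟨e, he, rfl⟩
      exact (h3 0).2 ⟨e, ⟨he, fun h => absurd rfl h⟩, rfl⟩
    · obtain ⟨e, ⟨he, -⟩, he1⟩ := (h3 0).1
      exact ⟨e 0, ⟨e, he, rfl⟩, he1⟩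
  · rintro ⟨h1, h2, h3⟩
    refine ⟨h1, isLattice_of_comap_map (NormLat.isLattice (hs.tail hx) (norm_tail_le hx) hn' h2)
      (hs.isLattice_normLat1 hx hn h3), ?_⟩
    refine Fin.cases ⟨?_, ?_⟩ fun i => ⟨?_, ?_⟩
    · obtain ⟨_, ⟨e, he, rfl⟩, he1⟩ := h3.2.2
      exact ⟨e, ⟨he, fun h => absurd rfl h⟩, he1⟩
    · rintro _ ⟨e, ⟨he, -⟩, rfl⟩
      exact h3.2.1 _ ⟨e, he, rfl⟩
    · obtain ⟨e, he, hei⟩ := h2.2.2 i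
      exact ⟨consZero p K e, ⟨he, fun _ => rfl⟩, hei⟩
    · rintro _ ⟨e, ⟨he, he0⟩, rfl⟩
      have h0 := he0 (Fin.succ_ne_zero i)
      have he' : (fun i : Fin m => e i.succ) ∈ M.comap (consZero p K) := by
        rwa [Submodule.mem_comap, ← eq_consZero_of_head h0]
      exact (norm_le_pi_norm (fun i : Fin m => e i.succ) i).trans (h2.2.1 _ he')

/-- The recursion for the number of normalized stable lattices. -/
theorem ncard_normLat_succ (hs : Sep (p := p) d x) (hx : ‖x‖ ≤ 1) :
    ((NormLat p x).ncard : ℝ) * crossRes p x =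
      (NormLat p fun i : Fin m => x i.succ).ncard * (NormLat1 p (x 0)).ncard := by
  classical
  have hmem := mem_normalized_flagIdeals hs hx rfl rfl
  have hst := hs.tail hx
  have hxt := norm_tail_le hx
  obtain ⟨h1, h2⟩ := ncard_normalized_eq (p := p) x admissible_univ admissible_flagIdeals
  rw [← normLat_eq_normalized hs hx rfl] at h1 h2
  have hfin := h2 (NormLat.finite hs hx rfl)
  have hfint := NormLat.finite hst hxt rfl
  have hfin0 := hs.finite_normLat1 hx rfl 0
  rw [h1, Set.ncard_eq_toFinset_card _ hfin, Set.ncard_eq_toFinset_card _ hfint,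
    Set.ncard_eq_toFinset_card _ hfin0,
    Finset.card_eq_sum_card_fiberwise (t := hfint.toFinset ×ˢ hfin0.toFinset)
      (f := fun M => (M.comap (consZero p K), M.map (headMap p K)))
      (fun M hM => by
        have := (hmem M).1 (hfin.mem_toFinset.1 hM)
        exact Finset.mem_product.2 ⟨hfint.mem_toFinset.2 this.2.1, hfin0.mem_toFinset.2 this.2.2⟩),
    Nat.cast_sum, Finset.sum_mul]
  have key : ∀ t ∈ hfint.toFinset ×ˢ hfin0.toFinset,
      ((hfin.toFinset.filter
        fun M => (M.comap (consZero p K), M.map (headMap p K)) = t).card : ℝ) *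
          crossRes p x = 1 := by
    rintro ⟨M₁, M₂⟩ ht
    obtain ⟨hM₁, hM₂⟩ := Finset.mem_product.1 ht
    replace hM₁ := hfint.mem_toFinset.1 hM₁
    replace hM₂ := hfin0.mem_toFinset.1 hM₂
    have hset : ((hfin.toFinset.filter
        fun M => (M.comap (consZero p K), M.map (headMap p K)) = (M₁, M₂)) :
          Set (Submodule ℤ_[p] (∀ i, K i))) = fiberSet x M₁ M₂ := by
      ext M
      rw [Finset.coe_filter, Set.mem_ofPred_eq, hfin.mem_toFinset, hmem, Prod.mk.injEq]
      constructor
      · rintro ⟨⟨h, -, -⟩, h', h''⟩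
        exact ⟨h, h', h''⟩
      · rintro ⟨h, h', h''⟩
        exact ⟨⟨h, h' ▸ hM₁, h'' ▸ hM₂⟩, h', h''⟩
    rw [← Set.ncard_coe_finset, hset]
    exact ncard_fiberSet (hs.injective hx) (NormLat.isLattice hst hxt rfl hM₁)
      (hs.isLattice_normLat1 hx rfl hM₂) hM₁.1 hM₂.1 (hset ▸ Finset.finite_toSet _)
  rw [Finset.sum_congr rfl key, Finset.sum_const, Finset.card_product, nsmul_eq_mul, mul_one,
    Nat.cast_mul]

end Recursion

/-! ### Factorization of the discriminant and the product formula. -/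

section Delta

open Classical in
/-- The distance of two numbers, or `1` if they are equal. -/
def dist1 {F : Type*} [NormedField F] (z w : F) : ℝ := if z = w then 1 else ‖z - w‖

theorem dist1_comm {F : Type*} [NormedField F] (z w : F) : dist1 z w = dist1 w z := by
  by_cases h : z = w
  · rw [h]
  · rw [dist1, dist1, if_neg h, if_neg (Ne.symm h), norm_sub_rev]

theorem dist1_of_ne {F : Type*} [NormedField F] {z w : F} (h : z ≠ w) : dist1 z w = ‖z - w‖ :=
  if_neg h

/-- Squaring makes the product symmetric and removes the ordering; since `dist1 z z = 1`, it can run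
over all pairs. -/
theorem norm_vandermondeProd_sq {F : Type*} [NormedField F] {n : ℕ} {y : Fin n → F}
    (hy : Function.Injective y) : ‖vandermondeProd y‖ ^ 2 = ∏ a, ∏ b, dist1 (y a) (y b) := by
  have h1 : ‖vandermondeProd y‖ = ∏ a, ∏ b ∈ Finset.Ioi a, dist1 (y a) (y b) := by
    rw [vandermondeProd, norm_prod]
    refine Finset.prod_congr rfl fun a _ => ?_
    rw [norm_prod]
    exact Finset.prod_congr rfl fun b hb => (dist1_of_ne (hy.ne (Finset.mem_Ioi.1 hb).ne)).symm
  have h2 := Finset.prod_prod_Ioi_mul_eq_prod_prod_off_diag fun a b : Fin n => dist1 (y a) (y b)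
  rw [h1, sq, ← Finset.prod_mul_distrib]
  refine Eq.trans (Finset.prod_congr rfl fun a _ => ?_) (h2.trans ?_)
  · rw [← Finset.prod_mul_distrib]
    exact Finset.prod_congr rfl fun b _ => by rw [dist1_comm (y a) (y b)]
  · rw [Finset.prod_comm' (t' := Finset.univ) (s' := fun b => {b}ᶜ) (by simp [eq_comm])]
    refine Finset.prod_congr rfl fun a _ => ?_
    rw [← Finset.prod_compl_mul_prod {a}, Finset.prod_singleton, dist1, if_pos rfl, mul_one]

variable {p : ℕ} [Fact p.Prime] {ι : Type*} [Fintype ι] {K : ι → Type*}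
  [∀ i, NormedField (K i)] [∀ i, NormedAlgebra ℚ_[p] (K i)] [∀ i, FiniteDimensional ℚ_[p] (K i)]

/-- The absolute value of the discriminant, as a product over the pairs of conjugates. -/
def deltaSq (p : ℕ) [Fact p.Prime] {K : ι → Type*} [∀ i, NormedField (K i)]
    [∀ i, NormedAlgebra ℚ_[p] (K i)] [∀ i, FiniteDimensional ℚ_[p] (K i)] (x : ∀ i, K i) : ℝ :=
  ∏ a : Node p K, ∏ b : Node p K, dist1 (node x a) (node x b)

theorem norm_deltaSigma_sq {x : ∀ i, K i} (hx : Function.Injective (node (p := p) x)) :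
    ‖deltaSigma p x‖ ^ 2 = deltaSq p x := by
  refine (norm_vandermondeProd_sq fun a b h =>
    (Finite.equivFin (Node p K)).symm.injective (hx h)).trans ?_
  rw [deltaSq, ← (Finite.equivFin (Node p K)).symm.prod_comp]
  refine Finset.prod_congr rfl fun a _ => ?_
  rw [← (Finite.equivFin (Node p K)).symm.prod_comp]

theorem deltaSq_unit {L : Type*} [NormedField L] [NormedAlgebra ℚ_[p] L]
    [FiniteDimensional ℚ_[p] L] (z : L) : deltaSq p (fun _ : Unit => z) =
      ∏ τ : L →ₐ[ℚ_[p]] PadicAlgCl p, ∏ τ' : L →ₐ[ℚ_[p]] PadicAlgCl p, dist1 (τ z) (τ' z) := by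
  rw [deltaSq, Fintype.prod_sigma, Fintype.prod_unique]
  refine Finset.prod_congr rfl fun a _ => ?_
  rw [Fintype.prod_sigma, Fintype.prod_unique]
  rfl

/-- Pairs of conjugates lie within the first factor, within the others, or are mixed; mixed pairs
occur in both orders, hence the square. -/
theorem deltaSq_succ {m : ℕ} {K : Fin (m + 1) → Type*} [∀ i, NormedField (K i)]
    [∀ i, NormedAlgebra ℚ_[p] (K i)] [∀ i, FiniteDimensional ℚ_[p] (K i)] {x : ∀ i, K i}
    (hx : Function.Injective (node (p := p) x)) : deltaSq p x =
      deltaSq p (fun _ : Unit => x 0) * crossRes p x ^ 2 *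
        deltaSq p fun i : Fin m => x i.succ := by
  have hne : ∀ (a : Node p fun i : Fin m => K i.succ) (τ : K 0 →ₐ[ℚ_[p]] PadicAlgCl p),
      a.2 (x a.1.succ) ≠ τ (x 0) := by
    intro a τ h
    have h1 : (⟨a.1.succ, a.2⟩ : Node p K) = ⟨0, τ⟩ := hx h
    exact Fin.succ_ne_zero _ (congrArg Sigma.fst h1)
  have hcross : crossRes p x = ∏ a : Node p fun i : Fin m => K i.succ,
      ∏ τ : K 0 →ₐ[ℚ_[p]] PadicAlgCl p, dist1 (a.2 (x a.1.succ)) (τ (x 0)) :=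
    Finset.prod_congr rfl fun a _ => Finset.prod_congr rfl fun τ _ => (dist1_of_ne (hne a τ)).symm
  have hcross' : crossRes p x = ∏ τ : K 0 →ₐ[ℚ_[p]] PadicAlgCl p,
      ∏ a : Node p fun i : Fin m => K i.succ, dist1 (τ (x 0)) (a.2 (x a.1.succ)) := by
    rw [hcross, Finset.prod_comm]
    exact Finset.prod_congr rfl fun a _ => Finset.prod_congr rfl fun τ _ => dist1_comm _ _
  rw [deltaSq, prod_node_succ, deltaSq_unit]
  have h1 : ∀ c : PadicAlgCl p, ∏ b : Node p K, dist1 c (node x b) =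
      (∏ τ : K 0 →ₐ[ℚ_[p]] PadicAlgCl p, dist1 c (τ (x 0))) *
        ∏ a : Node p fun i : Fin m => K i.succ, dist1 c (a.2 (x a.1.succ)) := fun c =>
    prod_node_succ _
  simp only [h1, Finset.prod_mul_distrib]
  rw [deltaSq, sq]
  nth_rewrite 1 [hcross']
  rw [hcross]
  simp only [node]
  ring

/-- Induction on the number of factors: the mixed part of `deltaSq_succ` is exactly what
`ncard_normLat_succ` absorbs. With no factor the algebra is zero and has a single lattice. -/
theorem ncard_normLat_sq_mul_deltaSq {m : ℕ} {K : Fin m → Type*} [∀ i, NormedField (K i)]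
    [∀ i, NormedAlgebra ℚ_[p] (K i)] [∀ i, FiniteDimensional ℚ_[p] (K i)]
    [∀ i, IsUltrametricDist (K i)] [∀ i, Algebra ℤ_[p] (K i)]
    [∀ i, IsScalarTower ℤ_[p] ℚ_[p] (K i)] {d : ℝ} {x : ∀ i, K i} (hs : Sep (p := p) d x)
    (hx : ‖x‖ ≤ 1) : ((NormLat p x).ncard : ℝ) ^ 2 * deltaSq p x =
      ∏ i, (((NormLat1 p (x i)).ncard : ℝ) ^ 2 * deltaSq p fun _ : Unit => x i) := by
  induction m with
  | zero =>
    have h1 : NormLat p x = {⊥} := by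
      ext M
      rw [Set.mem_singleton_iff]
      exact ⟨fun _ => Subsingleton.elim _ _, fun h => h ▸ ⟨by simp, by simp, fun i => i.elim0⟩⟩
    rw [h1, Set.ncard_singleton, deltaSq]
    simp
  | succ m ih =>
    rw [Fin.prod_univ_succ, ← ih (hs.tail hx) (norm_tail_le hx), deltaSq_succ (hs.injective hx)]
    have := congrArg (· ^ 2) (ncard_normLat_succ hs hx)
    simp only [mul_pow] at this
    linear_combination (deltaSq p (fun _ : Unit => x 0) * deltaSq p fun i : Fin m => x i.succ) * this

theorem ncard_normLat_mul_norm_deltaSigma {m : ℕ} {K : Fin m → Type*} [∀ i, NormedField (K i)]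
    [∀ i, NormedAlgebra ℚ_[p] (K i)] [∀ i, FiniteDimensional ℚ_[p] (K i)]
    [∀ i, IsUltrametricDist (K i)] [∀ i, Algebra ℤ_[p] (K i)]
    [∀ i, IsScalarTower ℤ_[p] ℚ_[p] (K i)] {d : ℝ} {x : ∀ i, K i} (hs : Sep (p := p) d x)
    (hx : ‖x‖ ≤ 1) : ((NormLat p x).ncard : ℝ) * ‖deltaSigma p x‖ =
      ∏ i, (((NormLat1 p (x i)).ncard : ℝ) * ‖deltaSigma p fun _ : Unit => x i‖) := by
  have hinj := hs.injective hx
  have hinj' : ∀ i, Function.Injective (node (p := p) fun _ : Unit => x i) := by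
    rintro i ⟨⟨⟩, σ⟩ ⟨⟨⟩, τ⟩ h
    have h1 : (⟨i, σ⟩ : Node p K) = ⟨i, τ⟩ := hinj h
    simpa using h1
  refine (pow_left_inj₀ (by positivity)
    (Finset.prod_nonneg fun i _ => by positivity) two_ne_zero).1 ?_
  rw [mul_pow, norm_deltaSigma_sq hinj, ncard_normLat_sq_mul_deltaSq hs hx, ← Finset.prod_pow]
  exact Finset.prod_congr rfl fun i _ => by rw [mul_pow, norm_deltaSigma_sq (hinj' i)]

end Delta

end

section

open Metric Polynomial
open scoped ENNReal

/-! ### Uniformizers and orbits of lattices -/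

section LocalField

variable {p : ℕ} [Fact p.Prime] {L : Type*} [NormedField L] [NormedAlgebra ℚ_[p] L]
  [FiniteDimensional ℚ_[p] L] [IsUltrametricDist L] [Algebra ℤ_[p] L]
  [IsScalarTower ℤ_[p] ℚ_[p] L]

theorem mem_integers_iff_norm (y : L) : y ∈ integers p L ↔ ‖y‖ ≤ 1 := by
  rw [mem_integers_iff, NormedAlgebra.norm_eq_spectralNorm ℚ_[p] y]

theorem norm_lt_one_of_mem_maximalIdeal {a : integers p L}
    (ha : a ∈ IsLocalRing.maximalIdeal (integers p L)) : ‖(a : L)‖ < 1 := by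
  have h1 := (mem_integers_iff_norm (a : L)).1 a.2
  refine lt_of_le_of_ne h1 fun h => (IsLocalRing.mem_maximalIdeal a).1 ha ?_
  have h0 : (a : L) ≠ 0 := by
    intro h0
    rw [h0, norm_zero] at h
    exact zero_ne_one h
  refine IsUnit.of_mul_eq_one ⟨(a : L)⁻¹, (mem_integers_iff_norm _).2 ?_⟩ ?_
  · rw [norm_inv, h, inv_one]
  · exact Subtype.ext (mul_inv_cancel₀ h0)

theorem mem_maximalIdeal_of_norm_lt_one {a : integers p L} (ha : ‖(a : L)‖ < 1) :
    a ∈ IsLocalRing.maximalIdeal (integers p L) := by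
  rw [IsLocalRing.mem_maximalIdeal, mem_nonunits_iff]
  rintro ⟨u, rfl⟩
  have h1 : ((u : integers p L) : L) * ((u⁻¹ : (integers p L)ˣ) : integers p L) = 1 := by
    exact_mod_cast congrArg Subtype.val u.mul_inv
  have h2 := congrArg norm h1
  rw [norm_mul, norm_one] at h2
  have h3 := (mem_integers_iff_norm _).1 ((u⁻¹ : (integers p L)ˣ) : integers p L).2
  nlinarith [norm_nonneg ((u : integers p L) : L)]

variable {π : Lˣ} (hπ : IsUniformizer p π)
include hπ

theorem IsUniformizer.norm_lt_one : ‖(π : L)‖ < 1 := by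
  obtain ⟨h, hspan⟩ := hπ
  exact norm_lt_one_of_mem_maximalIdeal (p := p) (a := ⟨(π : L), h⟩)
    (hspan ▸ Ideal.subset_span (Set.mem_singleton _))

theorem IsUniformizer.norm_pos : 0 < ‖(π : L)‖ := norm_pos_iff.2 π.ne_zero

theorem IsUniformizer.norm_le {y : L} (hy : ‖y‖ < 1) : ‖y‖ ≤ ‖(π : L)‖ := by
  obtain ⟨h, hspan⟩ := hπ
  have h1 := mem_maximalIdeal_of_norm_lt_one (p := p)
    (a := ⟨y, (mem_integers_iff_norm y).2 hy.le⟩) hy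
  rw [← hspan, Ideal.mem_span_singleton] at h1
  obtain ⟨c, hc⟩ := h1
  have h2 : y = π * (c : L) := congrArg Subtype.val hc
  rw [h2, norm_mul]
  exact mul_le_of_le_one_right (norm_nonneg _) ((mem_integers_iff_norm _).1 c.2)

theorem IsUniformizer.exists_zpow {y : L} (hy : y ≠ 0) : ∃ k : ℤ, ‖y‖ = ‖(π : L)‖ ^ k := by
  have h0 := hπ.norm_pos
  have h1 := hπ.norm_lt_one
  obtain ⟨n, hn1, hn2⟩ := exists_mem_Ico_zpow (x := ‖y‖⁻¹) (y := ‖(π : L)‖⁻¹)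
    (inv_pos.2 (norm_pos_iff.2 hy)) ((one_lt_inv₀ h0).2 h1)
  refine ⟨n, ?_⟩
  rw [inv_zpow] at hn1 hn2
  have h3 := (inv_le_inv₀ (zpow_pos h0 n) (norm_pos_iff.2 hy)).1 hn1
  have h4 := (inv_lt_inv₀ (norm_pos_iff.2 hy) (zpow_pos h0 _)).1 hn2
  refine h3.antisymm (not_lt.1 fun h5 => ?_)
  have h6 : ‖y / (π : L) ^ n‖ < 1 := by
    rw [norm_div, norm_zpow]
    exact (div_lt_one (zpow_pos h0 n)).2 h5
  have h7 := hπ.norm_le h6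
  rw [norm_div, norm_zpow, div_le_iff₀ (zpow_pos h0 n), ← zpow_one_add₀ h0.ne'] at h7
  rw [add_comm] at h4
  exact h4.not_ge h7

theorem IsUniformizer.mem_maximalIdeal_pow (a : integers p L) (n : ℕ) :
    a ∈ IsLocalRing.maximalIdeal (integers p L) ^ n ↔ ‖(a : L)‖ ≤ ‖(π : L)‖ ^ n := by
  have h0 := hπ.norm_pos
  obtain ⟨h, hspan⟩ := hπ
  rw [← hspan, Ideal.span_singleton_pow, Ideal.mem_span_singleton]
  constructor
  · rintro ⟨c, rfl⟩
    rw [Subalgebra.coe_mul, Subalgebra.coe_pow, norm_mul, norm_pow]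
    exact mul_le_of_le_one_right (by positivity) ((mem_integers_iff_norm _).1 c.2)
  · intro h1
    refine ⟨⟨(a : L) / (π : L) ^ n, (mem_integers_iff_norm _).2 ?_⟩, Subtype.ext ?_⟩
    · rw [norm_div, norm_pow]
      exact (div_le_one (by positivity)).2 h1
    · change (a : L) = (π : L) ^ n * ((a : L) / (π : L) ^ n)
      rw [mul_div_cancel₀ _ (pow_ne_zero n π.ne_zero)]

/-- Membership of `p` in powers of the maximal ideal is read off from absolute values, so the
ramification index is the exponent `k` with `‖p‖ = ‖π‖ ^ k`. -/
theorem IsUniformizer.norm_pow_ramIndex :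
    ramIndex p L ≠ 0 ∧ ‖(π : L)‖ ^ ramIndex p L = (p : ℝ)⁻¹ := by
  have h0 := hπ.norm_pos
  have h1 := hπ.norm_lt_one
  have hp0 : (algebraMap ℤ_[p] L p) ≠ 0 := by
    rw [IsScalarTower.algebraMap_apply ℤ_[p] ℚ_[p] L]
    refine (_root_.map_ne_zero (algebraMap ℚ_[p] L)).2 ?_
    simpa using (Fact.out : p.Prime).ne_zero
  have hpn : ‖algebraMap ℤ_[p] L p‖ = (p : ℝ)⁻¹ := by
    rw [IsScalarTower.algebraMap_apply ℤ_[p] ℚ_[p] L, norm_algebraMap']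
    exact Padic.norm_p
  have hp1 : (p : ℝ)⁻¹ < 1 := inv_lt_one_of_one_lt₀ (by exact_mod_cast (Fact.out : p.Prime).one_lt)
  obtain ⟨k, hk⟩ := hπ.exists_zpow hp0
  rw [hpn] at hk
  have hk0 : 0 < k := by
    by_contra h
    rw [hk] at hp1
    exact hp1.not_ge (one_le_zpow_of_nonpos₀ h0 h1.le (not_lt.1 h))
  lift k to ℕ using hk0.le
  rw [zpow_natCast] at hk
  have key : ∀ n, (IsLocalRing.maximalIdeal ℤ_[p]).map (algebraMap ℤ_[p] (integers p L)) ≤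
      IsLocalRing.maximalIdeal (integers p L) ^ n ↔ n ≤ k := by
    intro n
    rw [PadicInt.maximalIdeal_eq_span_p, Ideal.map_span, Set.image_singleton,
      Ideal.span_singleton_le_iff_mem, hπ.mem_maximalIdeal_pow]
    change ‖algebraMap ℤ_[p] L p‖ ≤ _ ↔ _
    rw [hpn, hk, pow_le_pow_iff_right_of_lt_one₀ h0 h1]
  have he : ramIndex p L = k :=
    Ideal.ramificationIdx'_spec ((key k).2 le_rfl) (mt (key (k + 1)).1 (by omega))
  rw [he]
  exact ⟨by omega, hk.symm⟩

theorem IsUniformizer.norm_eq_rpow : ‖(π : L)‖ = (p : ℝ) ^ (-(1 / (ramIndex p L : ℝ))) := by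
  obtain ⟨h1, h2⟩ := hπ.norm_pow_ramIndex
  have hp : (0 : ℝ) ≤ p := by positivity
  rw [Real.rpow_neg hp, ← Real.inv_rpow hp, ← h2, one_div,
    Real.pow_rpow_inv_natCast (norm_nonneg _) h1]

theorem IsUniformizer.norm_pow_eq_rpow (k : ℕ) :
    ‖(π : L)‖ ^ k = (p : ℝ) ^ (-((k : ℝ) / (ramIndex p L : ℝ))) := by
  rw [hπ.norm_eq_rpow, ← Real.rpow_natCast, ← Real.rpow_mul (by positivity)]
  congr 1
  ring

variable [MeasurableSpace L] [BorelSpace L] [SecondCountableTopology L]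

theorem IsUniformizer.measure_norm_le (ν : Measure L) [ν.IsAddHaarMeasure] (k : ℕ) :
    ν {e | ‖e‖ ≤ ‖(π : L)‖ ^ k} =
      ENNReal.ofReal (‖(π : L)‖ ^ (k * Module.finrank ℚ_[p] L)) * ν {e | ‖e‖ ≤ 1} := by
  have hk : (π : L) ^ k ≠ 0 := pow_ne_zero _ π.ne_zero
  have h1 : {e : L | ‖e‖ ≤ ‖(π : L)‖ ^ k} = (fun e => (π : L) ^ k * e) '' {e | ‖e‖ ≤ 1} := by
    ext e
    constructor
    · intro he
      refine ⟨e / (π : L) ^ k, ?_, mul_div_cancel₀ _ hk⟩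
      rw [Set.mem_ofPred_eq, norm_div, norm_pow]
      exact (div_le_one (pow_pos hπ.norm_pos k)).2 he
    · rintro ⟨e, he, rfl⟩
      rw [Set.mem_ofPred_eq, norm_mul, norm_pow]
      exact mul_le_of_le_one_right (by positivity) he
  rw [h1, measure_mul_image (p := p) ν hk, norm_pow, ← pow_mul]

/-- No absolute value lies strictly between `‖π‖` and `1`, so the units are the unit ball minus the
ball of radius `‖π‖`. -/
theorem IsUniformizer.measure_norm_eq_one (ν : Measure L) [ν.IsAddHaarMeasure] :
    ν {e | ‖e‖ = 1} =
      ENNReal.ofReal (1 - ‖(π : L)‖ ^ Module.finrank ℚ_[p] L) * ν {e | ‖e‖ ≤ 1} := by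
  have hprop : ProperSpace L := FiniteDimensional.proper ℚ_[p] L
  have h1 : {e : L | ‖e‖ = 1} = {e | ‖e‖ ≤ 1} \ {e | ‖e‖ ≤ ‖(π : L)‖ ^ 1} := by
    ext e
    rw [pow_one]
    constructor
    · intro he
      have he' : ‖e‖ = 1 := he
      refine ⟨he'.le, fun h => ?_⟩
      have h' : ‖e‖ ≤ ‖(π : L)‖ := h
      linarith [hπ.norm_lt_one]
    · rintro ⟨h2, h3⟩
      exact le_antisymm h2 (not_lt.1 fun h => h3 (hπ.norm_le h))
  have h2 : {e : L | ‖e‖ ≤ ‖(π : L)‖ ^ 1} ⊆ {e | ‖e‖ ≤ 1} := fun e he =>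
    le_trans (show ‖e‖ ≤ _ from he) ((pow_one _).trans_le hπ.norm_lt_one.le)
  have h3 : ν {e : L | ‖e‖ ≤ 1} ≠ ∞ := by
    have : {e : L | ‖e‖ ≤ 1} = closedBall 0 1 := by ext e; simp
    rw [this]
    exact (isCompact_closedBall 0 1).measure_ne_top
  rw [h1, measure_sdiff h2 (isClosed_le continuous_norm continuous_const).nullMeasurableSet
    (ne_top_of_le_ne_top h3 (measure_mono h2)), hπ.measure_norm_le ν 1, one_mul,
    ENNReal.ofReal_sub _ (by positivity), ENNReal.ofReal_one, ENNReal.sub_mul fun _ _ => h3,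
    one_mul]

end LocalField

/-! ### Orbits of lattices under powers of a uniformizer. -/

section Orbits

variable {p : ℕ} [Fact p.Prime] {L : Type*} [NormedField L] [NormedAlgebra ℚ_[p] L]
  [FiniteDimensional ℚ_[p] L] [IsUltrametricDist L] [Algebra ℤ_[p] L]
  [IsScalarTower ℤ_[p] ℚ_[p] L] {x : L}

/-- A lattice stable under `x`, as a module over `ℤ_p[x]`. -/
def toAdjoin {M : Submodule ℤ_[p] L} (hM : ∀ e ∈ M, x * e ∈ M) :
    Submodule (Algebra.adjoin ℤ_[p] {x}) L where
  carrier := M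
  add_mem' := M.add_mem
  zero_mem' := M.zero_mem
  smul_mem' c e he := by
    obtain ⟨c, hc⟩ := c
    change c * e ∈ M
    induction hc using Algebra.adjoin_induction generalizing e with
    | mem y hy => exact Set.mem_singleton_iff.1 hy ▸ hM e he
    | algebraMap a => exact Algebra.smul_def a e ▸ M.smul_mem a he
    | add y z _ _ h1 h2 => exact add_mul y z e ▸ M.add_mem (h1 e he) (h2 e he)
    | mul y z _ _ h1 h2 => exact (mul_assoc y z e).symm ▸ h1 _ (h2 e he)

theorem mul_mem_of_mem_adjoin (N : Submodule (Algebra.adjoin ℤ_[p] {x}) L) {e : L} (he : e ∈ N) :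
    x * e ∈ N :=
  N.smul_mem ⟨x, Algebra.subset_adjoin (Set.mem_singleton x)⟩ he

theorem exists_norm_max (M : Submodule ℤ_[p] L) [hM : Submodule.IsLattice ℚ_[p] M] :
    ∃ u ∈ M, u ≠ 0 ∧ ∀ e ∈ M, ‖e‖ ≤ ‖u‖ := by
  have hprop : ProperSpace L := FiniteDimensional.proper ℚ_[p] L
  obtain ⟨ε, C, hε, h1, h2⟩ := bounds_of_isLattice M
  have hclosed : IsClosed (M : Set L) :=
    AddSubgroup.isClosed_of_isOpen M.toAddSubgroup (isOpen_of_isLattice hM)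
  have hcomp : IsCompact (M : Set L) := (isCompact_closedBall (0 : L) C).of_isClosed_subset hclosed
    fun e he => mem_closedBall_zero_iff.2 (h2 e he)
  obtain ⟨u, hu, hmax⟩ := hcomp.exists_isMaxOn ⟨0, M.zero_mem⟩ continuous_norm.continuousOn
  refine ⟨u, hu, ?_, fun e he => hmax he⟩
  rintro rfl
  obtain ⟨c, hc0, -, hc⟩ := exists_padic_norm_mul_le p (C := 1) hε
  have h3 : ‖algebraMap ℚ_[p] L c‖ ≤ ‖(0 : L)‖ :=
    hmax (h1 _ (by rw [norm_algebraMap']; simpa using hc))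
  rw [norm_zero, norm_algebraMap', norm_le_zero_iff] at h3
  exact hc0 h3

variable {π : Lˣ} (hπ : IsUniformizer p π)
include hπ

/-- The largest absolute value of an element of a lattice is a power of `‖π‖`, and exactly one power
of `π` brings it to `1`; so each orbit has a unique normalized member. -/
theorem card_latticeOrbits (hfin : (NormLat1 p x).Finite)
    (hlat : ∀ M ∈ NormLat1 p x, Submodule.IsLattice ℚ_[p] M) :
    Finite (LatticeOrbits p π x) ∧
      Nat.card (LatticeOrbits p π x) = (NormLat1 p x).ncard := by
  let f : NormLat1 p x → LatticeOrbits p π x := fun M =>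
    Quotient.mk'' ⟨toAdjoin M.2.1, hlat M.1 M.2⟩
  have hf : Function.Bijective f := by
    constructor
    · rintro ⟨M, hM⟩ ⟨M', hM'⟩ h
      obtain ⟨⟨_, k, rfl⟩, hg⟩ := Quotient.exact h
      have hg' : ∀ e, e ∈ M ↔ ∃ f ∈ M', ((π ^ k : Lˣ) : L) * f = e := fun e =>
        (Iff.of_eq (congrArg (fun N : LatticeMod p x => e ∈ N.1) hg.symm))
      have hk : ‖(π : L)‖ ^ k = 1 := by
        refine le_antisymm ?_ ?_
        · obtain ⟨e, he, he1⟩ := hM'.2.2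
          have h1 := hM.2.1 _ ((hg' _).2 ⟨e, he, rfl⟩)
          rwa [norm_mul, he1, mul_one, Units.val_zpow_eq_zpow_val, norm_zpow] at h1
        · obtain ⟨e, he, he1⟩ := hM.2.2
          obtain ⟨f, hf, rfl⟩ := (hg' e).1 he
          rw [norm_mul, Units.val_zpow_eq_zpow_val, norm_zpow] at he1
          rw [← he1]
          exact mul_le_of_le_one_right (zpow_nonneg (norm_nonneg _) k) (hM'.2.1 f hf)
      have hk0 : k = 0 := by
        refine (zpow_eq_one_iff_right₀ (norm_nonneg _) hπ.norm_lt_one.ne).1 hk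
      subst hk0
      refine Subtype.ext (Submodule.ext fun e => (hg' e).trans ?_)
      simp
    · intro q
      obtain ⟨⟨N, hN⟩, rfl⟩ := Quotient.exists_rep q
      obtain ⟨u, huN, hu0, hmax⟩ := exists_norm_max (N.restrictScalars ℤ_[p])
      obtain ⟨k, hk⟩ := hπ.exists_zpow hu0
      let N' : LatticeMod p x := (π ^ (-k) : Lˣ) • ⟨N, hN⟩
      have hn : ‖((π ^ (-k) : Lˣ) : L)‖ = ‖u‖⁻¹ := by
        rw [Units.val_zpow_eq_zpow_val, norm_zpow, hk, zpow_neg]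
      have hu : 0 < ‖u‖ := norm_pos_iff.2 hu0
      have hmem : N'.1.restrictScalars ℤ_[p] ∈ NormLat1 p x := by
        refine ⟨fun e he => mul_mem_of_mem_adjoin N'.1 he, ?_, ?_⟩
        · rintro _ ⟨e, he, rfl⟩
          change ‖((π ^ (-k) : Lˣ) : L) * e‖ ≤ 1
          rw [norm_mul, hn, inv_mul_le_iff₀ hu, mul_one]
          exact hmax e he
        · refine ⟨((π ^ (-k) : Lˣ) : L) * u, ⟨u, huN, rfl⟩, ?_⟩
          rw [norm_mul, hn, inv_mul_cancel₀ hu.ne']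
      refine ⟨⟨_, hmem⟩, Quotient.sound ⟨⟨π ^ (-k), Subgroup.zpow_mem_zpowers π _⟩, ?_⟩⟩
      rfl
  have : Finite (NormLat1 p x) := hfin
  refine ⟨Finite.of_surjective f hf.2, ?_⟩
  rw [← Nat.card_eq_of_bijective f hf, Nat.card_coe_set_eq]

end Orbits

end

section

open Metric Polynomial
open scoped ENNReal

/-! ### The Haar measure on integral matrices -/

section HaarMatrix

variable {p : ℕ} [Fact p.Prime] {n : ℕ}

/-- The inclusion of the integral matrices, as a group homomorphism. -/
def coeMat (p n : ℕ) [Fact p.Prime] :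
    Matrix (Fin n) (Fin n) ℤ_[p] →+ Matrix (Fin n) (Fin n) ℚ_[p] :=
  (PadicInt.Coe.ringHom (p := p)).mapMatrix.toAddMonoidHom

theorem range_coeMat : Set.range (coeMat p n) = Mat0 p n := by
  ext A
  constructor
  · rintro ⟨A, rfl⟩ i j
    exact (A i j).2
  · intro hA
    obtain ⟨A0, hA0⟩ := exists_lift_mat hA
    exact ⟨A0, hA0⟩

theorem isOpenEmbedding_coeMat : Topology.IsOpenEmbedding (coeMat p n) := by
  have h1 : Topology.IsEmbedding fun (A : Fin n → Fin n → ℤ_[p]) (i j : Fin n) =>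
      ((A i j : ℤ_[p]) : ℚ_[p]) :=
    Topology.IsEmbedding.piMap fun _ => Topology.IsEmbedding.piMap fun _ =>
      PadicInt.isOpenEmbedding_coe.isEmbedding
  refine ⟨h1, ?_⟩
  rw [range_coeMat]
  exact isOpen_Mat0

theorem isOpen_norm_lt_one : IsOpen {a : ℤ_[p] | ‖a‖ < 1} :=
  isOpen_lt continuous_norm continuous_const

instance instCompactSpaceMatInt : CompactSpace (Matrix (Fin n) (Fin n) ℤ_[p]) :=
  inferInstanceAs (CompactSpace (Fin n → Fin n → ℤ_[p]))

variable [MeasurableSpace (Matrix (Fin n) (Fin n) ℤ_[p])]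
  [BorelSpace (Matrix (Fin n) (Fin n) ℤ_[p])] (P : Measure (Matrix (Fin n) (Fin n) ℤ_[p]))
  [P.IsAddHaarMeasure] [IsProbabilityMeasure P]

/-- The Haar probability measure on the integral matrices is the restriction of the Haar measure
on all matrices. -/
theorem measure_eq_volume (S : Set (Matrix (Fin n) (Fin n) ℚ_[p])) :
    P {A | A.map PadicInt.Coe.ringHom ∈ S} = volume (Mat0 p n ∩ S) := by
  have hemb := isOpenEmbedding_coeMat (p := p) (n := n)
  let μ := (volume : Measure (Matrix (Fin n) (Fin n) ℚ_[p])).comap (coeMat p n)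
  have hadd : MeasurableAdd (Matrix (Fin n) (Fin n) ℚ_[p]) := ContinuousAdd.measurableAdd
  have hμ : μ.IsAddHaarMeasure := Measure.IsAddHaarMeasure.comap (mH := hadd) _ hemb
  have hcomap : ∀ T, μ T = volume (coeMat p n '' T) := hemb.measurableEmbedding.comap_apply _
  have hprob : IsProbabilityMeasure μ := ⟨by
    rw [hcomap, Set.image_univ, range_coeMat, volume_Mat0]⟩
  rw [Measure.isAddHaarMeasure_eq_of_isProbabilityMeasure P μ, hcomap]
  congr 1
  change coeMat p n '' (coeMat p n ⁻¹' S) = _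
  rw [Set.image_preimage_eq_range_inter, range_coeMat]

theorem isUnit_toZMod_iff (a : ℤ_[p]) : PadicInt.toZMod a ≠ 0 ↔ ‖a‖ = 1 := by
  rw [Ne, ← RingHom.mem_ker, PadicInt.ker_toZMod, IsLocalRing.mem_maximalIdeal, mem_nonunits_iff,
    not_not, PadicInt.isUnit_iff]

/-- Each factor `p ^ n - p ^ i` of the order of `GL_n(𝔽_p)` is divided by `p ^ n`, with `k = n - i`.
-/
theorem cast_card_GL (p n : ℕ) [Fact p.Prime] :
    ((∏ i : Fin n, (p ^ n - p ^ (i : ℕ)) : ℕ) : ℝ) =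
      (∏ k ∈ Finset.Icc 1 n, (1 - ((p : ℝ) ^ k)⁻¹)) * ((p ^ n) ^ n : ℕ) := by
  have hp : (p : ℝ) ≠ 0 := by exact_mod_cast (Fact.out : p.Prime).ne_zero
  have h1 : ∏ k ∈ Finset.Icc 1 n, (1 - ((p : ℝ) ^ k)⁻¹) =
      ∏ i ∈ Finset.range n, (1 - ((p : ℝ) ^ (n - i))⁻¹) := by
    refine Finset.prod_nbij' (fun k => n - k) (fun i => n - i) ?_ ?_ ?_ ?_ ?_
    · intro k hk
      rw [Finset.mem_Icc] at hk
      exact Finset.mem_range.2 (by omega)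
    · intro i hi
      rw [Finset.mem_range] at hi
      exact Finset.mem_Icc.2 (by omega)
    · intro k hk
      exact Nat.sub_sub_self (Finset.mem_Icc.1 hk).2
    · intro i hi
      exact Nat.sub_sub_self (Finset.mem_range.1 hi).le
    · intro k hk
      rw [Nat.sub_sub_self (Finset.mem_Icc.1 hk).2]
  rw [h1, Finset.prod_range fun i => 1 - ((p : ℝ) ^ (n - i))⁻¹, Nat.cast_prod, Nat.cast_pow]
  have h2 : ((p ^ n : ℕ) : ℝ) ^ n = ∏ _i : Fin n, (p : ℝ) ^ n := by simp
  rw [h2, ← Finset.prod_mul_distrib]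
  refine Finset.prod_congr rfl fun i _ => ?_
  rw [Nat.cast_sub (Nat.pow_le_pow_right (Fact.out : p.Prime).pos i.2.le), Nat.cast_pow,
    Nat.cast_pow, sub_mul, one_mul, inv_mul_eq_div, pow_sub₀ _ hp i.2.le]
  field_simp

/-- The measure of `GL_n(ℤ_p)`. -/
theorem measure_norm_det_eq_one : P {A | ‖A.det‖ = 1} =
    ENNReal.ofReal (∏ k ∈ Finset.Icc 1 n, (1 - ((p : ℝ) ^ k)⁻¹)) := by
  classical
  have hp : (0 : ℝ) < p := by exact_mod_cast (Fact.out : p.Prime).pos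
  let f : Matrix (Fin n) (Fin n) ℤ_[p] →+* Matrix (Fin n) (Fin n) (ZMod p) :=
    (PadicInt.toZMod (p := p)).mapMatrix
  have hf : Function.Surjective f := by
    intro B
    choose a ha using fun i j => ZMod.ringHom_surjective (PadicInt.toZMod (p := p)) (B i j)
    exact ⟨Matrix.of a, Matrix.ext ha⟩
  have hker : ∀ A, f A = 0 ↔ ∀ i j, ‖A i j‖ < 1 := by
    intro A
    rw [← Matrix.ext_iff]
    refine forall_congr' fun i => forall_congr' fun j => ?_
    change PadicInt.toZMod (A i j) = 0 ↔ _
    rw [← not_iff_not, ← Ne, isUnit_toZMod_iff, not_lt]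
    exact ⟨fun h => h.ge, fun h => (PadicInt.norm_le_one _).antisymm h⟩
  have hopen : IsOpen (f ⁻¹' {0}) := by
    have : f ⁻¹' {0} = ⋂ i, ⋂ j, (fun A : Matrix (Fin n) (Fin n) ℤ_[p] => A i j) ⁻¹'
        {a | ‖a‖ < 1} := by
      ext A
      simp [hker]
    rw [this]
    exact isOpen_iInter_of_finite fun i => isOpen_iInter_of_finite fun j =>
      isOpen_norm_lt_one.preimage (continuous_id.matrix_elem i j)
  -- The fibres of reduction modulo `p` are translates of its open kernel, so the reduced matrix is
  -- uniformly distributed, and the event is that it is invertible.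
  have hfib : ∀ B, MeasurableSet (f ⁻¹' {B}) ∧ P (f ⁻¹' {B}) = P (f ⁻¹' {0}) := by
    intro B
    obtain ⟨A0, rfl⟩ := hf B
    have : f ⁻¹' {f A0} = (fun A => -A0 + A) ⁻¹' (f ⁻¹' {0}) := by
      ext A
      rw [Set.mem_preimage, Set.mem_preimage, Set.mem_preimage, Set.mem_singleton_iff,
        Set.mem_singleton_iff, map_add, map_neg, neg_add_eq_zero, eq_comm]
    rw [this]
    exact ⟨(hopen.preimage (continuous_const.add continuous_id)).measurableSet,
      measure_preimage_add _ _ _⟩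
  have hsum : ∀ T : Finset (Matrix (Fin n) (Fin n) (ZMod p)),
      P (f ⁻¹' (T : Set (Matrix (Fin n) (Fin n) (ZMod p)))) = T.card * P (f ⁻¹' {0}) := by
    intro T
    have : f ⁻¹' (T : Set (Matrix (Fin n) (Fin n) (ZMod p))) = ⋃ B ∈ T, f ⁻¹' {B} := by
      ext A
      simp
    rw [this, measure_biUnion_finset _ fun B _ => (hfib B).1,
      Finset.sum_congr rfl fun B _ => (hfib B).2, Finset.sum_const, nsmul_eq_mul]
    intro B _ B' _ hBB'
    exact Set.disjoint_left.2 fun A hA hA' => hBB' (Eq.trans (Eq.symm hA) hA')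
  have h1 := hsum Finset.univ
  have hcard : Fintype.card (Matrix (Fin n) (Fin n) (ZMod p)) = (p ^ n) ^ n := by
    change Fintype.card (Fin n → Fin n → ZMod p) = _
    simp [ZMod.card]
  rw [Finset.coe_univ, Set.preimage_univ, measure_univ, Finset.card_univ, hcard] at h1
  let : Fintype (GL (Fin n) (ZMod p)) := Fintype.ofFinite _
  have h2 := hsum ((Finset.univ : Finset (GL (Fin n) (ZMod p))).image Units.val)
  have h3 : f ⁻¹' (((Finset.univ : Finset (GL (Fin n) (ZMod p))).image Units.val : Finset _) :
      Set (Matrix (Fin n) (Fin n) (ZMod p))) = {A | ‖A.det‖ = 1} := by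
    ext A
    rw [Set.mem_ofPred_eq, ← isUnit_toZMod_iff, ← isUnit_iff_ne_zero, RingHom.map_det,
      ← Matrix.isUnit_iff_isUnit_det]
    simp [IsUnit, f]
  rw [h3, Finset.card_image_of_injective _ Units.val_injective, Finset.card_univ,
    ← Nat.card_eq_fintype_card, Matrix.card_GL_field, ZMod.card] at h2
  rw [h2, ← ENNReal.ofReal_natCast, cast_card_GL, ENNReal.ofReal_mul' (by positivity),
    ENNReal.ofReal_natCast, mul_assoc, ← h1, mul_one]

end HaarMatrix

end

section

open Metric Polynomial
open scoped ENNReal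

/-! ### Discriminants and valuations -/

section Discriminant

variable {p : ℕ} [Fact p.Prime] {ι : Type*} [Fintype ι] {K : ι → Type*}
  [∀ i, NormedField (K i)] [∀ i, NormedAlgebra ℚ_[p] (K i)] [∀ i, FiniteDimensional ℚ_[p] (K i)]
  {x : ∀ i, K i}

/-- A homomorphism from `E` to the algebraic closure is determined by the image of the generator
`x`. Distinct pairs (factor, embedding) give distinct homomorphisms, the idempotents separating the
factors. -/
theorem node_injective (hx : Algebra.adjoin ℚ_[p] {x} = ⊤) :
    Function.Injective (node (p := p) x) := by
  classical
  rintro ⟨i, σ⟩ ⟨j, τ⟩ h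
  have h1 : σ.comp (Pi.evalAlgHom ℚ_[p] K i) = τ.comp (Pi.evalAlgHom ℚ_[p] K j) :=
    AlgHom.ext_of_adjoin_eq_top hx fun y hy => by
      rw [Set.mem_singleton_iff.1 hy]
      exact h
  have h2 : ∀ e : ∀ i, K i, σ (e i) = τ (e j) := fun e => DFunLike.congr_fun h1 e
  obtain rfl : i = j := by
    by_contra hij
    have := h2 (Pi.single i 1)
    rw [Pi.single_eq_same, Pi.single_eq_of_ne (Ne.symm hij), map_one, map_zero] at this
    exact one_ne_zero this
  have h3 : σ = τ := AlgHom.ext fun e => by simpa using h2 (Pi.single i e)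
  rw [h3]

theorem map_prod_minpoly (hx : Function.Injective (node (p := p) x)) :
    (∏ i, minpoly ℚ_[p] (x i)).map (algebraMap ℚ_[p] (PadicAlgCl p)) =
      ∏ a : Node p K, (X - C (node x a)) := by
  classical
  have hmon : (∏ i, minpoly ℚ_[p] (x i)).Monic :=
    monic_prod_of_monic _ _ fun i _ => minpoly.monic (Algebra.IsIntegral.isIntegral (x i))
  have hroot : ∀ a : Node p K, ((∏ i, minpoly ℚ_[p] (x i)).map
      (algebraMap ℚ_[p] (PadicAlgCl p))).IsRoot (node x a) := by
    intro a
    rw [IsRoot, eval_node_map, map_prod, Finset.prod_eq_zero (Finset.mem_univ a.1)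
      (minpoly.aeval _ _), map_zero]
  refine eq_prod_X_sub_C_of_roots (hmon.map _) (le_antisymm ?_ ?_) hx hroot
  · rw [natDegree_map, natDegree_prod_of_monic _ _ fun i _ =>
      minpoly.monic (Algebra.IsIntegral.isIntegral (x i)), card_node,
      Module.finrank_pi_fintype]
    exact Finset.sum_le_sum fun i _ => minpoly.natDegree_le (x i)
  · rw [← Finset.card_univ, ← Finset.card_image_of_injective _ hx]
    refine card_le_degree_of_subset_roots fun z hz => ?_
    obtain ⟨a, -, rfl⟩ := Finset.mem_image.1 hz
    exact (mem_roots (hmon.map _).ne_zero).2 (hroot a)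

-- Up to sign, the discriminant is the resultant of the polynomial and its derivative, that is, the
-- product of the values of the derivative at the roots.
open Classical in
theorem norm_disc (hx : Function.Injective (node (p := p) x)) :
    ‖disc p x‖ = ∏ a : Node p K, ∏ b ∈ Finset.univ.erase a, ‖node x a - node x b‖ := by
  set F := ∏ i, minpoly ℚ_[p] (x i) with hF
  have hmon : F.Monic :=
    monic_prod_of_monic _ _ fun i _ => minpoly.monic (Algebra.IsIntegral.isIntegral (x i))
  have hG := map_prod_minpoly hx
  rw [← hF] at hG
  set G := F.map (algebraMap ℚ_[p] (PadicAlgCl p)) with hGF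
  have hnat : G.natDegree = F.natDegree := natDegree_map _
  -- The relation between resultant and discriminant requires positive degree; otherwise there are
  -- no conjugates.
  rcases Nat.eq_zero_or_pos F.natDegree with h0 | hpos
  · have h1 : F = 1 := hmon.natDegree_eq_zero.1 h0
    have h2 : IsEmpty (Node p K) := by
      have h3 := congrArg natDegree hG
      rw [hnat, h0, natDegree_prod_of_monic _ _ fun a _ => monic_X_sub_C _] at h3
      simp only [natDegree_X_sub_C, Finset.sum_const, smul_eq_mul, mul_one] at h3
      exact Fintype.card_eq_zero_iff.1 h3.symm
    rw [disc, ← hF, h1, ← C_1, discr_C, norm_one]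
    simp
  · have h1 := congrArg (algebraMap ℚ_[p] (PadicAlgCl p))
      (resultant_deriv (natDegree_pos_iff_degree_pos.1 hpos))
    rw [← resultant_map_map, ← derivative_map, ← hGF, ← hnat,
      resultant_eq_prod_eval G _ _ (natDegree_derivative_le G)
        (hG ▸ Splits.prod fun a _ => Splits.X_sub_C _), (hmon.map _).leadingCoeff, one_pow, one_mul,
      hmon.leadingCoeff, mul_one, hnat] at h1
    have h2 := congrArg norm h1
    rw [norm_algebraMap', norm_mul, norm_pow, norm_neg, norm_one, one_pow, one_mul] at h2
    rw [disc, ← hF, ← h2]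
    have h3 : G.roots = (Finset.univ : Finset (Node p K)).val.map (node x) := by
      rw [hG, Polynomial.roots_prod _ _ (Finset.prod_ne_zero_iff.2 fun a _ => X_sub_C_ne_zero _)]
      simp
    rw [h3, Multiset.map_map, Finset.prod_map_val, norm_prod]
    refine Finset.prod_congr rfl fun a _ => ?_
    rw [← norm_prod, Function.comp_apply]
    have h4 : G = Lagrange.nodal Finset.univ (node (p := p) x) := hG
    rw [h4, Lagrange.eval_nodal_derivative_eval_node_eq (Finset.mem_univ a), Lagrange.eval_nodal]

-- Let `q_a` be the product of the distances from the conjugate `z_a` to the others. Then `‖disc‖ =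
-- q_a ∏_{b ≠ a} q_b`, and `q_b ≤ ‖z_a - z_b‖` because its other factors are at most `1`. Hence
-- `‖disc‖ ≤ q_a ^ 2`, which is where the square root comes from.
open Classical in
theorem sep_of_injective (hx : Function.Injective (node (p := p) x)) (hx1 : ‖x‖ ≤ 1) :
    0 < ‖disc p x‖ ∧ ‖disc p x‖ ≤ 1 ∧ Sep (p := p) (√‖disc p x‖) x := by
  have hpos : ∀ a : Node p K, 0 < ∏ b ∈ Finset.univ.erase a, ‖node x a - node x b‖ := fun a =>
    Finset.prod_pos fun b hb => norm_pos_iff.2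
      (sub_ne_zero.2 (hx.ne (Finset.ne_of_mem_erase hb).symm))
  have hle : ∀ a : Node p K, ∏ b ∈ Finset.univ.erase a, ‖node x a - node x b‖ ≤ 1 := fun a =>
    Finset.prod_le_one (fun _ _ => norm_nonneg _) fun _ _ => norm_node_sub_le_one hx1 _ _
  have hd0 : 0 < ‖disc p x‖ := by
    rw [norm_disc hx]
    exact Finset.prod_pos fun a _ => hpos a
  refine ⟨hd0, ?_, Real.sqrt_pos.2 hd0, fun a => ?_⟩
  · rw [norm_disc hx]
    exact Finset.prod_le_one (fun a _ => (hpos a).le) fun a _ => hle a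
  · rw [Real.sqrt_le_iff]
    refine ⟨(hpos a).le, ?_⟩
    rw [norm_disc hx, ← Finset.mul_prod_erase _ _ (Finset.mem_univ a), sq]
    refine mul_le_mul_of_nonneg_left ?_ (hpos a).le
    refine Finset.prod_le_prod (fun b _ => (hpos b).le) fun b hb => ?_
    rw [← Finset.mul_prod_erase _ _ (Finset.mem_erase.2
      ⟨(Finset.ne_of_mem_erase hb).symm, Finset.mem_univ a⟩), norm_sub_rev]
    exact mul_le_of_le_one_right (norm_nonneg _)
      (Finset.prod_le_one (fun _ _ => norm_nonneg _) fun _ _ => norm_node_sub_le_one hx1 _ _)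

/-- These are the two bounds required by `volume_charpoly_small`. With `d = √‖disc‖` and at least
two conjugates, the left side is at most `‖disc‖ ^ 2 = d ^ 4`; with a single conjugate `‖disc‖ = 1`.
-/
theorem norm_disc_pow_le (hx : Function.Injective (node (p := p) x)) (hx1 : ‖x‖ ≤ 1) {n : ℕ}
    (hn : Fintype.card (Node p K) = n + 1) :
    ‖disc p x‖ ^ (n + 1) ≤ √‖disc p x‖ ^ 2 ∧ ‖disc p x‖ ^ (n + 1) ≤ √‖disc p x‖ ^ 3 := by
  classical
  obtain ⟨h0, h1, -⟩ := sep_of_injective hx hx1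
  have hs1 : √‖disc p x‖ ≤ 1 := Real.sqrt_le_one.2 h1
  have hsq : √‖disc p x‖ ^ 2 = ‖disc p x‖ := Real.sq_sqrt h0.le
  refine ⟨by rw [hsq]; exact pow_le_of_le_one h0.le h1 n.succ_ne_zero, ?_⟩
  rcases Nat.eq_zero_or_pos n with rfl | hpos
  · have : ‖disc p x‖ = 1 := by
      rw [norm_disc hx]
      refine Finset.prod_eq_one fun a _ => ?_
      have : (Finset.univ : Finset (Node p K)).erase a = ∅ := by
        rw [← Finset.card_eq_zero, Finset.card_erase_of_mem (Finset.mem_univ a),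
          Finset.card_univ, hn]
      rw [this, Finset.prod_empty]
    rw [this]
    simp
  · calc ‖disc p x‖ ^ (n + 1) ≤ ‖disc p x‖ ^ 2 := pow_le_pow_of_le_one h0.le h1 (by omega)
      _ = (√‖disc p x‖ ^ 2) ^ 2 := by rw [hsq]
      _ = √‖disc p x‖ ^ 4 := by ring
      _ ≤ √‖disc p x‖ ^ 3 := pow_le_pow_of_le_one (Real.sqrt_nonneg _) hs1 (by omega)

theorem deltaSigma_ne_zero (hx : Function.Injective (node (p := p) x)) : deltaSigma p x ≠ 0 := by
  rw [deltaSigma, vandermondeProd]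
  refine Finset.prod_ne_zero_iff.2 fun a _ => Finset.prod_ne_zero_iff.2 fun b hb h => ?_
  have h1 := (Finite.equivFin (Node p K)).symm.injective (hx (sub_eq_zero.1 h))
  exact (Finset.mem_Ioi.1 hb).ne h1

end Discriminant

/-! ### Translation between valuations and absolute values. -/

section Val

variable {p : ℕ} [Fact p.Prime] {L : Type*} [NormedField L] [NormedAlgebra ℚ_[p] L]
  [FiniteDimensional ℚ_[p] L]

theorem absVal_eq_norm (y : L) : absVal p y = ‖y‖ :=
  (NormedAlgebra.norm_eq_spectralNorm ℚ_[p] y).symm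

theorem le_val_iff (y : L) (s : ℝ) : (s : EReal) ≤ val p y ↔ ‖y‖ ≤ (p : ℝ) ^ (-s) := by
  have hp : (1 : ℝ) < p := by exact_mod_cast (Fact.out : p.Prime).one_lt
  by_cases hy : y = 0
  · rw [val, if_pos hy, hy, norm_zero]
    exact ⟨fun _ => by positivity, fun _ => le_top⟩
  · rw [val, if_neg hy, EReal.coe_le_coe_iff, absVal_eq_norm,
      ← Real.logb_le_iff_le_rpow hp (norm_pos_iff.2 hy)]
    exact ⟨fun h => by linarith, fun h => by linarith⟩

theorem rpow_neg_lt_of_val_lt {D : ℚ_[p]} (hD : D ≠ 0) {r : ℕ} {s : ℝ}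
    (h : (r : EReal) * val p D < (s : EReal)) : (p : ℝ) ^ (-s) < ‖D‖ ^ r := by
  have hp : (1 : ℝ) < p := by exact_mod_cast (Fact.out : p.Prime).one_lt
  have hD0 := norm_pos_iff.2 hD
  rw [val, if_neg hD, absVal_eq_norm, ← EReal.coe_coe_eq_natCast, ← EReal.coe_mul,
    EReal.coe_lt_coe_iff] at h
  rw [← Real.lt_logb_iff_rpow_lt hp (pow_pos hD0 r), Real.logb_pow]
  linarith

end Val

end

section

open Metric Polynomial
open scoped ENNReal

/-! ### The main theorem -/

section Normed

variable {p : ℕ} [Fact p.Prime] {m : ℕ} {K : Fin m → Type*}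
  [∀ i, NormedField (K i)] [∀ i, NormedAlgebra ℚ_[p] (K i)] [∀ i, FiniteDimensional ℚ_[p] (K i)]
  [∀ i, IsUltrametricDist (K i)] [∀ i, Algebra ℤ_[p] (K i)]
  [∀ i, IsScalarTower ℤ_[p] ℚ_[p] (K i)] {x : ∀ i, K i}

theorem norm_le_one_of_isIntegral (hx : IsIntegral ℤ_[p] x) : ‖x‖ ≤ 1 :=
  (pi_norm_le_iff_of_nonneg zero_le_one).2 fun i => (mem_integers_iff_norm (x i)).1
    (hx.map (Pi.evalAlgHom ℤ_[p] K i))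

theorem aeval_charpoly_eq (z : ∀ i, K i) {n : ℕ} (A : Matrix (Fin n) (Fin n) ℤ_[p]) (i : Fin m) :
    aeval (z i) A.charpoly =
      z i ^ n - theta p n z (charCoeff (A.map PadicInt.Coe.ringHom)) i := by
  rw [← aeval_map_algebraMap ℚ_[p]]
  have h1 : A.charpoly.map (algebraMap ℤ_[p] ℚ_[p]) = (A.map PadicInt.Coe.ringHom).charpoly :=
    (Matrix.charpoly_map A PadicInt.Coe.ringHom).symm
  rw [h1, charpoly_eq, map_sub, map_pow, aeval_X, aeval_polyOf, theta_apply_pi]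

variable {π : ∀ i, (K i)ˣ}

/-- The probability that the characteristic polynomial of a random integral matrix is small at
`x`, in terms of the number of normalized stable lattices. -/
theorem probability_mul_eq {n : ℕ} (hn : Fintype.card (Node p K) = n + 1) (hx1 : ‖x‖ ≤ 1)
    (hinj : Function.Injective (node (p := p) x)) (hπ : ∀ i, IsUniformizer p (π i))
    [MeasurableSpace (Matrix (Fin (n + 1)) (Fin (n + 1)) ℤ_[p])]
    [BorelSpace (Matrix (Fin (n + 1)) (Fin (n + 1)) ℤ_[p])]
    (P : Measure (Matrix (Fin (n + 1)) (Fin (n + 1)) ℤ_[p])) [P.IsAddHaarMeasure]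
    [IsProbabilityMeasure P] (k : Fin m → ℕ)
    (hk : ∀ i, ‖(π i : K i)‖ ^ k i < ‖disc p x‖ ^ (n + 1)) :
    P.real {A | ∀ i, ‖aeval (x i) A.charpoly‖ ≤ ‖(π i : K i)‖ ^ k i} *
        ∏ i, (1 - ‖(π i : K i)‖ ^ Module.finrank ℚ_[p] (K i)) =
      (NormLat p x).ncard * (∏ k ∈ Finset.Icc 1 (n + 1), (1 - ((p : ℝ) ^ k)⁻¹)) *
        ∏ i, ‖(π i : K i)‖ ^ (k i * Module.finrank ℚ_[p] (K i)) := by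
  let : ∀ i, MeasurableSpace (K i) := fun i => borel (K i)
  have : ∀ i, BorelSpace (K i) := fun i => ⟨rfl⟩
  have hprop : ∀ i, ProperSpace (K i) := fun i => FiniteDimensional.proper ℚ_[p] (K i)
  let μ : ∀ i, Measure (K i) := fun i => Measure.addHaar
  let ν : Measure (∀ i, K i) := Measure.pi μ
  obtain ⟨-, -, hs⟩ := sep_of_injective hinj hx1
  obtain ⟨hd2, hd3⟩ := norm_disc_pow_le hinj hx1 hn
  have hcore := volume_charpoly_small ν hs hx1 hn (ρ := fun i => ‖(π i : K i)‖ ^ k i)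
    (fun i => pow_pos (hπ i).norm_pos _) (fun i => (hk i).trans_le hd2)
    (fun i => (hk i).le.trans hd3)
  have hpi : ∀ t : ∀ i, Set (K i), ν {e | ∀ i, e i ∈ t i} = ∏ i, μ i (t i) := by
    intro t
    rw [← Measure.pi_pi]
    congr 1
    ext e
    simp
  have hunit : ∀ i, μ i {e | ‖e‖ ≤ 1} ≠ 0 ∧ μ i {e | ‖e‖ ≤ 1} ≠ ∞ := by
    intro i
    have : {e : K i | ‖e‖ ≤ 1} = closedBall 0 1 := by ext e; simp
    rw [this]
    exact ⟨(measure_closedBall_pos _ _ one_pos).ne', (isCompact_closedBall 0 1).measure_ne_top⟩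
  have hdet := measure_norm_det_eq_one P
  have hIG : P {A | ‖A.det‖ = 1} = volume (IntGL p (n + 1)) := by
    rw [IntGL_eq]
    refine Eq.trans ?_ (measure_eq_volume P {B | ‖B.det‖ = 1})
    congr 1
    ext A
    change ‖A.det‖ = 1 ↔ ‖(A.map PadicInt.Coe.ringHom).det‖ = 1
    rw [← RingHom.mapMatrix_apply, ← RingHom.map_det]
    rfl
  have hPS : P {A | ∀ i, ‖aeval (x i) A.charpoly‖ ≤ ‖(π i : K i)‖ ^ k i} =
      volume {A ∈ Mat0 p (n + 1) | ∀ i, ‖x i ^ (n + 1) - theta p (n + 1) x (charCoeff A) i‖ ≤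
        ‖(π i : K i)‖ ^ k i} := by
    refine Eq.trans ?_ (measure_eq_volume P {A | ∀ i,
      ‖x i ^ (n + 1) - theta p (n + 1) x (charCoeff A) i‖ ≤ ‖(π i : K i)‖ ^ k i})
    congr 1
    ext A
    exact forall_congr' fun i => by rw [aeval_charpoly_eq]
  have h1 := hpi fun i => {e | ‖e‖ = 1}
  have h2 := hpi fun i => {e | ‖e‖ ≤ ‖(π i : K i)‖ ^ k i}
  simp only [Set.mem_ofPred_eq, (hπ _).measure_norm_eq_one, (hπ _).measure_norm_le,
    Finset.prod_mul_distrib] at h1 h2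
  rw [h1, h2, ← hPS, ← hIG, hdet, ← mul_assoc, ← mul_assoc] at hcore
  have hprod0 : ∏ i, μ i {e | ‖e‖ ≤ 1} ≠ 0 := Finset.prod_ne_zero_iff.2 fun i _ => (hunit i).1
  have hprod1 : ∏ i, μ i {e | ‖e‖ ≤ 1} ≠ ∞ := ENNReal.prod_ne_top fun i _ => (hunit i).2
  have h3 := congrArg ENNReal.toReal ((ENNReal.mul_left_inj hprod0 hprod1).1 hcore)
  have hp1 : (1 : ℝ) ≤ p := by exact_mod_cast (Fact.out : p.Prime).one_le
  have hG0 : 0 ≤ ∏ k ∈ Finset.Icc 1 (n + 1), (1 - ((p : ℝ) ^ k)⁻¹) :=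
    Finset.prod_nonneg fun k _ => sub_nonneg.2 (inv_le_one_of_one_le₀ (one_le_pow₀ hp1))
  rw [ENNReal.toReal_mul, ENNReal.toReal_mul, ENNReal.toReal_mul, ENNReal.toReal_natCast,
    ENNReal.toReal_ofReal hG0, ENNReal.toReal_prod, ENNReal.toReal_prod] at h3
  have h4 : ∀ i, 0 ≤ 1 - ‖(π i : K i)‖ ^ Module.finrank ℚ_[p] (K i) := fun i =>
    sub_nonneg.2 (pow_le_one₀ (norm_nonneg _) (hπ i).norm_lt_one.le)
  simp only [ENNReal.toReal_ofReal (h4 _), ENNReal.toReal_ofReal (pow_nonneg (norm_nonneg _) _)]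
    at h3
  exact h3

theorem card_node_ne_zero (i : Fin m) : Fintype.card (Node p K) ≠ 0 := by
  obtain ⟨σ, -⟩ := exists_node (p := p) (K := K) i
  exact fun h => (Fintype.card_eq_zero_iff.1 h).false ⟨i, σ⟩

theorem V_eq {L : Type*} [NormedField L] [NormedAlgebra ℚ_[p] L] [FiniteDimensional ℚ_[p] L]
    [IsUltrametricDist L] [Algebra ℤ_[p] L] [IsScalarTower ℤ_[p] ℚ_[p] L] {ϖ : Lˣ}
    (hϖ : IsUniformizer p ϖ) {z : L}
    (hz : Nat.card (LatticeOrbits p ϖ z) = (NormLat1 p z).ncard) :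
    V p ϖ z = (NormLat1 p z).ncard * ‖deltaSigma p fun _ : Unit => z‖ /
      (1 - ‖(ϖ : L)‖ ^ Module.finrank ℚ_[p] L) := by
  rw [V, hz, hϖ.norm_pow_eq_rpow]

theorem main_normed (r : ℕ) (hr : Module.finrank ℚ_[p] (∀ i, K i) = r) (x : ∀ i, K i)
    (hx_int : IsIntegral ℤ_[p] x) (hx_gen : Algebra.adjoin ℚ_[p] {x} = ⊤) (π : ∀ i, (K i)ˣ)
    (hπ : ∀ i, IsUniformizer p (π i)) [MeasurableSpace (Matrix (Fin r) (Fin r) ℤ_[p])]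
    [BorelSpace (Matrix (Fin r) (Fin r) ℤ_[p])] (P : Measure (Matrix (Fin r) (Fin r) ℤ_[p]))
    [P.IsAddHaarMeasure] [IsProbabilityMeasure P] (s : Fin m → ℝ)
    (hs : ∀ i, ∃ k : ℕ, s i = (k : ℝ) / (ramIndex p (K i) : ℝ))
    (hs_large : ∀ i, (r : EReal) * val p (disc p x) < (s i : EReal)) :
    (∀ i, Finite (LatticeOrbits p (π i) (x i))) ∧
    (∏ i, (p : ℝ) ^ (s i * (Module.finrank ℚ_[p] (K i) : ℝ))) *
        P.real {A | ∀ i, (s i : EReal) ≤ val p (aeval (x i) A.charpoly)} =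
      (∏ k ∈ Finset.Icc 1 r, (1 - ((p : ℝ) ^ k)⁻¹)) / ‖deltaSigma p x‖ *
        ∏ i, V p (π i) (x i) := by
  have hp : (0 : ℝ) < p := by exact_mod_cast (Fact.out : p.Prime).pos
  have hx1 := norm_le_one_of_isIntegral hx_int
  have hinj := node_injective hx_gen
  have hn : Fintype.card (Node p K) = r := card_node.trans hr
  obtain ⟨hd0, -, hsep⟩ := sep_of_injective hinj hx1
  have hcard := fun i => card_latticeOrbits (hπ i) (hsep.finite_normLat1 hx1 rfl i)
    fun M hM => hsep.isLattice_normLat1 hx1 rfl hM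
  refine ⟨fun i => (hcard i).1, ?_⟩
  simp only [V_eq (hπ _) (hcard _).2]
  choose k hk using hs
  have hρ : ∀ i, (p : ℝ) ^ (-s i) = ‖(π i : K i)‖ ^ k i := fun i => by
    rw [hk, (hπ i).norm_pow_eq_rpow]
  have hδ := ncard_normLat_mul_norm_deltaSigma hsep hx1
  rcases r with _ | n
  -- If `r = 0` there are no factors and both sides equal `1`. The case is separate because
  -- companion matrices need positive size.
  · have hm : IsEmpty (Fin m) := ⟨fun i => card_node_ne_zero i hn⟩
    have hone : ∀ f : Fin m → ℝ, ∏ i, f i = 1 := fun f => Fintype.prod_empty f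
    have huniv : {A : Matrix (Fin 0) (Fin 0) ℤ_[p] |
        ∀ i, (s i : EReal) ≤ val p (aeval (x i) A.charpoly)} = Set.univ :=
      Set.eq_univ_of_forall fun A i => isEmptyElim i
    have hdelta : ‖deltaSigma p x‖ = 1 := by
      have h1 := norm_deltaSigma_sq hinj
      have h2 : IsEmpty (Node p K) := Fintype.card_eq_zero_iff.1 hn
      rw [deltaSq, Fintype.prod_empty] at h1
      exact (pow_eq_one_iff_of_nonneg (norm_nonneg _) two_ne_zero).1 h1
    rw [hone, hone, huniv, probReal_univ, hdelta]
    simp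
  · have hset : {A : Matrix (Fin (n + 1)) (Fin (n + 1)) ℤ_[p] |
        ∀ i, (s i : EReal) ≤ val p (aeval (x i) A.charpoly)} =
        {A | ∀ i, ‖aeval (x i) A.charpoly‖ ≤ ‖(π i : K i)‖ ^ k i} := by
      ext A
      exact forall_congr' fun i => by rw [le_val_iff, hρ]
    have key := probability_mul_eq hn hx1 hinj hπ P k fun i => by
      rw [← hρ]
      exact rpow_neg_lt_of_val_lt (norm_pos_iff.1 hd0) (hs_large i)
    rw [hset, Finset.prod_div_distrib, ← hδ]
    have h1 : (∏ i, (p : ℝ) ^ (s i * (Module.finrank ℚ_[p] (K i) : ℝ))) *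
        ∏ i, ‖(π i : K i)‖ ^ (k i * Module.finrank ℚ_[p] (K i)) = 1 := by
      rw [← Finset.prod_mul_distrib]
      refine Finset.prod_eq_one fun i _ => ?_
      rw [pow_mul, ← hρ, ← Real.rpow_natCast, ← Real.rpow_mul hp.le, ← Real.rpow_add hp, neg_mul,
        add_neg_cancel, Real.rpow_zero]
    have h2 : ∏ i, (1 - ‖(π i : K i)‖ ^ Module.finrank ℚ_[p] (K i)) ≠ 0 := by
      refine Finset.prod_ne_zero_iff.2 fun i _ => (sub_pos.2 ?_).ne'
      exact pow_lt_one₀ (norm_nonneg _) (hπ i).norm_lt_one Module.finrank_pos.ne'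
    have h3 : ‖deltaSigma p x‖ ≠ 0 := norm_ne_zero_iff.2 (deltaSigma_ne_zero hinj)
    rw [div_mul_div_comm, eq_div_iff (mul_ne_zero h3 h2)]
    linear_combination (‖deltaSigma p x‖ *
      ∏ i, (p : ℝ) ^ (s i * (Module.finrank ℚ_[p] (K i) : ℝ))) * key +
      (‖deltaSigma p x‖ * (NormLat p x).ncard *
        ∏ k ∈ Finset.Icc 1 (n + 1), (1 - ((p : ℝ) ^ k)⁻¹)) * h1

end Normed

end

end PadicEtale

end

theorem mainTheorem1 (p : ℕ) [Fact p.Prime] {m : ℕ} (K : Fin m → Type*) [∀ i, Field (K i)]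
    [∀ i, Algebra ℚ_[p] (K i)] [∀ i, FiniteDimensional ℚ_[p] (K i)]
    [∀ i, Algebra ℤ_[p] (K i)] [∀ i, IsScalarTower ℤ_[p] ℚ_[p] (K i)]
    (r : ℕ) (hr : Module.finrank ℚ_[p] (∀ i, K i) = r)
    (x : ∀ i, K i) (hx_int : IsIntegral ℤ_[p] x) (hx_gen : Algebra.adjoin ℚ_[p] {x} = ⊤)
    (π : ∀ i, (K i)ˣ) (hπ : ∀ i, PadicEtale.IsUniformizer p (π i))
    [MeasurableSpace (Matrix (Fin r) (Fin r) ℤ_[p])] [BorelSpace (Matrix (Fin r) (Fin r) ℤ_[p])]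
    (P : Measure (Matrix (Fin r) (Fin r) ℤ_[p])) [P.IsAddHaarMeasure] [IsProbabilityMeasure P]
    (s : Fin m → ℝ) (hs : ∀ i, ∃ k : ℕ, s i = (k : ℝ) / (PadicEtale.ramIndex p (K i) : ℝ))
    (hs_large : ∀ i, (r : EReal) * PadicEtale.val p (PadicEtale.disc p x) < (s i : EReal)) :
    (∀ i, Finite (PadicEtale.LatticeOrbits p (π i) (x i))) ∧
    (∏ i, (p : ℝ) ^ (s i * (Module.finrank ℚ_[p] (K i) : ℝ))) *
        P.real {A | ∀ i, (s i : EReal) ≤ PadicEtale.val p (Polynomial.aeval (x i) A.charpoly)} =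
      (∏ k ∈ Finset.Icc 1 r, (1 - ((p : ℝ) ^ k)⁻¹)) / ‖PadicEtale.deltaSigma p x‖ *
        ∏ i, PadicEtale.V p (π i) (x i) := by
  -- The fields carry no norm in the statement; the spectral norm, through which `absVal` is
  -- defined, provides one.
  let hN : ∀ i, NormedField (K i) := fun i => spectralNorm.normedField ℚ_[p] (K i)
  let hA : ∀ i, NormedAlgebra ℚ_[p] (K i) := fun i => spectralNorm.normedAlgebra ℚ_[p] (K i)
  have hU : ∀ i, IsUltrametricDist (K i) := fun i =>
    IsUltrametricDist.isUltrametricDist_of_isNonarchimedean_norm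
      (isNonarchimedean_spectralNorm (K := ℚ_[p]) (L := K i))
  exact PadicEtale.main_normed r hr x hx_int hx_gen π hπ P s hs hs_large
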